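/- **Setting.** Let $U$ be a compact metric space, $f:U\times\mathbb R^m\to\mathbb R^m$, $g:U\times\mathbb R^m\times\mathbb R^n\to\mathbb R^n$ and $G:U\times\mathbb R^m\times\mathbb R^n\to\mathbb R$ continuous, $f$ Lipschitz in $y$ and $g$ Lipschitz in $(y,z)$, uniformly in $u$, and let $Y\subset\mathbb R^m$, $Z\subset\mathbb R^n$ be compact. For $\epsilon>0$ consider the singularly perturbed (SP) weakly coupled system $$\epsilon y'(t)=f(u(t),y(t)),\qquad z'(t)=g(u(t),y(t),z(t)),\qquad t\ge 0 .$$ Controls are measurable, solutions are absolutely continuous, and equations hold a.e. A triplet $(u,y,z)$ is admissible if $(y(t),z(t))\in Y\times Z$ for all $t\ge0$, and $V^*(\epsilon)$ is the infimum of $\liminf_{T\to\infty}\frac1T\int_0^TG(u,y,z)\,dt$ over admissible triplets. A pair $(u,y)$ is admissible for the associated system if $y'(\tau)=f(u(\tau),y(\tau))$ and $y(\tau)\in Y$ for $\tau\ge0$. Spaces $\mathcal P(X)$ of probability measures on compact metric spaces carry the weak topology, and $\rho$ is a metric for it. A function $x(\cdot)$ generates the occupational measure $\nu$ (on $[0,\infty)$)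 if $\frac1T\int_0^Th(x(t))\,dt\to\int h\,d\nu$ for every continuous $h$. Put $$\tilde h(\mu,z)=\int_{U\times Y}h(u,y,z)\,\mu(du,dy),$$ $$W=\Big\{\mu\in\mathcal P(U\times Y):\int\nabla\phi(y)^Tf(u,y)\,d\mu=0\ \ \forall\phi\in C^1(\mathbb R^m)\Big\},\qquad F=W\times Z .$$ A pair $(\mu(\cdot),z(\cdot))$ is admissible for the averaged system if $\mu(\cdot)$ is measurable, $z'(t)=\tilde g(\mu(t),z(t))$ and $\mu(t)\in W$ for a.e. $t$, and $z(t)\in Z$ for all $t\ge0$; $\tilde V^*$ is the infimum of $\liminf_{T\to\infty}\frac1T\int_0^T\tilde G(\mu(t),z(t))\,dt$ over these pairs. Let $\tilde{\mathcal W}$ be the set of $p\in\mathcal P(F)$ with $\int_F\nabla\psi(z)^T\tilde g(\mu,z)\,dp=0$ for all $\psi\in C^1(\mathbb R^n)$, and $\tilde G^*=\inf_{p\in\tilde{\mathcal W}}\int_F\tilde G\,dp$ (the averaged LP problem). For $p\in\mathcal P(F)$, $\Phi(p)\in\mathcal P(U\times Y\times Z)$ is defined by $\int h\,d\Phi(p)=\int_F\tilde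 h\,dp$ for all continuous $h$. **The feedback.** Let $\psi_1,\psi_2,\dots\in C^1(\mathbb R^n)$ and $\phi_1,\phi_2,\dots\in C^1(\mathbb R^m)$ be sequences whose linear combinations approximate every $C^1$ function together with its gradient, uniformly on compact sets. For $N,M\ge1$ let $W_M$ be defined as $W$ with only $\phi_1,\dots,\phi_M$ as test functions, let $F_M=W_M\times Z$, and let $\tilde G^{N,M}$ be the infimum of $\int_{F_M}\tilde G\,dp$ over $p\in\mathcal P(F_M)$ with $\int_{F_M}\nabla\psi_i(z)^T\tilde g\,dp=0$, $i\le N$. Assume that for all $N,M\ge1$ there are a function $\zeta^{N,M}\in\mathrm{span}(\psi_1,\dots,\psi_N)$ with $\tilde G^{N,M}\le\tilde G(\mu,z)+\nabla\zeta^{N,M}(z)^T\tilde g(\mu,z)$ on $F_M$, and, for each $z\in Z$, a function $\eta_z^{N,M}\in\mathrm{span}(\phi_1,\dots,\phi_M)$ that attains $$\sup_{\eta\in\mathrm{span}(\phi_1,\dots,\phi_M)}\ \min_{(u,y)\in U\times Y}\{G(u,y,z)+\nabla\zeta^{N,M}(z)^Tg(u,y,z)+\nabla\eta(y)^Tf(u,y)\}.$$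 For $(y,z)\in Y\times Z$ let $u^{N,M}(y,z)$ be a minimizer over $u\in U$ of $$G(u,y,z)+\nabla\zeta^{N,M}(z)^Tg(u,y,z)+\nabla\eta_z^{N,M}(y)^Tf(u,y). \tag{1}$$ Assume that for all $z\in Z$, $y_0\in Y$ the closed loop system $y'(\tau)=f(u^{N,M}(y(\tau),z),y(\tau))$, $y(0)=y_0$, has a unique solution in $Y$. For each $z\in Z$ fix an initial value in $Y$, let $y_z^{N,M}(\cdot)$ be the corresponding solution and $u_z^{N,M}(\tau)=u^{N,M}(y_z^{N,M}(\tau),z)$. **Assumptions.** 1. The averaged LP problem has a unique optimal solution $p^*$, and $\tilde V^*=\tilde G^*$. The averaged problem has an optimal pair $(\mu^*(\cdot),z^*(\cdot))$; the limit of $\frac1T\int_0^T\tilde h(\mu^*(t),z^*(t))\,dt$ as $T\to\infty$ exists for every continuous $\tilde h$ on $F$; and for a.e. $t$, $p^*$ charges each ball $\{(\mu,z):\rho(\mu,\mu^*(t))+\|z-z^*(t)\|<r\}$, $r>0$. 2. For a.e. $t$, $\mu^*(t)$ is generated by a pair $(u_t^*(\cdot),y_t^*(\cdot))$ that is admissible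 for the associated system, and for a.e. $\tau$ it charges each ball centered at $(u_t^*(\tau),y_t^*(\tau))$. 3. For all $N,M$: $(u_z^{N,M},y_z^{N,M})_{z\in Z}$ is an average control generating (ACG) family. That is, for each $z\in Z$ the pair is admissible for the associated system and generates a measure $\mu^{N,M}(z)$; for each continuous $h(u,y,z)$, $\tilde h(\mu^{N,M}(z),z)$ is measurable in $z$ and $\frac1S\int_0^Sh(u_z^{N,M},y_z^{N,M},z)\,d\tau\to\tilde h(\mu^{N,M}(z),z)$ as $S\to\infty$, uniformly in $z\in Z$; the equation $z'=\tilde g(\mu^{N,M}(z),z)$, $z(0)=z^*(0)$, has a unique solution $z^{N,M}(\cdot)$ in $Z$; and, with $\mu^{N,M}(t):=\mu^{N,M}(z^{N,M}(t))$, the pair $(\mu^{N,M}(\cdot),z^{N,M}(\cdot))$ generates a measure $\lambda^{N,M}\in\mathcal P(F)$. Moreover, $\lambda^{N,M}$ is generated also from all initial values in $Z$ in some neighbourhood of $z^*([0,\infty))$, and, for a.e. $t$, $\mu^{N,M}(z^*(t))$ is generated also by the closed loop solutions for $z=z^*(t)$ from all initial values in $Y$ in some neighbourhood of $y^*_t([0,\infty))$.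 4. For a.e. $t$ there is an open ball $Q_t$ centered at $z^*(t)$ such that for all $N,M$, on $Q_t\cap Z$, $\mu^{N,M}(\cdot)$ has a modulus of continuity with respect to $\rho$ and $z\mapsto\tilde g(\mu^{N,M}(z),z)$ is Lipschitz; and $\lim_{N\to\infty}\limsup_{M\to\infty}\mathrm{meas}\{t'\in[0,t]:z^{N,M}(t')\notin Q_{t'}\}=0$ for all $t>0$. 5. For a.e. $t$ and a.e. $\tau$ there is an open ball $B_{t,\tau}$ centered at $y_t^*(\tau)$ such that for all $N,M$, for $(y,z)\in(B_{t,\tau}\cap Y)\times(Q_t\cap Z)$, the minimizer of (1) is unique and $u^{N,M}(y,z)$ is Lipschitz in $(y,z)$; and, for a.e. $t$ and the closed loop solutions $y_t^{N,M}(\cdot)$ for $z=z^*(t)$ starting at $y_t^*(0)$, $\lim_{N\to\infty}\limsup_{M\to\infty}\mathrm{meas}\{\tau'\in[0,\tau]:y_t^{N,M}(\tau')\notin B_{t,\tau'}\}=0$ for all $\tau>0$. 6. There are positive definite matrices $A_1,A_2$ such that $(f(u,y')-f(u,y''))^TA_1(y'-y'')\le-\|y'-y''\|^2$ for all $u\in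 U$, $y',y''\in\mathbb R^m$, and $(\tilde g(\mu,z')-\tilde g(\mu,z''))^TA_2(z'-z'')\le-\|z'-z''\|^2$ for all $\mu\in W$, $z',z''\in\mathbb R^n$. Fix $N,M\ge1$. For a function $h(u,y,z)$ and a set $D\subset(0,\infty)$, say that $\tilde h$ is *piecewise continuous along $\mu^{N,M}(\cdot)$ off $D$* if there are a nondecreasing $\nu$ with $\nu(\theta)\to0$ as $\theta\downarrow0$ and numbers $a_t$ ($t\ge0$) with $a_t>0$ for $t\notin D$ such that $\|\tilde h(\mu^{N,M}(t'),z)-\tilde h(\mu^{N,M}(t),z)\|\le\nu(|t-t'|)$ for all $t\notin D$, $|t'-t|<a_t$ ($t,t'\ge0$), $z\in Z$, and $\inf\{a_t:t\notin\bigcup_{s\in D}(s-\delta,s+\delta)\}>0$ for each $\delta>0$. Call $D$ *linearly sparse* if there is $c$ such that $D$ has at most $cT$ points in $(0,T)$ for every $T>0$. 7. There is a linearly sparse $D$ such that $\tilde g$ and $\tilde G$ are piecewise continuous along $\mu^{N,M}(\cdot)$ off $D$. **Theorem.** Let assumptions 1–7 hold. Let $\Delta(\epsilon)>0$, $\Delta(\epsilon)\to0$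 and $\Delta(\epsilon)/\epsilon\to\infty$ as $\epsilon\downarrow0$, put $t_l=l\Delta(\epsilon)$ and $$u_\epsilon^{N,M}(t)=u^{N,M}_{z^{N,M}(t_l)}\Big(\frac{t-t_l}\epsilon\Big),\qquad t\in[t_l,t_{l+1}),\ l=0,1,\dots,$$ and let $(y_\epsilon^{N,M},z_\epsilon^{N,M})$ be the solution of the SP system with this control and with $z_\epsilon^{N,M}(0)=z^{N,M}(0)$, $y_\epsilon^{N,M}(0)=y_0$, where $y_0$ does not depend on $\epsilon$. Assume that the resulting triplet is admissible for all small $\epsilon$. Then: (a) the limit $\tilde V^{N,M}=\lim_{T\to\infty}\frac1T\int_0^T\tilde G(\mu^{N,M}(t),z^{N,M}(t))\,dt$ exists, and $u_\epsilon^{N,M}$ is $\beta(N,M)$-asymptotically near optimal with $\beta(N,M)=\tilde V^{N,M}-\tilde G^*$: the limit on the left below exists and $$\lim_{\epsilon\to0}\liminf_{T\to\infty}\frac1T\int_0^TG(u_\epsilon^{N,M},y_\epsilon^{N,M},z_\epsilon^{N,M})\,dt\le\liminf_{\epsilon\to0}V^*(\epsilon)+\beta(N,M);$$ (b) if, in addition,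 for some $c$ the set $D$ has at most $cT$ points in every interval $(s,s+T)$ with $s\ge0$, $T\ge1$, then $\lim_{\epsilon\to0}\sup_{t\ge0}\|z_\epsilon^{N,M}(t)-z^{N,M}(t)\|=0$; (c) if, in addition, for every Lipschitz continuous $h:U\times\mathbb R^m\times\mathbb R^n\to\mathbb R$ the function $\tilde h$ is piecewise continuous along $\mu^{N,M}(\cdot)$ off some linearly sparse set (which may depend on $h$), then there is a function $\kappa$ with $\kappa(\epsilon)\to0$ as $\epsilon\downarrow0$ such that, for all small $\epsilon$, if the triplet $(u_\epsilon^{N,M},y_\epsilon^{N,M},z_\epsilon^{N,M})$ generates an occupational measure $\gamma_\epsilon^{N,M}$, then $\rho(\gamma_\epsilon^{N,M},\Phi(\lambda^{N,M}))\le\kappa(\epsilon)$. -/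

import Mathlib

open MeasureTheory Filter Topology Set
open scoped NNReal ENNReal Matrix

namespace SPAverage

noncomputable section

/-- The Euclidean space `ℝᵏ`. -/
abbrev Euc (k : ℕ) := EuclideanSpace ℝ (Fin k)

/-- The data of a weakly coupled singularly perturbed control problem
`ε y' = f(u,y)`, `z' = g(u,y,z)`, with running cost `G`, controls in the compact metric space `U`,
and compact state constraint sets `Y` and `Z`. -/
structure SPSystem (U : Type*) [MetricSpace U] (m n : ℕ) where
  f : U → Euc m → Euc m
  g : U → Euc m → Euc n → Euc n
  G : U → Euc m → Euc n → ℝ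
  Y : Set (Euc m)
  Z : Set (Euc n)
  continuous_f : Continuous fun q : U × Euc m => f q.1 q.2
  continuous_g : Continuous fun q : U × Euc m × Euc n => g q.1 q.2.1 q.2.2
  continuous_G : Continuous fun q : U × Euc m × Euc n => G q.1 q.2.1 q.2.2
  lipschitz_f : ∃ K : ℝ≥0, ∀ u, LipschitzWith K (f u)
  lipschitz_g : ∃ K : ℝ≥0, ∀ u, LipschitzWith K fun q : Euc m × Euc n => g u q.1 q.2
  isCompact_Y : IsCompact Y
  isCompact_Z : IsCompact Z

/-- `x` is an absolutely continuous function on `[0,∞)` with `x' = v` almost everywhere. -/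
def IsPrimitive {E : Type*} [NormedAddCommGroup E] [NormedSpace ℝ E] (v x : ℝ → E) : Prop :=
  ∀ t, 0 ≤ t → IntervalIntegrable v volume 0 t ∧ x t = x 0 + ∫ s in (0 : ℝ)..t, v s

/-- The time average `(1/T) ∫₀ᵀ h(t) dt`. -/
def timeAvg (h : ℝ → ℝ) (T : ℝ) : ℝ := T⁻¹ * ∫ t in (0 : ℝ)..T, h t

/-- The metric used on spaces of probability measures (it metrizes weak convergence). -/
def rho {X : Type*} [MeasurableSpace X] [PseudoEMetricSpace X] (μ ν : ProbabilityMeasure X) : ℝ :=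
  levyProkhorovDist (μ : Measure X) (ν : Measure X)

/-- `ψ 0, ψ 1, …` are `C¹` functions whose linear combinations approximate every `C¹` function
together with its gradient, uniformly on compact sets. -/
def IsC1Dense {k : ℕ} (ψ : ℕ → Euc k → ℝ) : Prop :=
  (∀ i, ContDiff ℝ 1 (ψ i)) ∧
  ∀ ζ : Euc k → ℝ, ContDiff ℝ 1 ζ → ∀ K : Set (Euc k), IsCompact K → ∀ δ > 0,
    ∃ (N : ℕ) (c : ℕ → ℝ), ∀ x ∈ K,
      |ζ x - ∑ i ∈ Finset.range N, c i * ψ i x| < δ ∧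
      ‖fderiv ℝ ζ x - ∑ i ∈ Finset.range N, c i • fderiv ℝ (ψ i) x‖ < δ

section System

variable {U : Type*} [MetricSpace U] [MeasurableSpace U]
variable {m n : ℕ} (S : SPSystem U m n)

/-! ### The singularly perturbed problem -/

/-- Admissible triplets of the singularly perturbed system with parameter `ε`. -/
structure IsAdmissibleSP (ε : ℝ) (u : ℝ → U) (y : ℝ → Euc m) (z : ℝ → Euc n) : Prop where
  measurable_control : AEMeasurable u (volume.restrict (Ici 0))
  fast : IsPrimitive (fun t => ε⁻¹ • S.f (u t) (y t)) y
  slow : IsPrimitive (fun t => S.g (u t) (y t) (z t)) z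
  mem : ∀ t, 0 ≤ t → y t ∈ S.Y ∧ z t ∈ S.Z

/-- The long run average cost of a triplet. -/
def costSP (u : ℝ → U) (y : ℝ → Euc m) (z : ℝ → Euc n) : ℝ :=
  liminf (timeAvg fun t => S.G (u t) (y t) (z t)) atTop

/-- The optimal value of the singularly perturbed problem. -/
def valueSP (ε : ℝ) : ℝ :=
  sInf {v | ∃ u y z, IsAdmissibleSP S ε u y z ∧ v = costSP S u y z}

/-- The controls `u ε`, with corresponding solutions `(y ε, z ε)`, are asymptotically `α`-near
optimal in the singularly perturbed problem. -/
def IsAsymptoticallyNearOptimal (α : ℝ) (u : ℝ → ℝ → U) (y : ℝ → ℝ → Euc m)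
    (z : ℝ → ℝ → Euc n) : Prop :=
  (∀ᶠ ε in 𝓝[>] (0 : ℝ), IsAdmissibleSP S ε (u ε) (y ε) (z ε)) ∧
  ∃ l : ℝ, Tendsto (fun ε => costSP S (u ε) (y ε) (z ε)) (𝓝[>] 0) (𝓝 l) ∧
    l ≤ liminf (fun ε => valueSP S ε) (𝓝[>] 0) + α

/-! ### The associated system and the averaged problem -/

/-- Admissible pairs of the associated system `y' = f(u,y)`. -/
structure IsAdmissibleAssoc (u : ℝ → U) (y : ℝ → Euc m) : Prop where
  measurable_control : AEMeasurable u (volume.restrict (Ici 0))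
  ode : IsPrimitive (fun τ => S.f (u τ) (y τ)) y
  mem : ∀ τ, 0 ≤ τ → y τ ∈ S.Y

/-- Probability measures on `U × Y`. -/
abbrev PUY := ProbabilityMeasure (U × S.Y)

/-- `h̃(μ,z) = ∫ h(u,y,z) μ(du,dy)`. -/
def tilde {E : Type*} [NormedAddCommGroup E] [NormedSpace ℝ E] (h : U → Euc m → Euc n → E)
    (μ : PUY S) (z : Euc n) : E :=
  ∫ q : U × S.Y, h q.1 q.2 z ∂(μ : Measure (U × S.Y))

/-- `W`: all `μ` with `∫ ∇φ(y)ᵀ f(u,y) μ(du,dy) = 0` for every `φ ∈ C¹(ℝᵐ)`. -/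
def W : Set (PUY S) :=
  {μ | ∀ φ : Euc m → ℝ, ContDiff ℝ 1 φ →
    ∫ q : U × S.Y, fderiv ℝ φ q.2 (S.f q.1 q.2) ∂(μ : Measure (U × S.Y)) = 0}

/-- `F = W × Z`. -/
def F : Set (PUY S × Euc n) := {q | q.1 ∈ W S ∧ q.2 ∈ S.Z}

/-- Admissible pairs of the averaged system `z' = g̃(μ,z)`, `μ(t) ∈ W`. -/
structure IsAdmissibleAvg (μ : ℝ → PUY S) (z : ℝ → Euc n) : Prop where
  measurable_control : AEMeasurable μ (volume.restrict (Ici 0))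
  control_mem : ∀ᵐ t ∂(volume.restrict (Ici (0 : ℝ))), μ t ∈ W S
  ode : IsPrimitive (fun t => tilde S S.g (μ t) (z t)) z
  mem : ∀ t, 0 ≤ t → z t ∈ S.Z

/-- The long run average cost of a pair of the averaged system. -/
def costAvg (μ : ℝ → PUY S) (z : ℝ → Euc n) : ℝ :=
  liminf (timeAvg fun t => tilde S S.G (μ t) (z t)) atTop

/-- The optimal value `Ṽ*` of the averaged problem. -/
def valueAvg : ℝ :=
  sInf {v | ∃ μ z, IsAdmissibleAvg S μ z ∧ v = costAvg S μ z}

/-- The feasible set of the averaged infinite dimensional LP problem. -/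
def WAvg : Set (ProbabilityMeasure (F S)) :=
  {p | ∀ ψ : Euc n → ℝ, ContDiff ℝ 1 ψ →
    ∫ q : F S, fderiv ℝ ψ q.1.2 (tilde S S.g q.1.1 q.1.2) ∂(p : Measure (F S)) = 0}

/-- `∫ G̃ dp`. -/
def costLP (p : ProbabilityMeasure (F S)) : ℝ :=
  ∫ q : F S, tilde S S.G q.1.1 q.1.2 ∂(p : Measure (F S))

/-- The optimal value `G̃*` of the averaged infinite dimensional LP problem. -/
def valueLP : ℝ := sInf (costLP S '' WAvg S)

/-! ### Occupational measures on `[0,∞)` -/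

/-- The pair `(u,y)` generates the occupational measure `μ`. -/
def GeneratesUY (u : ℝ → U) (y : ℝ → Euc m) (μ : PUY S) : Prop :=
  ∀ h : U × Euc m → ℝ, Continuous h →
    Tendsto (timeAvg fun τ => h (u τ, y τ)) atTop
      (𝓝 (∫ q : U × S.Y, h (q.1, q.2) ∂(μ : Measure (U × S.Y))))

/-- The triplet `(u,y,z)` generates the occupational measure `γ`. -/
def GeneratesUYZ (u : ℝ → U) (y : ℝ → Euc m) (z : ℝ → Euc n)
    (γ : ProbabilityMeasure (U × S.Y × S.Z)) : Prop :=
  ∀ h : U × Euc m × Euc n → ℝ, Continuous h →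
    Tendsto (timeAvg fun t => h (u t, y t, z t)) atTop
      (𝓝 (∫ q : U × S.Y × S.Z, h (q.1, q.2.1, q.2.2) ∂(γ : Measure (U × S.Y × S.Z))))

/-- `Φ(p) = γ`, that is, `∫ h dγ = ∫ h̃ dp` for every continuous `h`. -/
def IsPhi (p : ProbabilityMeasure (F S)) (γ : ProbabilityMeasure (U × S.Y × S.Z)) : Prop :=
  ∀ h : U × Euc m × Euc n → ℝ, Continuous h →
    ∫ q : U × S.Y × S.Z, h (q.1, q.2.1, q.2.2) ∂(γ : Measure (U × S.Y × S.Z)) =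
      ∫ q : F S, tilde S (fun u y z => h (u, y, z)) q.1.1 q.1.2 ∂(p : Measure (F S))

/-! ### The `(N,M)`-approximating problems -/

/-- `W_M`: only the test functions `φ 0, …, φ (M-1)` are used. -/
def WM (φ : ℕ → Euc m → ℝ) (M : ℕ) : Set (PUY S) :=
  {μ | ∀ i < M,
    ∫ q : U × S.Y, fderiv ℝ (φ i) q.2 (S.f q.1 q.2) ∂(μ : Measure (U × S.Y)) = 0}

/-- `F_M = W_M × Z`. -/
def FM (φ : ℕ → Euc m → ℝ) (M : ℕ) : Set (PUY S × Euc n) :=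
  {q | q.1 ∈ WM S φ M ∧ q.2 ∈ S.Z}

/-- The feasible set of the `(N,M)`-approximating averaged problem. -/
def WNM (ψ : ℕ → Euc n → ℝ) (φ : ℕ → Euc m → ℝ) (N M : ℕ) :
    Set (ProbabilityMeasure (FM S φ M)) :=
  {p | ∀ i < N, ∫ q : FM S φ M, fderiv ℝ (ψ i) q.1.2 (tilde S S.g q.1.1 q.1.2)
    ∂(p : Measure (FM S φ M)) = 0}

/-- The optimal value `G̃^{N,M}` of the `(N,M)`-approximating averaged problem. -/
def valueNM (ψ : ℕ → Euc n → ℝ) (φ : ℕ → Euc m → ℝ) (N M : ℕ) : ℝ :=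
  sInf ((fun p : ProbabilityMeasure (FM S φ M) =>
    ∫ q : FM S φ M, tilde S S.G q.1.1 q.1.2 ∂(p : Measure (FM S φ M))) '' WNM S ψ φ N M)

/-- The function `∑_{i<K} c i * θ i`. -/
def comb {k : ℕ} (θ : ℕ → Euc k → ℝ) (K : ℕ) (c : ℕ → ℝ) (x : Euc k) : ℝ :=
  ∑ i ∈ Finset.range K, c i * θ i x

/-- `G(u,y,z) + ∇ζ(z)ᵀ g(u,y,z) + ∇η(y)ᵀ f(u,y)`. -/
def lagrangian (ζ : Euc n → ℝ) (η : Euc m → ℝ) (u : U) (y : Euc m) (z : Euc n) : ℝ :=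
  S.G u y z + fderiv ℝ ζ z (S.g u y z) + fderiv ℝ η y (S.f u y)

/-- `ζ = ∑_{i<N} c i * ψ i` is a solution of the `(N,M)`-approximating averaged dual problem. -/
def IsAvgDualSolution (ψ : ℕ → Euc n → ℝ) (φ : ℕ → Euc m → ℝ) (N M : ℕ) (c : ℕ → ℝ) : Prop :=
  ∀ q ∈ FM S φ M,
    valueNM S ψ φ N M ≤
      tilde S S.G q.1 q.2 + fderiv ℝ (comb ψ N c) q.2 (tilde S S.g q.1 q.2)

/-- The optimal value of the `(N,M)`-approximating associated dual problem at `z`,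
for a given function `ζ`. -/
def valueAssocDual (φ : ℕ → Euc m → ℝ) (M : ℕ) (ζ : Euc n → ℝ) (z : Euc n) : ℝ :=
  sSup {θ : ℝ | ∃ w : ℕ → ℝ, ∀ u : U, ∀ y ∈ S.Y, θ ≤ lagrangian S ζ (comb φ M w) u y z}

/-- `η = ∑_{i<M} w i * φ i` is a solution of the `(N,M)`-approximating associated dual problem
at `z`, for a given function `ζ`. -/
def IsAssocDualSolution (φ : ℕ → Euc m → ℝ) (M : ℕ) (ζ : Euc n → ℝ) (z : Euc n)
    (w : ℕ → ℝ) : Prop :=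
  ∀ u : U, ∀ y ∈ S.Y, valueAssocDual S φ M ζ z ≤ lagrangian S ζ (comb φ M w) u y z

/-! ### The feedback constructed from the dual solutions -/

/-- `y` is a solution, staying in `Y`, of the associated system closed by the feedback
`v : Y → U` and starting at `y₀`. -/
def IsClosedLoop (v : Euc m → U) (y₀ : Euc m) (y : ℝ → Euc m) : Prop :=
  IsAdmissibleAssoc S (fun τ => v (y τ)) y ∧ y 0 = y₀

/-- The construction of the feedback controls `u^{N,M}(y,z)`: the test functions, solutions
`ζ^{N,M} = ∑ cζ i * ψ i` and `η_z^{N,M} = ∑ cη i * φ i` of the approximating averaged and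
associated dual problems, the minimizing feedback `v = u^{N,M}` determined by them, and the
solutions `traj N M z y₀` of the associated system closed by `u^{N,M}(·,z)`, starting at `y₀`. -/
structure FeedbackConstruction where
  ψ : ℕ → Euc n → ℝ
  φ : ℕ → Euc m → ℝ
  cζ : ℕ+ → ℕ+ → ℕ → ℝ
  cη : ℕ+ → ℕ+ → Euc n → ℕ → ℝ
  v : ℕ+ → ℕ+ → Euc m → Euc n → U
  traj : ℕ+ → ℕ+ → Euc n → Euc m → ℝ → Euc m
  dense_ψ : IsC1Dense ψ
  dense_φ : IsC1Dense φ
  dual_avg : ∀ N M : ℕ+, IsAvgDualSolution S ψ φ N M (cζ N M)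
  dual_assoc : ∀ N M : ℕ+, ∀ z ∈ S.Z,
    IsAssocDualSolution S φ M (comb ψ N (cζ N M)) z (cη N M z)
  minimizer : ∀ N M : ℕ+, ∀ y ∈ S.Y, ∀ z ∈ S.Z, ∀ u : U,
    lagrangian S (comb ψ N (cζ N M)) (comb φ M (cη N M z)) (v N M y z) y z ≤
      lagrangian S (comb ψ N (cζ N M)) (comb φ M (cη N M z)) u y z
  traj_spec : ∀ N M : ℕ+, ∀ z ∈ S.Z, ∀ y₀ ∈ S.Y,
    IsClosedLoop S (fun y => v N M y z) y₀ (traj N M z y₀)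
  traj_unique : ∀ N M : ℕ+, ∀ z ∈ S.Z, ∀ y₀ ∈ S.Y, ∀ y : ℝ → Euc m,
    IsClosedLoop S (fun y => v N M y z) y₀ y → ∀ τ, 0 ≤ τ → y τ = traj N M z y₀ τ

/-- The control `τ ↦ u^{N,M}(y(τ), z)` along the closed loop solution starting at `y₀`. -/
def FeedbackConstruction.ctrl {S : SPSystem U m n} (C : FeedbackConstruction S) (N M : ℕ+)
    (z : Euc n) (y₀ : Euc m) (τ : ℝ) : U :=
  C.v N M (C.traj N M z y₀ τ) z

/-! ### Average control generating families -/

/-- `z` is a solution, staying in `Z`, of `z' = g̃(μ(z), z)`. -/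
def IsFeedbackAvgSolution (μ : Euc n → PUY S) (z : ℝ → Euc n) : Prop :=
  IsPrimitive (fun t => tilde S S.g (μ (z t)) (z t)) z ∧ ∀ t, 0 ≤ t → z t ∈ S.Z

variable [BorelSpace U] [CompactSpace U]

/-- The pair `(μ(·),z(·))` generates the occupational measure `p` on `F`. -/
def GeneratesF (μ : ℝ → PUY S) (z : ℝ → Euc n) (p : ProbabilityMeasure (F S)) : Prop :=
  ∀ h : PUY S × Euc n → ℝ, Continuous h →
    Tendsto (timeAvg fun t => h (μ t, z t)) atTop (𝓝 (∫ q : F S, h q ∂(p : Measure (F S))))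

/-- The family `z ↦ (u z, y z)` of pairs of the associated system is average control generating;
`μ z` is the occupational measure generated by `(u z, y z)`, and `zt` is the solution of
`z' = g̃(μ(z), z)`, `z(0) = z₀`. -/
structure IsACGFamily (u : Euc n → ℝ → U) (y : Euc n → ℝ → Euc m) (μ : Euc n → PUY S)
    (z₀ : Euc n) (zt : ℝ → Euc n) : Prop where
  admissible : ∀ z ∈ S.Z, IsAdmissibleAssoc S (u z) (y z)
  generates : ∀ z ∈ S.Z, GeneratesUY S (u z) (y z) (μ z)
  measurable : ∀ h : U × Euc m × Euc n → ℝ, Continuous h →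
    Measurable fun z : S.Z => tilde S (fun u y z => h (u, y, z)) (μ z) z
  uniform : ∀ h : U × Euc m × Euc n → ℝ, Continuous h →
    ∃ φh : ℝ → ℝ, Tendsto φh atTop (𝓝 0) ∧ ∀ T > 0, ∀ z ∈ S.Z,
      |timeAvg (fun τ => h (u z τ, y z τ, z)) T
        - tilde S (fun u y z => h (u, y, z)) (μ z) z| ≤ φh T
  solution : IsFeedbackAvgSolution S μ zt ∧ zt 0 = z₀
  unique : ∀ w : ℝ → Euc n, IsFeedbackAvgSolution S μ w → w 0 = z₀ → ∀ t, 0 ≤ t → w t = zt t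
  limit : ∀ h : PUY S × Euc n → ℝ, Continuous h →
    ∃ l : ℝ, Tendsto (timeAvg fun t => h (μ (zt t), zt t)) atTop (𝓝 l)

/-! ### The assumptions on the optimal solutions and on the feedback -/

/-- Assumptions on the averaged problem: the LP problem has the unique optimal solution `ps`, its
value equals that of the averaged problem, `(μs,zs)` is an optimal pair of the averaged problem
along which long run averages exist, and `ps` charges each neighbourhood of `(μs(t),zs(t))`. -/
structure OptimalPairAssumption (μs : ℝ → PUY S) (zs : ℝ → Euc n)
    (ps : ProbabilityMeasure (F S)) : Prop where
  optimal : ps ∈ WAvg S ∧ costLP S ps = valueLP S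
  unique : ∀ p ∈ WAvg S, costLP S p = valueLP S → p = ps
  value_eq : valueAvg S = valueLP S
  admissible : IsAdmissibleAvg S μs zs
  attains : costAvg S μs zs = valueAvg S
  limit : ∀ h : PUY S × Euc n → ℝ, Continuous h →
    ∃ l : ℝ, Tendsto (timeAvg fun t => h (μs t, zs t)) atTop (𝓝 l)
  charged : ∀ᵐ t ∂(volume.restrict (Ici (0 : ℝ))), ∀ r > 0,
    0 < (ps : Measure (F S)) {q : F S | rho q.1.1 (μs t) + ‖q.1.2 - zs t‖ < r}

/-- Assumptions on the fast dynamics: for almost every `t`, `μs t` is the occupational measure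
generated by the admissible pair `(us t, ys t)` and charges each neighbourhood of almost every
point of this pair. -/
structure OptimalFastAssumption (μs : ℝ → PUY S) (us : ℝ → ℝ → U) (ys : ℝ → ℝ → Euc m) :
    Prop where
  generated : ∀ᵐ t ∂(volume.restrict (Ici (0 : ℝ))),
    IsAdmissibleAssoc S (us t) (ys t) ∧ GeneratesUY S (us t) (ys t) (μs t)
  charged : ∀ᵐ t ∂(volume.restrict (Ici (0 : ℝ))), ∀ᵐ τ ∂(volume.restrict (Ici (0 : ℝ))),
    ∀ r > 0, 0 < (μs t : Measure (U × S.Y))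
      {q : U × S.Y | dist q.1 (us t τ) + ‖(q.2 : Euc m) - ys t τ‖ < r}

variable {S}

/-- The family `z ↦ (u_z^{N,M}, y_z^{N,M})`, where `y_z^{N,M}` starts at `yi N M z`, is an average
control generating family with occupational measures `μ N M z` and slow trajectory `zt N M`
(starting at `zs 0`), and `(μ N M (zt N M t), zt N M t)` generates `lam N M`. The measures do not
depend on the initial conditions near the optimal trajectories. -/
structure ACGAssumption (C : FeedbackConstruction S) (zs : ℝ → Euc n) (ys : ℝ → ℝ → Euc m)
    (yi : ℕ+ → ℕ+ → Euc n → Euc m) (μ : ℕ+ → ℕ+ → Euc n → PUY S)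
    (zt : ℕ+ → ℕ+ → ℝ → Euc n) (lam : ℕ+ → ℕ+ → ProbabilityMeasure (F S)) : Prop where
  init_mem : ∀ N M, ∀ z ∈ S.Z, yi N M z ∈ S.Y
  acg : ∀ N M, IsACGFamily S (fun z => C.ctrl N M z (yi N M z))
    (fun z => C.traj N M z (yi N M z)) (μ N M) (zs 0) (zt N M)
  fast_indep : ∀ N M, ∀ᵐ t ∂(volume.restrict (Ici (0 : ℝ))), ∃ O : Set (Euc m), IsOpen O ∧
    (∀ τ, 0 ≤ τ → ys t τ ∈ O) ∧ ∀ y₀ ∈ O ∩ S.Y,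
      GeneratesUY S (C.ctrl N M (zs t) y₀) (C.traj N M (zs t) y₀) (μ N M (zs t))
  generates : ∀ N M, GeneratesF S (fun t => μ N M (zt N M t)) (zt N M) (lam N M)
  slow_indep : ∀ N M, ∃ O : Set (Euc n), IsOpen O ∧ (∀ t, 0 ≤ t → zs t ∈ O) ∧
    ∀ w : ℝ → Euc n, IsFeedbackAvgSolution S (μ N M) w → w 0 ∈ O →
      GeneratesF S (fun t => μ N M (w t)) w (lam N M)

/-- Continuity of `z ↦ μ N M z` on the balls `Q_t` of radius `RQ t` centered at `zs t`, and
asymptotic smallness of the set of times at which `zt N M` is outside of these balls. -/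
structure SlowBallAssumption (zs : ℝ → Euc n) (μ : ℕ+ → ℕ+ → Euc n → PUY S)
    (zt : ℕ+ → ℕ+ → ℝ → Euc n) (RQ : ℝ → ℝ) : Prop where
  pos : ∀ᵐ t ∂(volume.restrict (Ici (0 : ℝ))), 0 < RQ t
  continuous : ∀ᵐ t ∂(volume.restrict (Ici (0 : ℝ))), ∀ N M, ∃ κ : ℝ → ℝ,
    Tendsto κ (𝓝[>] 0) (𝓝 0) ∧
    ∀ z' ∈ Metric.ball (zs t) (RQ t) ∩ S.Z, ∀ z'' ∈ Metric.ball (zs t) (RQ t) ∩ S.Z,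
      rho (μ N M z') (μ N M z'') ≤ κ ‖z' - z''‖
  lipschitz : ∀ᵐ t ∂(volume.restrict (Ici (0 : ℝ))), ∀ N M, ∃ L : ℝ,
    ∀ z' ∈ Metric.ball (zs t) (RQ t) ∩ S.Z, ∀ z'' ∈ Metric.ball (zs t) (RQ t) ∩ S.Z,
      ‖tilde S S.g (μ N M z') z' - tilde S S.g (μ N M z'') z''‖ ≤ L * ‖z' - z''‖
  exit : ∀ t > 0, Tendsto (fun N : ℕ+ => limsup (fun M : ℕ+ =>
    volume {t' : ℝ | t' ∈ Icc 0 t ∧ zt N M t' ∉ Metric.ball (zs t') (RQ t')}) atTop)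
    atTop (𝓝 0)

/-- Uniqueness and Lipschitz continuity of the feedback on `B_{t,τ} × Q_t`, where `B_{t,τ}` is the
ball of radius `RB t τ` centered at `ys t τ`, and asymptotic smallness of the set of times at
which the closed loop solution is outside of these balls. -/
structure FastBallAssumption (C : FeedbackConstruction S) (zs : ℝ → Euc n)
    (ys : ℝ → ℝ → Euc m) (RQ : ℝ → ℝ) (RB : ℝ → ℝ → ℝ) : Prop where
  pos : ∀ᵐ t ∂(volume.restrict (Ici (0 : ℝ))), 0 < RQ t →
    ∀ᵐ τ ∂(volume.restrict (Ici (0 : ℝ))), 0 < RB t τ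
  unique : ∀ᵐ t ∂(volume.restrict (Ici (0 : ℝ))), 0 < RQ t →
    ∀ᵐ τ ∂(volume.restrict (Ici (0 : ℝ))), ∀ N M : ℕ+,
      ∀ y ∈ Metric.ball (ys t τ) (RB t τ) ∩ S.Y, ∀ z ∈ Metric.ball (zs t) (RQ t) ∩ S.Z, ∀ u : U,
        (∀ u' : U,
          lagrangian S (comb C.ψ N (C.cζ N M)) (comb C.φ M (C.cη N M z)) u y z ≤
            lagrangian S (comb C.ψ N (C.cζ N M)) (comb C.φ M (C.cη N M z)) u' y z) →
        u = C.v N M y z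
  lipschitz : ∀ᵐ t ∂(volume.restrict (Ici (0 : ℝ))), 0 < RQ t →
    ∀ᵐ τ ∂(volume.restrict (Ici (0 : ℝ))), ∀ N M : ℕ+, ∃ L : ℝ,
      ∀ y' ∈ Metric.ball (ys t τ) (RB t τ) ∩ S.Y, ∀ z' ∈ Metric.ball (zs t) (RQ t) ∩ S.Z,
      ∀ y'' ∈ Metric.ball (ys t τ) (RB t τ) ∩ S.Y, ∀ z'' ∈ Metric.ball (zs t) (RQ t) ∩ S.Z,
        dist (C.v N M y' z') (C.v N M y'' z'') ≤ L * (‖y' - y''‖ + ‖z' - z''‖)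
  exit : ∀ᵐ t ∂(volume.restrict (Ici (0 : ℝ))), 0 < RQ t → ∀ τ > 0,
    Tendsto (fun N : ℕ+ => limsup (fun M : ℕ+ =>
      volume {τ' : ℝ | τ' ∈ Icc 0 τ ∧
        C.traj N M (zs t) (ys t 0) τ' ∉ Metric.ball (ys t τ') (RB t τ')}) atTop)
      atTop (𝓝 0)

variable (S)

/-! ### Stability, piecewise continuity, and the piecewise control -/

/-- Lyapunov type stability of the associated and of the averaged systems. -/
structure StabilityAssumption (A₁ : Matrix (Fin m) (Fin m) ℝ) (A₂ : Matrix (Fin n) (Fin n) ℝ) :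
    Prop where
  posDef₁ : A₁.PosDef
  posDef₂ : A₂.PosDef
  fast : ∀ (u : U) (y' y'' : Euc m),
    (S.f u y' - S.f u y'').ofLp ⬝ᵥ (A₁ *ᵥ (y' - y'').ofLp) ≤ -‖y' - y''‖ ^ 2
  slow : ∀ μ ∈ W S, ∀ z' z'' : Euc n,
    (tilde S S.g μ z' - tilde S S.g μ z'').ofLp ⬝ᵥ (A₂ *ᵥ (z' - z'').ofLp) ≤ -‖z' - z''‖ ^ 2

variable {S} in
/-- Continuity of `t ↦ h̃(μ(t),z)` outside of the exceptional set `D`: the bound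
`‖h̃(μ(t'),z) - h̃(μ(t),z)‖ ≤ ν(|t-t'|)` holds for `|t'-t| < a t`, `a t` being positive off `D` and
bounded away from zero off the `δ`-neighbourhood of `D`, for each `δ > 0`. -/
def IsPiecewiseContinuous {E : Type*} [NormedAddCommGroup E] [NormedSpace ℝ E]
    (h : U → Euc m → Euc n → E) (μ : ℝ → PUY S) (D : Set ℝ) : Prop :=
  ∃ ν a : ℝ → ℝ, MonotoneOn ν (Ici 0) ∧ Tendsto ν (𝓝[>] 0) (𝓝 0) ∧
    (∀ t, 0 ≤ t → t ∉ D → 0 < a t ∧ ∀ t', 0 ≤ t' → |t' - t| < a t → ∀ z ∈ S.Z,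
      ‖tilde S h (μ t') z - tilde S h (μ t) z‖ ≤ ν |t - t'|) ∧
    ∀ δ > 0, ∃ r > 0, ∀ t, 0 ≤ t → (∀ s ∈ D, δ ≤ |t - s|) → r ≤ a t

end System

/-- `D ⊆ (0,∞)` has at most `c T` points in `(0,T)`, for each `T > 0`. -/
def IsLinearlySparse (D : Set ℝ) : Prop :=
  D ⊆ Ioi 0 ∧ ∃ c : ℝ, ∀ T > 0, (D ∩ Ioo 0 T).Finite ∧ ((D ∩ Ioo 0 T).ncard : ℝ) ≤ c * T

/-- `D` has at most `c T` points in each interval `(s,s+T)`, `s ≥ 0`, `T ≥ 1`. -/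
def IsUniformlySparse (D : Set ℝ) : Prop :=
  ∃ c : ℝ, ∀ s, 0 ≤ s → ∀ T, 1 ≤ T →
    (D ∩ Ioo s (s + T)).Finite ∧ ((D ∩ Ioo s (s + T)).ncard : ℝ) ≤ c * T

/-- The control equal to `u (z (l Δ)) ((t - l Δ) / ε)` on `[l Δ, (l+1) Δ)`, `l = 0, 1, …`. -/
def piecewiseControl {U : Type*} {n : ℕ} (u : Euc n → ℝ → U) (z : ℝ → Euc n) (Δ ε t : ℝ) : U :=
  u (z (⌊t / Δ⌋₊ * Δ)) ((t - ⌊t / Δ⌋₊ * Δ) / ε)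

end

end SPAverage

/-! Averaging works block by block. On a control interval of length `Δ ε`, in the stretched time `(t
- t_l)/ε`, the fast variable solves the associated system with an open loop control from the ACG
family, but from a different initial value. By the first stability inequality, two solutions with
the same control have squared distance integrable with a bound independent of the length of the
interval (`StabilityAssumption.exists_integral_sq_le`). As `Δ ε / ε → ∞`, the initial value is
forgotten, and the uniform ACG limits give `IsPiecewiseScheme.block`: the integral of `h` over block
`l` is `Δ ε` times `h̃` at the frozen measure and at the current slow state, up to `o(Δ ε)`
uniformly in `l`.

The averaged trajectory obeys the same Euler rule with the same frozen measures, except on blocks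
near the exceptional set `D` (`IsPiecewiseScheme.block_averaged`). Since both rules use the same
measure, the second stability inequality applies to the difference `e_l` of the slow states: the
form `⟨e, P e⟩`, with `P` the operator of `A₂`, drops by `2 Δ ε ‖e‖²` up to small forcing and a
penalty near `D` (`IsPiecewiseScheme.lyapunov_step`). Summed under linear sparsity, this makes `e`
small in mean square over every horizon. `SPSystem.exists_quadratic_modulus` turns this into
closeness of time averages for any continuous `h` whose `h̃` is piecewise continuous, uniformly in
`T ≥ 1` (`IsPiecewiseScheme.timeAvg_near`). That uniformity permits taking `T → ∞` before `ε → 0`,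
and gives convergence of the costs and of the occupational measures. Uniform sparsity upgrades the
mean square bound to a uniform one, through a Grönwall estimate over time windows of length between
1 and 2 (`le_of_step_of_window`).

Near optimality also needs `valueLP S ≤ liminf V*(ε)` (`valueLP_le_liminf_valueSP`). Occupational
measures of near optimal triplets with `ε → 0`, `T → ∞` have a limit point. Testing the dynamics
with `φ(y) χ(z)` shows that its conditional measures given `z` lie in `W` and that it induces a
feasible point of the averaged LP with the same cost (`valueLP_le_of_limit_measure`). -/

set_option linter.unusedSectionVars false

/-! ### Preliminaries: primitives, time averages, moduli of continuity and the functions `h̃`. -/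

namespace SPAverage

/-! ### Primitives and the chain rule -/

/-- Chain rule in integrated form along a Lipschitz primitive. -/
theorem integral_fderiv_comp_primitive {E : Type*} [NormedAddCommGroup E] [NormedSpace ℝ E]
    [FiniteDimensional ℝ E] {v x : ℝ → E} {a b B : ℝ} (hab : a ≤ b)
    (hint : IntervalIntegrable v volume a b)
    (hx : ∀ t ∈ Icc a b, x t = x a + ∫ s in a..t, v s) (hv : ∀ t ∈ Icc a b, ‖v t‖ ≤ B)
    {φ : E → ℝ} (hφ : ContDiff ℝ 1 φ) :
    ∫ t in a..b, fderiv ℝ φ (x t) (v t) = φ (x b) - φ (x a) := by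
  have hlip : ∀ s ∈ Icc a b, ∀ t ∈ Icc a b, ‖x t - x s‖ ≤ B * |t - s| := by
    intro s hs t ht
    have hi : ∀ r ∈ Icc a b, IntervalIntegrable v volume a r := fun r hr =>
      hint.mono_set (by rw [uIcc_of_le hab, uIcc_of_le hr.1]; exact Icc_subset_Icc le_rfl hr.2)
    rw [hx t ht, hx s hs, add_sub_add_left_eq_sub,
      intervalIntegral.integral_interval_sub_left (hi t ht) (hi s hs)]
    refine intervalIntegral.norm_integral_le_of_norm_le_const fun r hr => hv r ?_
    have := uIoc_subset_uIcc hr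
    exact (uIcc_subset_Icc hs ht) this
  have hB : 0 ≤ B := (norm_nonneg _).trans (hv a (left_mem_Icc.2 hab))
  obtain ⟨C, hC⟩ : ∃ C, ∀ t ∈ Icc a b, x t ∈ Metric.closedBall (x a) C := by
    refine ⟨B * (b - a), fun t ht => ?_⟩
    rw [mem_closedBall_iff_norm]
    refine (hlip a (left_mem_Icc.2 hab) t ht).trans ?_
    rw [abs_of_nonneg (sub_nonneg.2 ht.1)]
    exact mul_le_mul_of_nonneg_left (by linarith [ht.2]) hB
  -- A `C¹` function is Lipschitz on a compact convex set, so the composition with the Lipschitz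
  -- path is Lipschitz, hence absolutely continuous.
  obtain ⟨K, hK⟩ := (hφ.contDiffOn (s := Metric.closedBall (x a) C)).exists_lipschitzOnWith
    one_ne_zero (convex_closedBall _ _) (isCompact_closedBall _ _)
  have hxl : LipschitzOnWith (Real.toNNReal B) x (Icc a b) := by
    refine LipschitzOnWith.of_dist_le_mul fun t ht s hs => ?_
    rw [dist_eq_norm, Real.dist_eq, Real.coe_toNNReal _ hB]
    exact hlip s hs t ht
  have hac : AbsolutelyContinuousOnInterval (fun t => φ (x t)) a b := by
    have : LipschitzOnWith (K * Real.toNNReal B) (φ ∘ x) (uIcc a b) := by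
      rw [uIcc_of_le hab]
      exact hK.comp hxl hC
    exact this.absolutelyContinuousOnInterval
  rw [← hac.integral_deriv_eq_sub]
  refine intervalIntegral.integral_congr_ae ?_
  have hb : ∀ᵐ t : ℝ, t ≠ b := by simp [ae_iff, measure_singleton]
  filter_upwards [hint.ae_hasDerivAt_integral, hb] with t ht htb htab
  rw [uIoc_of_le hab] at htab
  have hta : t ∈ Ioo a b := ⟨htab.1, lt_of_le_of_ne htab.2 htb⟩
  have h1 := ht (by rw [uIcc_of_le hab]; exact Ioo_subset_Icc_self hta) a left_mem_uIcc
  have h2 : HasDerivAt x (v t) t := by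
    refine (h1.const_add (x a)).congr_of_eventuallyEq ?_
    filter_upwards [Ioo_mem_nhds hta.1 hta.2] with s hs
    exact hx s (Ioo_subset_Icc_self hs)
  exact (((hφ.differentiable one_ne_zero (x t)).hasFDerivAt.comp_hasDerivAt t h2).deriv).symm

section

variable {E : Type*} [NormedAddCommGroup E] [NormedSpace ℝ E] {v x : ℝ → E}

theorem IsPrimitive.intervalIntegrable (h : IsPrimitive v x) {a b : ℝ} (ha : 0 ≤ a) (hb : 0 ≤ b) :
    IntervalIntegrable v volume a b :=
  (h a ha).1.symm.trans (h b hb).1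

theorem IsPrimitive.eq_add (h : IsPrimitive v x) {a b : ℝ} (ha : 0 ≤ a) (hb : 0 ≤ b) :
    x b = x a + ∫ s in a..b, v s := by
  rw [(h b hb).2, (h a ha).2, add_assoc,
    intervalIntegral.integral_add_adjacent_intervals (h a ha).1 (h.intervalIntegrable ha hb)]

theorem IsPrimitive.norm_sub_le (h : IsPrimitive v x) {B : ℝ} (hv : ∀ t, 0 ≤ t → ‖v t‖ ≤ B)
    {a b : ℝ} (ha : 0 ≤ a) (hab : a ≤ b) : ‖x b - x a‖ ≤ B * (b - a) := by
  rw [h.eq_add ha (ha.trans hab), add_sub_cancel_left]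
  have := intervalIntegral.norm_integral_le_of_norm_le_const (a := a) (b := b) (f := v) (C := B)
    fun r hr => hv r (by rw [uIoc_of_le hab] at hr; exact ha.trans hr.1.le)
  rwa [abs_of_nonneg (sub_nonneg.2 hab)] at this

theorem IsPrimitive.continuousOn (h : IsPrimitive v x) : ContinuousOn x (Ici 0) := by
  intro t ht
  have ht' : (0 : ℝ) ≤ t := ht
  have h1 : ContinuousOn (fun s => x 0 + ∫ r in (0 : ℝ)..s, v r) (Icc 0 (t + 1)) := by
    have := intervalIntegral.continuousOn_primitive_interval (μ := volume) (f := v) (a := 0)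
      (b := t + 1) ((intervalIntegrable_iff' (by simp)).1 (h (t + 1) (by linarith)).1)
    rw [uIcc_of_le (by linarith)] at this
    exact continuousOn_const.add this
  have h2 : ContinuousOn x (Icc 0 (t + 1)) :=
    h1.congr fun s hs => (h s hs.1).2
  refine (h2 t ⟨ht', by linarith⟩).mono_of_mem_nhdsWithin ?_
  have : Icc (0 : ℝ) (t + 1) = Ici 0 ∩ Iic (t + 1) := rfl
  rw [this]
  exact inter_mem self_mem_nhdsWithin (mem_nhdsWithin_of_mem_nhds (Iic_mem_nhds (by linarith)))

theorem IsPrimitive.integral_fderiv [FiniteDimensional ℝ E] (h : IsPrimitive v x) {B : ℝ}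
    (hv : ∀ t, 0 ≤ t → ‖v t‖ ≤ B) {φ : E → ℝ} (hφ : ContDiff ℝ 1 φ) {T : ℝ} (hT : 0 ≤ T) :
    ∫ t in (0 : ℝ)..T, fderiv ℝ φ (x t) (v t) = φ (x T) - φ (x 0) :=
  integral_fderiv_comp_primitive hT (h T hT).1 (fun t ht => (h t ht.1).2)
    (fun t ht => hv t ht.1) hφ

end

/-! ### Time averages -/

theorem abs_timeAvg_sub_le {h k : ℝ → ℝ} {T c : ℝ} (hT : 0 < T)
    (hh : IntervalIntegrable h volume 0 T) (hk : IntervalIntegrable k volume 0 T)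
    (hc : ∀ t, 0 ≤ t → t ≤ T → |h t - k t| ≤ c) : |timeAvg h T - timeAvg k T| ≤ c := by
  rw [timeAvg, timeAvg, ← mul_sub, ← intervalIntegral.integral_sub hh hk, abs_mul,
    abs_of_pos (inv_pos.2 hT), inv_mul_le_iff₀ hT]
  have := intervalIntegral.norm_integral_le_of_norm_le_const (a := 0) (b := T)
    (f := fun t => h t - k t) (C := c)
    fun r hr => by rw [uIoc_of_le hT.le] at hr; exact hc r hr.1.le hr.2
  rw [sub_zero, abs_of_pos hT] at this
  rw [mul_comm T c]
  exact this

theorem abs_timeAvg_le {h : ℝ → ℝ} {T c : ℝ} (hT : 0 < T)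
    (hc : ∀ t, 0 ≤ t → t ≤ T → |h t| ≤ c) : |timeAvg h T| ≤ c := by
  rw [timeAvg, abs_mul, abs_of_pos (inv_pos.2 hT), inv_mul_le_iff₀ hT]
  have := intervalIntegral.norm_integral_le_of_norm_le_const (a := 0) (b := T)
    (f := h) (C := c)
    fun r hr => by rw [uIoc_of_le hT.le] at hr; exact hc r hr.1.le hr.2
  rw [sub_zero, abs_of_pos hT] at this
  rw [mul_comm T c]
  exact this

/-! ### Continuous functions on `U × Y × Z` -/

variable {U : Type*} [MetricSpace U] [CompactSpace U] {m n : ℕ} (S : SPSystem U m n)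

theorem SPSystem.isCompact_box : IsCompact ((univ : Set U) ×ˢ S.Y ×ˢ S.Z) :=
  isCompact_univ.prod (S.isCompact_Y.prod S.isCompact_Z)

theorem SPSystem.exists_norm_le {E : Type*} [NormedAddCommGroup E]
    {h : U × Euc m × Euc n → E} (hh : Continuous h) :
    ∃ B, 0 ≤ B ∧ ∀ u, ∀ y ∈ S.Y, ∀ z ∈ S.Z, ‖h (u, y, z)‖ ≤ B := by
  obtain ⟨B, hB⟩ := S.isCompact_box.exists_bound_of_continuousOn hh.continuousOn
  exact ⟨max B 0, le_max_right _ _, fun u y hy z hz =>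
    (hB (u, y, z) ⟨mem_univ _, hy, hz⟩).trans (le_max_left _ _)⟩

theorem SPSystem.exists_norm_f_le :
    ∃ B, 0 ≤ B ∧ ∀ u, ∀ y ∈ S.Y, ‖S.f u y‖ ≤ B := by
  obtain ⟨B, hB⟩ := (isCompact_univ.prod S.isCompact_Y).exists_bound_of_continuousOn
    S.continuous_f.continuousOn
  exact ⟨max B 0, le_max_right _ _, fun u y hy =>
    (hB (u, y) ⟨mem_univ _, hy⟩).trans (le_max_left _ _)⟩

/-- A quadratic modulus of continuity on the compact set `U × Y × Z`. -/
theorem SPSystem.exists_quadratic_modulus {E : Type*} [NormedAddCommGroup E]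
    {h : U × Euc m × Euc n → E} (hh : Continuous h)
    {η : ℝ} (hη : 0 < η) :
    ∃ K, 0 ≤ K ∧ ∀ u, ∀ y ∈ S.Y, ∀ z ∈ S.Z, ∀ y' ∈ S.Y, ∀ z' ∈ S.Z,
      ‖h (u, y, z) - h (u, y', z')‖ ≤ η + K * (‖y - y'‖ ^ 2 + ‖z - z'‖ ^ 2) := by
  obtain ⟨B, hB0, hB⟩ := S.exists_norm_le hh
  have huc := S.isCompact_box.uniformContinuousOn_of_continuous hh.continuousOn
  obtain ⟨δ, hδ, hu⟩ := Metric.uniformContinuousOn_iff.1 huc η hη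
  -- Points closer than `δ` are covered by uniform continuity; otherwise the squared distance is at
  -- least `δ²`, while the difference of values is at most `2 * B`.
  refine ⟨2 * B / δ ^ 2, by positivity, fun u y hy z hz y' hy' z' hz' => ?_⟩
  by_cases hd : dist (u, y, z) (u, y', z') < δ
  · have := hu (u, y, z) ⟨mem_univ _, hy, hz⟩ (u, y', z') ⟨mem_univ _, hy', hz'⟩ hd
    rw [dist_eq_norm] at this
    have h2 : 0 ≤ 2 * B / δ ^ 2 * (‖y - y'‖ ^ 2 + ‖z - z'‖ ^ 2) := by positivity
    linarith
  · have hd' : δ ≤ max ‖y - y'‖ ‖z - z'‖ := by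
      have := not_lt.1 hd
      simpa [Prod.dist_eq, dist_eq_norm] using this
    have hsq : δ ^ 2 ≤ ‖y - y'‖ ^ 2 + ‖z - z'‖ ^ 2 := by
      rcases le_max_iff.1 hd' with h' | h'
      · nlinarith [sq_nonneg ‖z - z'‖]
      · nlinarith [sq_nonneg ‖y - y'‖]
    have h3 : ‖h (u, y, z) - h (u, y', z')‖ ≤ 2 * B := by
      have h1 := hB u y hy z hz
      have h2 := hB u y' hy' z' hz'
      exact (norm_sub_le _ _).trans (by linarith)
    have h4 : 2 * B ≤ 2 * B / δ ^ 2 * (‖y - y'‖ ^ 2 + ‖z - z'‖ ^ 2) := by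
      rw [div_mul_eq_mul_div, le_div_iff₀ (by positivity)]
      exact mul_le_mul_of_nonneg_left hsq (by positivity)
    linarith

variable [MeasurableSpace U] [BorelSpace U]

instance : CompactSpace S.Y := isCompact_iff_compactSpace.1 S.isCompact_Y
instance : CompactSpace S.Z := isCompact_iff_compactSpace.1 S.isCompact_Z

variable {S} in
theorem SPSystem.aestronglyMeasurable_comp {E : Type*} [NormedAddCommGroup E]
    {h : U × Euc m × Euc n → E} (hh : Continuous h) {s : Set ℝ} (hs : MeasurableSet s)
    (hs0 : s ⊆ Ici 0) {u : ℝ → U} {y : ℝ → Euc m}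
    {z : ℝ → Euc n} (hu : AEMeasurable u (volume.restrict (Ici 0)))
    (hy : ContinuousOn y s) (hz : ContinuousOn z s) :
    AEStronglyMeasurable (fun t => h (u t, y t, z t)) (volume.restrict s) := by
  have h1 : AEMeasurable u (volume.restrict s) :=
    hu.mono_measure (Measure.restrict_mono hs0 le_rfl)
  have h2 := (hy.aestronglyMeasurable (μ := volume) hs).aemeasurable
  have h3 := (hz.aestronglyMeasurable (μ := volume) hs).aemeasurable
  exact hh.comp_aestronglyMeasurable (h1.prodMk (h2.prodMk h3)).aestronglyMeasurable

variable {S} in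
theorem SPSystem.intervalIntegrable_comp {E : Type*} [NormedAddCommGroup E]
    {h : U × Euc m × Euc n → E} (hh : Continuous h) {T : ℝ} (hT : 0 ≤ T) {u : ℝ → U}
    {y : ℝ → Euc m}
    {z : ℝ → Euc n} (hu : AEMeasurable u (volume.restrict (Ici 0)))
    (hy : ContinuousOn y (Icc 0 T)) (hz : ContinuousOn z (Icc 0 T))
    (hyY : ∀ t ∈ Icc 0 T, y t ∈ S.Y) (hzZ : ∀ t ∈ Icc 0 T, z t ∈ S.Z) :
    IntervalIntegrable (fun t => h (u t, y t, z t)) volume 0 T := by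
  obtain ⟨B, -, hB⟩ := S.exists_norm_le hh
  rw [intervalIntegrable_iff_integrableOn_Icc_of_le hT]
  refine ⟨SPSystem.aestronglyMeasurable_comp hh measurableSet_Icc
    (fun t ht => ht.1) hu hy hz, ?_⟩
  refine HasFiniteIntegral.of_bounded (C := B) ?_
  filter_upwards [ae_restrict_mem measurableSet_Icc] with t ht
  exact hB _ _ (hyY t ht) _ (hzZ t ht)

/-! ### The functions `h̃` -/

theorem integrable_of_continuous_UY {E : Type*} [NormedAddCommGroup E]
    {k : U × S.Y → E} (hk : Continuous k) (μ : PUY S) :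
    Integrable k (μ : Measure (U × S.Y)) := by
  obtain ⟨B, hB⟩ := isCompact_univ.exists_bound_of_continuousOn hk.continuousOn
  exact ⟨hk.aestronglyMeasurable, HasFiniteIntegral.of_bounded (C := B)
    (ae_of_all _ fun q => hB q (mem_univ _))⟩

variable {E : Type*} [NormedAddCommGroup E] [NormedSpace ℝ E]

theorem continuous_slice {h : U × Euc m × Euc n → E} (hh : Continuous h) (z : Euc n) :
    Continuous fun q : U × S.Y => h (q.1, q.2, z) := by fun_prop

theorem norm_tilde_le {h : U × Euc m × Euc n → E} {c : ℝ} {z : Euc n}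
    (hc : ∀ u, ∀ y ∈ S.Y, ‖h (u, y, z)‖ ≤ c) (μ : PUY S) :
    ‖tilde S (fun u y z => h (u, y, z)) μ z‖ ≤ c := by
  have := norm_integral_le_of_norm_le_const (μ := (μ : Measure (U × S.Y)))
    (f := fun q : U × S.Y => h (q.1, q.2, z)) (C := c)
    (ae_of_all _ fun q => hc q.1 q.2 q.2.2)
  simpa [tilde] using this

theorem norm_tilde_sub_le {h k : U × Euc m × Euc n → E} (hh : Continuous h) (hk : Continuous k)
    {c : ℝ} {z z' : Euc n} (hc : ∀ u, ∀ y ∈ S.Y, ‖h (u, y, z) - k (u, y, z')‖ ≤ c) (μ : PUY S) :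
    ‖tilde S (fun u y z => h (u, y, z)) μ z - tilde S (fun u y z => k (u, y, z)) μ z'‖ ≤ c := by
  rw [tilde, tilde, ← integral_sub (integrable_of_continuous_UY S (continuous_slice S hh z) μ)
    (integrable_of_continuous_UY S (continuous_slice S hk z') μ)]
  have := norm_integral_le_of_norm_le_const (μ := (μ : Measure (U × S.Y)))
    (f := fun q : U × S.Y => h (q.1, q.2, z) - k (q.1, q.2, z')) (C := c)
    (ae_of_all _ fun q => hc q.1 q.2 q.2.2)
  simpa using this

/-- Lets the scalar averaging estimates be applied to the vector field `g` coordinatewise. -/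
theorem tilde_g_apply (μ : PUY S) (z : Euc n) (i : Fin n) :
    tilde S S.g μ z i = tilde S (fun u y z => S.g u y z i) μ z := by
  have h := (EuclideanSpace.proj i : Euc n →L[ℝ] ℝ).integral_comp_comm
    (integrable_of_continuous_UY S (continuous_slice S S.continuous_g z) μ)
  exact h.symm

end SPAverage

/-! ### Stability of the fast dynamics and uniform averaging over long stretched time. -/

namespace SPAverage

/-! ### Quadratic forms -/

/-- The operator of a positive definite matrix, with the properties of its quadratic form. -/
theorem exists_operator_of_posDef {k : ℕ} {A : Matrix (Fin k) (Fin k) ℝ} (hA : A.PosDef) :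
    ∃ P : Euc k →L[ℝ] Euc k,
      (∀ v w : Euc k, v.ofLp ⬝ᵥ (A *ᵥ w.ofLp) = inner ℝ v (P w)) ∧
      (∀ v w : Euc k, inner ℝ v (P w) = inner ℝ w (P v)) ∧
      ∃ c > 0, ∀ w : Euc k, c * ‖w‖ ^ 2 ≤ inner ℝ w (P w) := by
  have key : ∀ v w : Euc k,
      v.ofLp ⬝ᵥ (A *ᵥ w.ofLp) = inner ℝ v (Matrix.toEuclideanCLM (𝕜 := ℝ) A w) := by
    intro v w
    rw [EuclideanSpace.inner_eq_star_dotProduct, dotProduct_comm]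
    simp
  have hpos : ∀ w : Euc k, w ≠ 0 → 0 < inner ℝ w (Matrix.toEuclideanCLM (𝕜 := ℝ) A w) := by
    intro w hw
    rw [← key]
    have := hA.dotProduct_mulVec_pos (x := w.ofLp) (by simpa using hw)
    simpa using this
  refine ⟨Matrix.toEuclideanCLM (𝕜 := ℝ) A, key, ?_, ?_⟩
  · intro v w
    rw [← key, ← key, Matrix.dotProduct_mulVec, dotProduct_comm, ← Matrix.mulVec_transpose]
    have : Aᵀ = A := by simpa [Matrix.IsHermitian] using hA.isHermitian
    rw [this]
  · set P := Matrix.toEuclideanCLM (𝕜 := ℝ) A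
    have hcont : Continuous fun w : Euc k => inner ℝ w (P w) :=
      continuous_id.inner P.continuous
    -- The unit sphere is empty only in dimension zero, where any constant works. Otherwise the
    -- constant is the minimum of the form on the sphere, extended by homogeneity.
    rcases (Metric.sphere (0 : Euc k) 1).eq_empty_or_nonempty with he | hne
    · refine ⟨1, one_pos, fun w => ?_⟩
      have hw : w = 0 := by
        by_contra hw
        have : (‖w‖⁻¹ • w) ∈ Metric.sphere (0 : Euc k) 1 := by
          simp [norm_smul, hw]
        rw [he] at this
        exact this
      simp [hw]
    · obtain ⟨w₀, hw₀, hmin⟩ := (isCompact_sphere (0 : Euc k) 1).exists_isMinOn hne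
        hcont.continuousOn
      refine ⟨_, hpos w₀ (by rintro rfl; simp at hw₀), fun w => ?_⟩
      by_cases hw : w = 0
      · simp [hw]
      have hm := hmin (show (‖w‖⁻¹ • w) ∈ Metric.sphere (0 : Euc k) 1 by simp [norm_smul, hw])
      have hn : 0 < ‖w‖ := norm_pos_iff.2 hw
      simp only [mem_ofPred_eq, map_smul, inner_smul_left, inner_smul_right] at hm
      simp only [conj_trivial] at hm
      calc _ ≤ (‖w‖⁻¹ * (‖w‖⁻¹ * inner ℝ w (P w))) * ‖w‖ ^ 2 := by gcongr
        _ = inner ℝ w (P w) := by field_simp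

/-- Symmetry of `P` merges the two terms of the product rule, producing the pairing that occurs in
the stability inequalities. -/
theorem fderiv_inner_apply_self {k : ℕ} {P : Euc k →L[ℝ] Euc k}
    (hP : ∀ v w : Euc k, inner ℝ v (P w) = inner ℝ w (P v)) (w v : Euc k) :
    fderiv ℝ (fun w : Euc k => (inner ℝ w (P w) : ℝ)) w v = 2 * inner ℝ v (P w) := by
  rw [fderiv_inner_apply ℝ differentiableAt_fun_id P.differentiableAt]
  simp only [fderiv_fun_id, ContinuousLinearMap.fderiv, ContinuousLinearMap.id_apply]
  rw [hP w v]
  ring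

theorem inner_operator_le {k : ℕ} (P : Euc k →L[ℝ] Euc k) (v w : Euc k) :
    |inner ℝ v (P w)| ≤ ‖P‖ * ‖v‖ * ‖w‖ := by
  refine (abs_real_inner_le_norm _ _).trans ?_
  calc ‖v‖ * ‖P w‖ ≤ ‖v‖ * (‖P‖ * ‖w‖) := by gcongr; exact P.le_opNorm w
    _ = _ := by ring

variable {U : Type*} [MetricSpace U] [CompactSpace U] [MeasurableSpace U] [BorelSpace U]
variable {m n : ℕ} (S : SPSystem U m n)

/-! ### The associated system -/

/-- Two solutions of the associated system with the same control approach each other in mean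
square, at a rate that is independent of the control. -/
theorem StabilityAssumption.exists_integral_sq_le {A₁ : Matrix (Fin m) (Fin m) ℝ}
    {A₂ : Matrix (Fin n) (Fin n) ℝ} (hs : StabilityAssumption S A₁ A₂) :
    ∃ C, 0 ≤ C ∧ ∀ (u : ℝ → U) (x x' : ℝ → Euc m) (T : ℝ), 0 ≤ T →
      AEMeasurable u (volume.restrict (Ici 0)) →
      ContinuousOn x (Icc 0 T) → ContinuousOn x' (Icc 0 T) →
      (∀ t ∈ Icc 0 T, x t ∈ S.Y) → (∀ t ∈ Icc 0 T, x' t ∈ S.Y) →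
      (∀ t ∈ Icc 0 T, x t = x 0 + ∫ s in (0 : ℝ)..t, S.f (u s) (x s)) →
      (∀ t ∈ Icc 0 T, x' t = x' 0 + ∫ s in (0 : ℝ)..t, S.f (u s) (x' s)) →
      ∫ t in (0 : ℝ)..T, ‖x t - x' t‖ ^ 2 ≤ C := by
  obtain ⟨P, hkey, hsym, c, hc, hcP⟩ := exists_operator_of_posDef hs.posDef₁
  obtain ⟨R, hR⟩ := (Metric.isBounded_iff.1 S.isCompact_Y.isBounded)
  obtain ⟨B, hB0, hB⟩ := S.exists_norm_f_le
  -- Along the difference `w` of the solutions, `⟨w, P w⟩` has derivative at most `-2‖w‖²`. The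
  -- integral is thus controlled by the initial value of the form, which is at most `‖P‖ * R ^ 2`
  -- with `R` bounding the distances in `Y`.
  refine ⟨‖P‖ * R ^ 2, by positivity, fun u x x' T hT hu hx hx' hxY hx'Y hode hode' => ?_⟩
  have hfc : Continuous fun q : U × Euc m × Euc n => S.f q.1 q.2.1 :=
    S.continuous_f.comp (by fun_prop : Continuous fun q : U × Euc m × Euc n => (q.1, q.2.1))
  have hmeas : ∀ x : ℝ → Euc m, ContinuousOn x (Icc 0 T) → (∀ t ∈ Icc 0 T, x t ∈ S.Y) →
      IntervalIntegrable (fun t => S.f (u t) (x t)) volume 0 T := by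
    intro x hx hxY
    rw [intervalIntegrable_iff_integrableOn_Icc_of_le hT]
    refine ⟨SPSystem.aestronglyMeasurable_comp (z := fun _ => (0 : Euc n)) hfc measurableSet_Icc
      (fun t ht => ht.1) hu hx continuousOn_const, HasFiniteIntegral.of_bounded (C := B) ?_⟩
    filter_upwards [ae_restrict_mem measurableSet_Icc] with t ht
    exact hB _ _ (hxY t ht)
  have hi := hmeas x hx hxY
  have hi' := hmeas x' hx' hx'Y
  have hd : ∀ t ∈ Icc 0 T, x t - x' t = (x 0 - x' 0) +
      ∫ s in (0 : ℝ)..t, (S.f (u s) (x s) - S.f (u s) (x' s)) := by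
    intro t ht
    have hsub : uIcc 0 t ⊆ uIcc 0 T := by
      rw [uIcc_of_le hT, uIcc_of_le ht.1]; exact Icc_subset_Icc le_rfl ht.2
    rw [intervalIntegral.integral_sub (hi.mono_set hsub) (hi'.mono_set hsub)]
    conv_lhs => rw [hode t ht, hode' t ht]
    abel
  have hbd : ∀ t ∈ Icc 0 T, ‖S.f (u t) (x t) - S.f (u t) (x' t)‖ ≤ 2 * B := fun t ht =>
    (norm_sub_le _ _).trans (by linarith [hB (u t) _ (hxY t ht), hB (u t) _ (hx'Y t ht)])
  have hchain := integral_fderiv_comp_primitive hT (hi.sub hi') hd hbd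
    (φ := fun w : Euc m => (inner ℝ w (P w) : ℝ)) (contDiff_id.inner ℝ P.contDiff)
  simp only [fderiv_inner_apply_self hsym] at hchain
  have hdc : ContinuousOn (fun t => x t - x' t) (Icc 0 T) := hx.sub hx'
  have hsqi : IntervalIntegrable (fun t => ‖x t - x' t‖ ^ 2) volume 0 T :=
    ContinuousOn.intervalIntegrable (by rw [uIcc_of_le hT]; exact (hdc.norm.pow 2))
  have hPi : IntervalIntegrable (fun t => 2 * (inner ℝ (S.f (u t) (x t) - S.f (u t) (x' t))
      (P (x t - x' t)) : ℝ)) volume 0 T := by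
    have h1 := hi.sub hi'
    rw [intervalIntegrable_iff_integrableOn_Icc_of_le hT] at h1 ⊢
    have h2 : ContinuousOn (fun t => P (x t - x' t)) (Icc 0 T) := P.continuous.comp_continuousOn hdc
    refine ⟨(h1.aestronglyMeasurable.inner (𝕜 := ℝ)
      (h2.aestronglyMeasurable measurableSet_Icc)).const_mul 2,
      HasFiniteIntegral.of_bounded (C := 2 * (‖P‖ * (2 * B) * R)) ?_⟩
    filter_upwards [ae_restrict_mem measurableSet_Icc] with t ht
    rw [Real.norm_eq_abs, abs_mul, abs_two]
    refine mul_le_mul_of_nonneg_left ((inner_operator_le P _ _).trans ?_) zero_le_two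
    have h3 : ‖x t - x' t‖ ≤ R := by
      rw [← dist_eq_norm]; exact hR (hxY t ht) (hx'Y t ht)
    have h4 := hbd t ht
    gcongr
  have hle : ∫ t in (0 : ℝ)..T, ‖x t - x' t‖ ^ 2 ≤
      ∫ t in (0 : ℝ)..T, -(2 * (inner ℝ (S.f (u t) (x t) - S.f (u t) (x' t))
      (P (x t - x' t)) : ℝ)) := by
    refine intervalIntegral.integral_mono_on hT hsqi hPi.neg fun t ht => ?_
    have := hs.fast (u t) (x t) (x' t)
    rw [hkey] at this
    nlinarith [sq_nonneg ‖x t - x' t‖]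
  rw [intervalIntegral.integral_neg, hchain] at hle
  have h0 : (0 : ℝ) ∈ Icc 0 T := left_mem_Icc.2 hT
  have h1 := (abs_le.1 (inner_operator_le P (x 0 - x' 0) (x 0 - x' 0))).2
  have h2 : 0 ≤ (inner ℝ (x T - x' T) (P (x T - x' T)) : ℝ) :=
    le_trans (by positivity) (hcP _)
  have h3 : ‖x 0 - x' 0‖ ≤ R := by
    rw [← dist_eq_norm]; exact hR (hxY 0 h0) (hx'Y 0 h0)
  have h4 : ‖P‖ * ‖x 0 - x' 0‖ * ‖x 0 - x' 0‖ ≤ ‖P‖ * R ^ 2 := by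
    rw [mul_assoc, ← sq]; gcongr
  linarith

variable {S}

/-- An occupational measure generated by an admissible pair of the associated system is in `W`. -/
theorem GeneratesUY.mem_W {u : ℝ → U} {y : ℝ → Euc m} {μ : PUY S} (hg : GeneratesUY S u y μ)
    (ha : IsAdmissibleAssoc S u y) : μ ∈ W S := by
  intro φ hφ
  have hc : Continuous fun q : U × Euc m => fderiv ℝ φ q.2 (S.f q.1 q.2) :=
    ((hφ.continuous_fderiv one_ne_zero).comp continuous_snd).clm_apply S.continuous_f
  obtain ⟨B, hB0, hB⟩ := S.exists_norm_f_le
  obtain ⟨b, hb⟩ := S.isCompact_Y.exists_bound_of_continuousOn hφ.continuous.continuousOn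
  refine tendsto_nhds_unique (hg _ hc) ?_
  -- The chain rule leaves only the boundary terms `φ (y T) - φ (y 0)`, bounded by `2 * b` on `Y`.
  refine squeeze_zero_norm' (a := fun T : ℝ => T⁻¹ * (2 * b)) ?_ ?_
  · filter_upwards [eventually_gt_atTop (0 : ℝ)] with T hT
    rw [timeAvg, ha.ode.integral_fderiv (fun t ht => hB _ _ (ha.mem t ht)) hφ hT.le, norm_mul,
      norm_inv, Real.norm_of_nonneg hT.le]
    refine mul_le_mul_of_nonneg_left ((norm_sub_le _ _).trans ?_) (by positivity)
    linarith [hb _ (ha.mem T hT.le), hb _ (ha.mem 0 le_rfl)]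
  · simpa using tendsto_inv_atTop_zero.mul_const (2 * b)

/-! ### Uniform averaging along an average control generating family -/

section ACG

variable {uf : Euc n → ℝ → U} {yf : Euc n → ℝ → Euc m} {μ : Euc n → PUY S} {z₀ : Euc n}
  {zt : ℝ → Euc n}

/-- The averages with a frozen slow variable converge uniformly, also in the frozen variable. -/
theorem IsACGFamily.uniform_frozen (hA : IsACGFamily S uf yf μ z₀ zt)
    {h : U × Euc m × Euc n → ℝ} (hh : Continuous h) {η : ℝ} (hη : 0 < η) :
    ∃ T₀ > 0, ∀ T ≥ T₀, ∀ z ∈ S.Z, ∀ w ∈ S.Z,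
      |timeAvg (fun τ => h (uf z τ, yf z τ, w)) T
        - tilde S (fun u y z => h (u, y, z)) (μ z) w| ≤ η := by
  have huc := S.isCompact_box.uniformContinuousOn_of_continuous hh.continuousOn
  obtain ⟨δ, hδ, hu⟩ := Metric.uniformContinuousOn_iff.1 huc (η / 3) (by positivity)
  -- For one frozen `w`, the ACG property applies to an integrand that ignores its third argument. A
  -- finite `δ`-net in `Z` makes the threshold uniform in `w`.
  obtain ⟨F, hFZ, hF, hcov⟩ := S.isCompact_Z.finite_cover_balls hδ
  have hev : ∀ᶠ T in atTop, ∀ w ∈ F, ∀ z ∈ S.Z,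
      |timeAvg (fun τ => h (uf z τ, yf z τ, w)) T
        - tilde S (fun u y z => h (u, y, z)) (μ z) w| ≤ η / 3 := by
    rw [eventually_all_finite hF]
    intro w _
    obtain ⟨φ, hφ, hle⟩ := hA.uniform (fun q => h (q.1, q.2.1, w))
      (hh.comp (by fun_prop : Continuous fun q : U × Euc m × Euc n => (q.1, q.2.1, w)))
    filter_upwards [hφ.eventually (gt_mem_nhds (show 0 < η / 3 by positivity)),
      eventually_gt_atTop 0] with T hT hT0 z hz
    exact (hle T hT0 z hz).trans hT.le
  obtain ⟨T₀, hT₀⟩ := eventually_atTop.1 hev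
  refine ⟨max T₀ 1, by positivity, fun T hT z hz w hw => ?_⟩
  have hTpos : 0 < T := lt_of_lt_of_le (by positivity) hT
  obtain ⟨w', hw'F, hww'⟩ := mem_iUnion₂.1 (hcov hw)
  have hw'Z := hFZ hw'F
  have hpt : ∀ u, ∀ y ∈ S.Y, |h (u, y, w) - h (u, y, w')| ≤ η / 3 := by
    intro u y hy
    rw [← Real.dist_eq]
    refine (hu _ ⟨mem_univ _, hy, hw⟩ _ ⟨mem_univ _, hy, hw'Z⟩ ?_).le
    simpa [Prod.dist_eq, hδ] using hww'
  have had := hA.admissible z hz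
  have hyc : ContinuousOn (yf z) (Icc 0 T) := had.ode.continuousOn.mono fun t ht => ht.1
  have hint : ∀ w ∈ S.Z, IntervalIntegrable (fun τ => h (uf z τ, yf z τ, w)) volume 0 T :=
    fun w hw => SPSystem.intervalIntegrable_comp hh hTpos.le had.measurable_control hyc
      continuousOn_const (fun t ht => had.mem t ht.1) fun _ _ => hw
  have h1 := abs_timeAvg_sub_le hTpos (hint w hw) (hint w' hw'Z) (c := η / 3)
    fun t ht _ => hpt _ _ (had.mem t ht)
  have h2 := hT₀ T ((le_max_left _ _).trans hT) w' hw'F z hz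
  have h3 := norm_tilde_sub_le S hh hh (z := w) (z' := w') hpt (μ z)
  rw [Real.norm_eq_abs] at h3
  rw [abs_le] at *
  constructor <;> linarith

/-- Averages along an arbitrary solution with the control `uf z` and a slowly varying third
component are close to `h̃(μ z, ·)`. -/
theorem IsACGFamily.uniform_perturbed {A₁ : Matrix (Fin m) (Fin m) ℝ}
    {A₂ : Matrix (Fin n) (Fin n) ℝ} (hs : StabilityAssumption S A₁ A₂)
    (hA : IsACGFamily S uf yf μ z₀ zt)
    {h : U × Euc m × Euc n → ℝ} (hh : Continuous h) {η : ℝ} (hη : 0 < η) :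
    ∃ T₀ > 0, ∃ r > 0, ∀ T ≥ T₀, ∀ z ∈ S.Z, ∀ (x : ℝ → Euc m) (w : ℝ → Euc n),
      ContinuousOn x (Icc 0 T) → ContinuousOn w (Icc 0 T) →
      (∀ t ∈ Icc 0 T, x t ∈ S.Y) → (∀ t ∈ Icc 0 T, w t ∈ S.Z) →
      (∀ t ∈ Icc 0 T, x t = x 0 + ∫ s in (0 : ℝ)..t, S.f (uf z s) (x s)) →
      (∀ t ∈ Icc 0 T, ‖w t - w 0‖ ≤ r) →
      |timeAvg (fun τ => h (uf z τ, x τ, w τ)) T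
        - tilde S (fun u y z => h (u, y, z)) (μ z) (w 0)| ≤ η := by
  obtain ⟨C, hC0, hC⟩ := hs.exists_integral_sq_le
  obtain ⟨K, hK0, hK⟩ := S.exists_quadratic_modulus hh (η := η / 4) (by positivity)
  obtain ⟨T₁, hT₁, hU⟩ := hA.uniform_frozen hh (η := η / 4) (by positivity)
  have hr : ∃ r > 0, K * r ^ 2 ≤ η / 4 := by
    refine ⟨√(η / 4 / (K + 1)), by positivity, ?_⟩
    rw [Real.sq_sqrt (by positivity), mul_div_assoc', div_le_iff₀ (by positivity)]
    nlinarith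
  obtain ⟨r, hr0, hKr⟩ := hr
  -- Four errors of size `η / 4`: the constant part of the modulus, the drift `K * r ^ 2`, the
  -- forgotten initial value `K * C / T`, and the frozen average.
  refine ⟨max T₁ (4 * K * C / η), by positivity, r, hr0,
    fun T hT z hz x w hx hw hxY hwZ hode hwr => ?_⟩
  have hTpos : 0 < T := lt_of_lt_of_le hT₁ ((le_max_left _ _).trans hT)
  have hT2 : K * C / T ≤ η / 4 := by
    rw [div_le_iff₀ hTpos]
    have := (le_max_right _ _).trans hT
    rw [div_le_iff₀ hη] at this
    linarith
  have h0 : (0 : ℝ) ∈ Icc 0 T := left_mem_Icc.2 hTpos.le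
  have had := hA.admissible z hz
  have hyc : ContinuousOn (yf z) (Icc 0 T) := had.ode.continuousOn.mono fun t ht => ht.1
  have hi1 := SPSystem.intervalIntegrable_comp hh hTpos.le had.measurable_control hx hw hxY hwZ
  have hi2 := SPSystem.intervalIntegrable_comp (S := S) (z := fun _ => w 0) hh hTpos.le
    had.measurable_control hyc continuousOn_const (fun t ht => had.mem t ht.1) fun _ _ => hwZ 0 h0
  have hsq : ∫ t in (0 : ℝ)..T, ‖x t - yf z t‖ ^ 2 ≤ C :=
    hC (uf z) x (yf z) T hTpos.le had.measurable_control hx hyc hxY (fun t ht => had.mem t ht.1)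
      hode fun t ht => (had.ode t ht.1).2
  have hsqi : IntervalIntegrable (fun t => ‖x t - yf z t‖ ^ 2) volume 0 T :=
    ContinuousOn.intervalIntegrable (by rw [uIcc_of_le hTpos.le]; exact ((hx.sub hyc).norm.pow 2))
  have hpt : ∀ t ∈ Icc 0 T, |h (uf z t, x t, w t) - h (uf z t, yf z t, w 0)| ≤
      (η / 4 + K * r ^ 2) + K * ‖x t - yf z t‖ ^ 2 := by
    intro t ht
    refine (hK _ _ (hxY t ht) _ (hwZ t ht) _ (had.mem t ht.1) _ (hwZ 0 h0)).trans ?_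
    have : ‖w t - w 0‖ ^ 2 ≤ r ^ 2 := by gcongr; exact hwr t ht
    nlinarith
  have hdiff : |timeAvg (fun τ => h (uf z τ, x τ, w τ)) T
      - timeAvg (fun τ => h (uf z τ, yf z τ, w 0)) T| ≤ (η / 4 + K * r ^ 2) + K * C / T := by
    rw [timeAvg, timeAvg, ← mul_sub, ← intervalIntegral.integral_sub hi1 hi2, abs_mul,
      abs_of_pos (inv_pos.2 hTpos), inv_mul_le_iff₀ hTpos]
    calc _ ≤ ∫ t in (0 : ℝ)..T, |h (uf z t, x t, w t) - h (uf z t, yf z t, w 0)| :=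
          intervalIntegral.abs_integral_le_integral_abs hTpos.le
      _ ≤ ∫ t in (0 : ℝ)..T, ((η / 4 + K * r ^ 2) + K * ‖x t - yf z t‖ ^ 2) :=
          intervalIntegral.integral_mono_on hTpos.le (hi1.sub hi2).abs
            (intervalIntegrable_const.add (hsqi.const_mul K)) hpt
      _ = T * (η / 4 + K * r ^ 2) + K * ∫ t in (0 : ℝ)..T, ‖x t - yf z t‖ ^ 2 := by
          rw [intervalIntegral.integral_add intervalIntegrable_const (hsqi.const_mul K),
            intervalIntegral.integral_const, intervalIntegral.integral_const_mul]
          simp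
      _ ≤ T * (η / 4 + K * r ^ 2) + K * C := by gcongr
      _ = _ := by field_simp
  have h2 := hU T ((le_max_left _ _).trans hT) z hz (w 0) (hwZ 0 h0)
  rw [abs_le] at *
  constructor <;> linarith

end ACG

end SPAverage

/-! ### Estimates on a single control block and the Lyapunov step. -/

namespace SPAverage

variable {U : Type*} [MetricSpace U] [CompactSpace U] [MeasurableSpace U] [BorelSpace U]
variable {m n : ℕ} {S : SPSystem U m n}

/-! ### The piecewise control on one interval -/

/-- The solutions of the singularly perturbed system with the piecewise control determined by an
average control generating family. -/
structure IsPiecewiseScheme (S : SPSystem U m n) (uf : Euc n → ℝ → U) (yf : Euc n → ℝ → Euc m)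
    (μ : Euc n → PUY S) (zt : ℝ → Euc n) (Δ : ℝ → ℝ) (uε : ℝ → ℝ → U) (yε : ℝ → ℝ → Euc m)
    (zε : ℝ → ℝ → Euc n) : Prop where
  acg : IsACGFamily S uf yf μ (zt 0) zt
  pos : ∀ ε > 0, 0 < Δ ε
  zero : Tendsto Δ (𝓝[>] 0) (𝓝 0)
  slow : Tendsto (fun ε => Δ ε / ε) (𝓝[>] 0) atTop
  control : ∀ ε t, uε ε t = piecewiseControl uf zt (Δ ε) ε t
  admissible : ∀ᶠ ε in 𝓝[>] (0 : ℝ), IsAdmissibleSP S ε (uε ε) (yε ε) (zε ε)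
  init : ∀ᶠ ε in 𝓝[>] (0 : ℝ), zε ε 0 = zt 0

/-- In stretched time a block carries one open loop control. The bound on `s` is strict because the
right endpoint already belongs to the next block. -/
theorem piecewiseControl_eq {V : Type*} (uf : Euc n → ℝ → V) (zt : ℝ → Euc n) {d ε s : ℝ}
    (hd : 0 < d) (hε : 0 < ε) (l : ℕ) (hs0 : 0 ≤ s) (hs : s < d / ε) :
    piecewiseControl uf zt d ε (l * d + ε * s) = uf (zt (l * d)) s := by
  have hfl : ⌊(l * d + ε * s) / d⌋₊ = l := by
    rw [Nat.floor_eq_iff (by positivity), le_div_iff₀ hd, div_lt_iff₀ hd]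
    rw [lt_div_iff₀ hε] at hs
    constructor <;> nlinarith
  rw [piecewiseControl, hfl]
  congr 1
  field_simp
  ring

theorem IsAdmissibleSP.norm_sub_le {ε : ℝ} {u : ℝ → U} {y : ℝ → Euc m} {z : ℝ → Euc n}
    (ha : IsAdmissibleSP S ε u y z) {B : ℝ}
    (hB : ∀ u, ∀ y ∈ S.Y, ∀ z ∈ S.Z, ‖S.g u y z‖ ≤ B) {a b : ℝ} (h0 : 0 ≤ a) (hab : a ≤ b) :
    ‖z b - z a‖ ≤ B * (b - a) :=
  ha.slow.norm_sub_le (fun t ht => hB _ _ (ha.mem t ht).1 _ (ha.mem t ht).2) h0 hab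

theorem IsAdmissibleSP.intervalIntegrable {ε : ℝ} {u : ℝ → U} {y : ℝ → Euc m} {z : ℝ → Euc n}
    (ha : IsAdmissibleSP S ε u y z) {E : Type*} [NormedAddCommGroup E]
    {h : U × Euc m × Euc n → E} (hh : Continuous h) {a b : ℝ} (h0 : 0 ≤ a) (h0b : 0 ≤ b) :
    IntervalIntegrable (fun t => h (u t, y t, z t)) volume a b := by
  have key : ∀ T, 0 ≤ T → IntervalIntegrable (fun t => h (u t, y t, z t)) volume 0 T :=
    fun T hT => SPSystem.intervalIntegrable_comp (S := S) hh hT ha.measurable_control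
      (ha.fast.continuousOn.mono fun t ht => ht.1) (ha.slow.continuousOn.mono fun t ht => ht.1)
      (fun t ht => (ha.mem t ht.1).1) fun t ht => (ha.mem t ht.1).2
  exact (key a h0).symm.trans (key b h0b)

section Scheme

variable {uf : Euc n → ℝ → U} {yf : Euc n → ℝ → Euc m} {μ : Euc n → PUY S}
  {zt : ℝ → Euc n} {Δ : ℝ → ℝ} {uε : ℝ → ℝ → U} {yε : ℝ → ℝ → Euc m} {zε : ℝ → ℝ → Euc n}
  {A₁ : Matrix (Fin m) (Fin m) ℝ} {A₂ : Matrix (Fin n) (Fin n) ℝ}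

theorem IsPiecewiseScheme.tendsto_Δ (hP : IsPiecewiseScheme S uf yf μ zt Δ uε yε zε) :
    Tendsto Δ (𝓝[>] 0) (𝓝[>] 0) :=
  tendsto_nhdsWithin_iff.2 ⟨hP.zero, by
    filter_upwards [self_mem_nhdsWithin] with ε hε using hP.pos ε hε⟩

theorem IsPiecewiseScheme.zt_mem (hP : IsPiecewiseScheme S uf yf μ zt Δ uε yε zε) {t : ℝ}
    (ht : 0 ≤ t) : zt t ∈ S.Z := hP.acg.solution.1.2 t ht

/-- After the change of time, this is `IsACGFamily.uniform_perturbed` on an interval of length `Δ ε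
/ ε`: that length tends to infinity, and the slow variable moves by only `O(Δ ε)`. The measure is
frozen at the averaged state, the third argument at the singularly perturbed one. -/
theorem IsPiecewiseScheme.block (hs : StabilityAssumption S A₁ A₂)
    (hP : IsPiecewiseScheme S uf yf μ zt Δ uε yε zε)
    {h : U × Euc m × Euc n → ℝ} (hh : Continuous h) {η : ℝ} (hη : 0 < η) :
    ∀ᶠ ε in 𝓝[>] (0 : ℝ), ∀ l : ℕ,
      |(∫ t in (l * Δ ε)..(l * Δ ε + Δ ε), h (uε ε t, yε ε t, zε ε t))
        - Δ ε * tilde S (fun u y z => h (u, y, z)) (μ (zt (l * Δ ε))) (zε ε (l * Δ ε))|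
      ≤ η * Δ ε := by
  obtain ⟨T₀, hT₀, r, hr, hmain⟩ := hP.acg.uniform_perturbed hs hh hη
  obtain ⟨B, hB0, hB⟩ := S.exists_norm_le S.continuous_g
  have hr' : 0 < r / (B + 1) := by positivity
  filter_upwards [hP.admissible, hP.slow.eventually_ge_atTop T₀,
    hP.zero.eventually (gt_mem_nhds hr'), self_mem_nhdsWithin] with ε ha hT hΔr hε l
  have hε : 0 < ε := hε
  have hd := hP.pos ε hε
  set d := Δ ε with hd_def
  have hl : 0 ≤ l * d := by positivity
  have hT0 : 0 < d / ε := by positivity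
  have hεT : ε * (d / ε) = d := by field_simp
  have hpos : ∀ t ∈ Icc 0 (d / ε), 0 ≤ l * d + ε * t := fun t ht =>
    add_nonneg hl (mul_nonneg hε.le ht.1)
  have hmaps : MapsTo (fun t => l * d + ε * t) (Icc 0 (d / ε)) (Ici 0) := hpos
  have hcont : ContinuousOn (fun t : ℝ => l * d + ε * t) (Icc 0 (d / ε)) := by fun_prop
  have hctrl : ∀ s, 0 ≤ s → s < d / ε → uε ε (l * d + ε * s) = uf (zt (l * d)) s :=
    fun s h0 h1 => by rw [hP.control]; exact piecewiseControl_eq uf zt hd hε l h0 h1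
  -- The factor `ε⁻¹` of the fast equation is absorbed by the change of time, so the rescaled fast
  -- variable solves the associated system exactly.
  have hode : ∀ t ∈ Icc 0 (d / ε), yε ε (l * d + ε * t) = yε ε (l * d + ε * 0) +
      ∫ s in (0 : ℝ)..t, S.f (uf (zt (l * d)) s) (yε ε (l * d + ε * s)) := by
    intro t ht
    have h1 := ha.fast.eq_add hl (hpos t ht)
    have h2 := intervalIntegral.integral_comp_add_mul (a := 0) (b := t)
      (fun s => ε⁻¹ • S.f (uε ε s) (yε ε s)) hε.ne' (l * d)
    simp only [mul_zero, add_zero] at h2 ⊢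
    rw [h1]
    congr 1
    rw [intervalIntegral.integral_smul] at h2
    rw [← smul_right_injective _ (inv_ne_zero hε.ne') |>.eq_iff, ← h2]
    congr 1
    refine intervalIntegral.integral_congr_ae ?_
    -- The endpoint must be discarded: for `t = d / ε` the control there is that of the next block.
    have hb : ∀ᵐ s : ℝ, s ≠ t := by simp [ae_iff, measure_singleton]
    filter_upwards [hb] with s hst hs
    rw [uIoc_of_le ht.1] at hs
    rw [hctrl s hs.1.le (lt_of_lt_of_le (lt_of_le_of_ne hs.2 hst) ht.2)]
  have hw : ∀ t ∈ Icc 0 (d / ε), ‖zε ε (l * d + ε * t) - zε ε (l * d + ε * 0)‖ ≤ r := by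
    intro t ht
    rw [mul_zero, add_zero]
    refine (ha.norm_sub_le hB hl (by nlinarith [ht.1] : l * d ≤ l * d + ε * t)).trans ?_
    have : ε * t ≤ d := by
      calc ε * t ≤ ε * (d / ε) := by gcongr; exact ht.2
        _ = d := hεT
    rw [lt_div_iff₀ (by positivity)] at hΔr
    nlinarith
  have := hmain (d / ε) hT (zt (l * d)) (hP.zt_mem hl) (fun t => yε ε (l * d + ε * t))
    (fun t => zε ε (l * d + ε * t)) (ha.fast.continuousOn.comp hcont hmaps)
    (ha.slow.continuousOn.comp hcont hmaps) (fun t ht => (ha.mem _ (hpos t ht)).1)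
    (fun t ht => (ha.mem _ (hpos t ht)).2) hode hw
  have havg : timeAvg (fun τ => h (uf (zt (l * d)) τ, yε ε (l * d + ε * τ), zε ε (l * d + ε * τ)))
      (d / ε) = d⁻¹ * ∫ t in (l * d)..(l * d + d), h (uε ε t, yε ε t, zε ε t) := by
    have h2 := intervalIntegral.integral_comp_add_mul (a := 0) (b := d / ε)
      (fun s => h (uε ε s, yε ε s, zε ε s)) hε.ne' (l * d)
    rw [mul_zero, add_zero, hεT] at h2
    rw [timeAvg]
    have h3 : ∫ τ in (0 : ℝ)..(d / ε), h (uf (zt (l * d)) τ, yε ε (l * d + ε * τ),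
        zε ε (l * d + ε * τ)) = ∫ τ in (0 : ℝ)..(d / ε), h (uε ε (l * d + ε * τ),
        yε ε (l * d + ε * τ), zε ε (l * d + ε * τ)) := by
      refine intervalIntegral.integral_congr_ae ?_
      have hb : ∀ᵐ s : ℝ, s ≠ d / ε := by simp [ae_iff, measure_singleton]
      filter_upwards [hb] with s hst hs
      rw [uIoc_of_le hT0.le] at hs
      rw [hctrl s hs.1.le (lt_of_le_of_ne hs.2 hst)]
    rw [h3, h2, smul_eq_mul, ← mul_assoc]
    congr 1
    field_simp
  rw [havg, mul_zero, add_zero] at this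
  calc _ = d * |d⁻¹ * (∫ t in (l * d)..(l * d + d), h (uε ε t, yε ε t, zε ε t))
        - tilde S (fun u y z => h (u, y, z)) (μ (zt (l * d))) (zε ε (l * d))| := by
        rw [← abs_of_pos hd, ← abs_mul, abs_of_pos hd, mul_sub, mul_inv_cancel_left₀ hd.ne']
    _ ≤ d * η := by gcongr
    _ = _ := mul_comm _ _

/-- Dividing by `k + 1` is crude, but it avoids square roots and remains meaningful in dimension
zero. -/
theorem norm_le_of_forall_abs_le {k : ℕ} {v : Euc k} {c : ℝ} (hc : 0 ≤ c)
    (hv : ∀ i, |v i| ≤ c / (k + 1)) : ‖v‖ ≤ c := by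
  rw [EuclideanSpace.norm_eq]
  refine Real.sqrt_le_iff.2 ⟨hc, ?_⟩
  calc ∑ i, ‖v i‖ ^ 2 ≤ ∑ _i : Fin k, (c / (k + 1)) ^ 2 :=
        Finset.sum_le_sum fun i _ => by
          rw [Real.norm_eq_abs]; gcongr; exact hv i
    _ = k / (k + 1) ^ 2 * c ^ 2 := by simp; field_simp
    _ ≤ 1 * c ^ 2 := by
        gcongr
        rw [div_le_one (by positivity)]
        nlinarith [(Nat.cast_nonneg k : (0 : ℝ) ≤ k)]
    _ = c ^ 2 := one_mul _

theorem IsPiecewiseScheme.block_g (hs : StabilityAssumption S A₁ A₂)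
    (hP : IsPiecewiseScheme S uf yf μ zt Δ uε yε zε) {η : ℝ} (hη : 0 < η) :
    ∀ᶠ ε in 𝓝[>] (0 : ℝ), ∀ l : ℕ,
      ‖(zε ε (l * Δ ε + Δ ε) - zε ε (l * Δ ε))
        - Δ ε • tilde S S.g (μ (zt (l * Δ ε))) (zε ε (l * Δ ε))‖ ≤ η * Δ ε := by
  have hη' : 0 < η / (n + 1) := by positivity
  have hall : ∀ᶠ ε in 𝓝[>] (0 : ℝ), ∀ i : Fin n, ∀ l : ℕ,
      |(∫ t in (l * Δ ε)..(l * Δ ε + Δ ε), S.g (uε ε t) (yε ε t) (zε ε t) i)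
        - Δ ε * tilde S (fun u y z => S.g u y z i) (μ (zt (l * Δ ε))) (zε ε (l * Δ ε))|
      ≤ η / (n + 1) * Δ ε := by
    rw [eventually_all]
    intro i
    have hc : Continuous fun q : U × Euc m × Euc n => S.g q.1 q.2.1 q.2.2 i :=
      (EuclideanSpace.proj i : Euc n →L[ℝ] ℝ).continuous.comp S.continuous_g
    exact hP.block hs hc hη'
  filter_upwards [hall, hP.admissible, self_mem_nhdsWithin] with ε hε ha hε0 l
  have hd := hP.pos ε hε0
  have hl : 0 ≤ l * Δ ε := by positivity
  have hl' : 0 ≤ l * Δ ε + Δ ε := by positivity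
  refine norm_le_of_forall_abs_le (by positivity) fun i => ?_
  have h1 := hε i l
  have h2 := (EuclideanSpace.proj i : Euc n →L[ℝ] ℝ).intervalIntegral_comp_comm
    (ha.intervalIntegrable S.continuous_g hl hl')
  rw [ha.slow.eq_add hl hl', add_sub_cancel_left]
  rw [div_mul_eq_mul_div] at h1
  refine le_trans (le_of_eq ?_) h1
  rw [← tilde_g_apply]
  congr 1
  simp only [PiLp.sub_apply, PiLp.smul_apply, smul_eq_mul]
  congr 1
  exact h2.symm

theorem IsPiecewiseScheme.norm_zt_sub_le (hP : IsPiecewiseScheme S uf yf μ zt Δ uε yε zε) {B : ℝ}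
    (hB : ∀ u, ∀ y ∈ S.Y, ∀ z ∈ S.Z, ‖S.g u y z‖ ≤ B) {a b : ℝ} (h0 : 0 ≤ a) (hab : a ≤ b) :
    ‖zt b - zt a‖ ≤ B * (b - a) :=
  hP.acg.solution.1.1.norm_sub_le (fun _ ht => norm_tilde_le S (h := fun q => S.g q.1 q.2.1 q.2.2)
    (fun u y hy => hB u y hy _ (hP.zt_mem ht)) _) h0 hab

theorem IsPiecewiseScheme.intervalIntegrable_tilde
    (hP : IsPiecewiseScheme S uf yf μ zt Δ uε yε zε)
    {h : U × Euc m × Euc n → ℝ} (hh : Continuous h) {a b : ℝ} (ha : 0 ≤ a) (hb : 0 ≤ b) :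
    IntervalIntegrable (fun t => tilde S (fun u y z => h (u, y, z)) (μ (zt t)) (zt t))
      volume a b := by
  obtain ⟨B, hB0, hB⟩ := S.exists_norm_le hh
  have key : ∀ T, 0 ≤ T → IntervalIntegrable
      (fun t => tilde S (fun u y z => h (u, y, z)) (μ (zt t)) (zt t)) volume 0 T := by
    intro T hT
    rw [intervalIntegrable_iff_integrableOn_Icc_of_le hT]
    -- The path is extended to negative times by its initial value, so that it maps all of `ℝ` into
    -- the subtype `S.Z` on which measurability is assumed.
    have hc : Continuous fun t : ℝ => zt (max 0 t) :=
      hP.acg.solution.1.1.continuousOn.comp_continuous (by fun_prop) fun t => mem_Ici.2 (le_max_left _ _)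
    have hm : Measurable fun t : ℝ =>
        tilde S (fun u y z => h (u, y, z)) (μ (zt (max 0 t))) (zt (max 0 t)) :=
      (hP.acg.measurable h hh).comp
        (f := fun t : ℝ => (⟨zt (max 0 t), hP.zt_mem (le_max_left _ _)⟩ : S.Z))
        hc.measurable.subtype_mk
    refine ⟨hm.aestronglyMeasurable.congr ?_, HasFiniteIntegral.of_bounded (C := B) ?_⟩
    · filter_upwards [ae_restrict_mem measurableSet_Icc] with t ht
      rw [max_eq_right ht.1]
    · filter_upwards [ae_restrict_mem measurableSet_Icc] with t ht
      exact norm_tilde_le S (fun u y hy => hB u y hy _ (hP.zt_mem ht.1)) _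
  exact (key a ha).symm.trans (key b hb)

/-! ### The averaged system on one interval -/

open Classical in
/-- The indicator of the event that `l d` is `δ`-close to `D`. -/
noncomputable def nearIndicator (D : Set ℝ) (δ d : ℝ) (l : ℕ) : ℝ :=
  if ∃ s ∈ D, |l * d - s| < δ then 1 else 0

theorem nearIndicator_nonneg (D : Set ℝ) (δ d : ℝ) (l : ℕ) : 0 ≤ nearIndicator D δ d l := by
  unfold nearIndicator; split_ifs <;> norm_num

/-- Away from `D` the integrand varies by at most `ν(d)` through the measure and by `O(d)`-small
motion through `z`; near `D` only the trivial bound on `h` is available. The constant `B` is fixed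
before `δ` and `η`, so `δ` can later be chosen to compensate for it. -/
theorem IsPiecewiseScheme.block_averaged
    (hP : IsPiecewiseScheme S uf yf μ zt Δ uε yε zε)
    {E : Type*} [NormedAddCommGroup E] [NormedSpace ℝ E] [CompleteSpace E]
    {h : U × Euc m × Euc n → E} (hh : Continuous h) {D : Set ℝ}
    (hpc : IsPiecewiseContinuous (fun u y z => h (u, y, z)) (fun t => μ (zt t)) D)
    (hint : ∀ a b, 0 ≤ a → 0 ≤ b → IntervalIntegrable
      (fun t => tilde S (fun u y z => h (u, y, z)) (μ (zt t)) (zt t)) volume a b) :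
    ∃ B, 0 ≤ B ∧ ∀ δ > 0, ∀ η > 0, ∀ᶠ d in 𝓝[>] (0 : ℝ), ∀ l : ℕ,
      ‖(∫ t in (l * d)..(l * d + d), tilde S (fun u y z => h (u, y, z)) (μ (zt t)) (zt t))
        - d • tilde S (fun u y z => h (u, y, z)) (μ (zt (l * d))) (zt (l * d))‖
      ≤ d * (η + B * nearIndicator D δ d l) := by
  obtain ⟨B, hB0, hB⟩ := S.exists_norm_le hh
  obtain ⟨G, hG0, hG⟩ := S.exists_norm_le S.continuous_g
  obtain ⟨ν, a, hmono, hν, hcont, hunif⟩ := hpc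
  refine ⟨2 * B, by positivity, fun δ hδ η hη => ?_⟩
  obtain ⟨K, hK0, hK⟩ := S.exists_quadratic_modulus hh (η := η / 4) (by positivity)
  obtain ⟨r, hr, hra⟩ := hunif δ hδ
  have hlim : Tendsto (fun d : ℝ => K * (G * d) ^ 2) (𝓝[>] 0) (𝓝 0) := by
    have : Continuous fun d : ℝ => K * (G * d) ^ 2 := by fun_prop
    simpa using (this.tendsto 0).mono_left nhdsWithin_le_nhds
  filter_upwards [hν.eventually (gt_mem_nhds (show 0 < η / 2 by positivity)),
    hlim.eventually (gt_mem_nhds (show 0 < η / 4 by positivity)),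
    mem_nhdsWithin_of_mem_nhds (Iio_mem_nhds hr), self_mem_nhdsWithin] with d hνd hKd hdr hd l
  have hd : 0 < d := hd
  have hdr : d < r := hdr
  have hl : 0 ≤ l * d := by positivity
  have hpt : ∀ t ∈ Icc (l * d) (l * d + d),
      ‖tilde S (fun u y z => h (u, y, z)) (μ (zt t)) (zt t)
        - tilde S (fun u y z => h (u, y, z)) (μ (zt (l * d))) (zt (l * d))‖ ≤
      η + 2 * B * nearIndicator D δ d l := by
    intro t ht
    have ht0 : 0 ≤ t := hl.trans ht.1
    have hzd : ‖zt t - zt (l * d)‖ ≤ G * d :=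
      (hP.norm_zt_sub_le hG hl ht.1).trans (by gcongr; linarith [ht.2])
    have h1 : ‖tilde S (fun u y z => h (u, y, z)) (μ (zt t)) (zt t)
        - tilde S (fun u y z => h (u, y, z)) (μ (zt t)) (zt (l * d))‖ ≤ η / 2 := by
      refine norm_tilde_sub_le S hh hh (fun u y hy => ?_) _
      refine (hK u y hy _ (hP.zt_mem ht0) y hy _ (hP.zt_mem hl)).trans ?_
      have : ‖zt t - zt (l * d)‖ ^ 2 ≤ (G * d) ^ 2 := by gcongr
      rw [sub_self, norm_zero]
      nlinarith
    have h2 : ‖tilde S (fun u y z => h (u, y, z)) (μ (zt t)) (zt (l * d))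
        - tilde S (fun u y z => h (u, y, z)) (μ (zt (l * d))) (zt (l * d))‖ ≤
        η / 2 + 2 * B * nearIndicator D δ d l := by
      by_cases hnear : ∃ s ∈ D, |l * d - s| < δ
      · rw [nearIndicator, if_pos hnear]
        have hb : ∀ ν : PUY S,
            ‖tilde S (fun u y z => h (u, y, z)) ν (zt (l * d))‖ ≤ B := fun ν =>
          norm_tilde_le S (fun u y hy => hB u y hy _ (hP.zt_mem hl)) ν
        refine (norm_sub_le _ _).trans ?_
        linarith [hb (μ (zt t)), hb (μ (zt (l * d)))]
      · rw [nearIndicator, if_neg hnear, mul_zero, add_zero]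
        have hfar : ∀ s ∈ D, δ ≤ |l * d - s| := fun s hs => by
          by_contra hc
          exact hnear ⟨s, hs, not_le.1 hc⟩
        have hD : l * d ∉ D := fun hmem => by
          have := hfar _ hmem
          rw [sub_self, abs_zero] at this
          linarith
        have habs : |t - l * d| ≤ d := by
          rw [abs_of_nonneg (sub_nonneg.2 ht.1)]; linarith [ht.2]
        have h3 := (hcont _ hl hD).2 t ht0
          (lt_of_lt_of_le (lt_of_le_of_lt habs hdr) (hra _ hl hfar)) _ (hP.zt_mem hl)
        refine h3.trans ((hmono (mem_Ici.2 (abs_nonneg _)) (mem_Ici.2 hd.le) ?_).trans hνd.le)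
        rwa [abs_sub_comm]
    calc _ ≤ _ + _ := norm_sub_le_norm_sub_add_norm_sub _ _ _
      _ ≤ _ := add_le_add h1 h2
      _ = _ := by ring
  have hi := hint (l * d) (l * d + d) hl (by linarith)
  have : (∫ t in (l * d)..(l * d + d), tilde S (fun u y z => h (u, y, z)) (μ (zt t)) (zt t))
      - d • tilde S (fun u y z => h (u, y, z)) (μ (zt (l * d))) (zt (l * d)) =
      ∫ t in (l * d)..(l * d + d), (tilde S (fun u y z => h (u, y, z)) (μ (zt t)) (zt t)
        - tilde S (fun u y z => h (u, y, z)) (μ (zt (l * d))) (zt (l * d))) := by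
    rw [intervalIntegral.integral_sub hi intervalIntegrable_const,
      intervalIntegral.integral_const, add_sub_cancel_left]
  rw [this]
  have h4 := intervalIntegral.norm_integral_le_of_norm_le_const (a := l * d) (b := l * d + d)
    fun t ht => hpt t (by rw [uIoc_of_le (by linarith)] at ht; exact Ioc_subset_Icc_self ht)
  rwa [add_sub_cancel_left, abs_of_pos hd, mul_comm (η + _) d] at h4

/-! ### A Lyapunov estimate for the slow variables -/

/-- Both slow increments are Euler steps with the same measure in `W`, so `e' = e + d • (γ - γ') +
ρ`. In the expansion of the form, the cross term with `γ - γ'` gives the dissipation, `ρ` is the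
consistency error of the two block estimates, and the term quadratic in the increment is `O(d²)`. -/
theorem IsPiecewiseScheme.lyapunov_step (hs : StabilityAssumption S A₁ A₂)
    (hP : IsPiecewiseScheme S uf yf μ zt Δ uε yε zε) {D : Set ℝ}
    (hpc : IsPiecewiseContinuous S.g (fun t => μ (zt t)) D) {P : Euc n →L[ℝ] Euc n}
    (hkey : ∀ v w : Euc n, v.ofLp ⬝ᵥ (A₂ *ᵥ w.ofLp) = inner ℝ v (P w))
    (hsym : ∀ v w : Euc n, inner ℝ v (P w) = inner ℝ w (P v)) :
    ∃ K, 0 ≤ K ∧ ∀ δ > 0, ∀ η > 0, ∀ᶠ ε in 𝓝[>] (0 : ℝ), ∀ l : ℕ, ∀ e e' : Euc n,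
      e = zε ε (l * Δ ε) - zt (l * Δ ε) → e' = zε ε (l * Δ ε + Δ ε) - zt (l * Δ ε + Δ ε) →
      inner ℝ e' (P e') ≤ inner ℝ e (P e) - 2 * Δ ε * ‖e‖ ^ 2 +
        Δ ε * (η + K * nearIndicator D δ (Δ ε) l) := by
  obtain ⟨B, hB0, hB⟩ := hP.block_averaged S.continuous_g hpc
    fun a b ha hb => hP.acg.solution.1.1.intervalIntegrable ha hb
  obtain ⟨G, hG0, hG⟩ := S.exists_norm_le S.continuous_g
  obtain ⟨R, hR⟩ := (Metric.isBounded_iff.1 S.isCompact_Z.isBounded)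
  have hR0 : 0 ≤ R := dist_nonneg.trans (hR (hP.zt_mem le_rfl) (hP.zt_mem le_rfl))
  refine ⟨2 * ‖P‖ * R * B, by positivity, fun δ hδ η hη => ?_⟩
  -- The cross term with `ρ` contributes `2 * ‖P‖ * R * (2 * η')` per unit of time; the other half
  -- of `η` is reserved for the `O(d²)` term.
  have hη' : ∃ η' > 0, 4 * ‖P‖ * R * η' ≤ η / 2 := by
    refine ⟨η / 2 / (4 * ‖P‖ * R + 1), by positivity, ?_⟩
    rw [mul_div_assoc', div_le_iff₀ (by positivity)]
    nlinarith
  obtain ⟨η', hη'0, hη'⟩ := hη'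
  have hlim : Tendsto (fun ε : ℝ => 4 * ‖P‖ * G ^ 2 * Δ ε) (𝓝[>] 0) (𝓝 0) := by
    simpa using hP.zero.const_mul (4 * ‖P‖ * G ^ 2)
  filter_upwards [hP.block_g hs hη'0, hP.tendsto_Δ.eventually (hB δ hδ η' hη'0), hP.admissible,
    hlim.eventually (gt_mem_nhds (show 0 < η / 2 by positivity)), self_mem_nhdsWithin] with
    ε hg hav ha hΔ hε l e e' he he'
  have hd := hP.pos ε hε
  set d := Δ ε with hd_def
  have hl : 0 ≤ l * d := by positivity
  have hl' : 0 ≤ l * d + d := by positivity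
  have hz := (ha.mem _ hl).2
  have hzt := hP.zt_mem hl
  have h1 := hg l
  have h2 := hav l
  have hN := nearIndicator_nonneg D δ d l
  set N := nearIndicator D δ d l
  set ζ := zε ε (l * d) with hζ
  set ξ := zt (l * d) with hξ
  have hode := hP.acg.solution.1.1.eq_add hl hl'
  have h3 : ∫ t in (l * d)..(l * d + d), tilde S S.g (μ (zt t)) (zt t) =
      zt (l * d + d) - ξ := by rw [hode, add_sub_cancel_left]
  rw [h3] at h2
  set γ := tilde S S.g (μ ξ) ζ with hγ
  set γ' := tilde S S.g (μ ξ) ξ with hγ'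
  change ‖(zt (l * d + d) - ξ) - d • γ'‖ ≤ _ at h2
  set ρ := ((zε ε (l * d + d) - ζ) - d • γ) - ((zt (l * d + d) - ξ) - d • γ') with hρ
  have hρn : ‖ρ‖ ≤ d * (2 * η' + B * N) :=
    (norm_sub_le _ _).trans (by linarith)
  have hee : e' = e + (d • (γ - γ') + ρ) := by
    rw [he', he, hρ, smul_sub]; abel
  set v := d • (γ - γ') + ρ with hv
  have hvn : ‖v‖ ≤ 2 * G * d := by
    have hv' : v = (zε ε (l * d + d) - ζ) - (zt (l * d + d) - ξ) := by
      rw [hv, hρ, smul_sub]; abel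
    rw [hv']
    refine (norm_sub_le _ _).trans ?_
    have h4 := ha.norm_sub_le hG hl (by linarith : l * d ≤ l * d + d)
    have h5 := hP.norm_zt_sub_le hG hl (by linarith : l * d ≤ l * d + d)
    rw [add_sub_cancel_left] at h4 h5
    linarith
  have heR : ‖e‖ ≤ R := by rw [he, ← dist_eq_norm]; exact hR hz hzt
  have hμW : μ ξ ∈ W S := (hP.acg.generates ξ hzt).mem_W (hP.acg.admissible ξ hzt)
  have hst : (inner ℝ (γ - γ') (P e) : ℝ) ≤ -‖e‖ ^ 2 := by
    rw [← hkey, he]; exact hs.slow _ hμW ζ ξ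
  have hexp : (inner ℝ e' (P e') : ℝ) = inner ℝ e (P e) +
      2 * (d * inner ℝ (γ - γ') (P e)) + 2 * inner ℝ ρ (P e) + inner ℝ v (P v) := by
    rw [hee, map_add, inner_add_left, inner_add_right, inner_add_right, hsym e v]
    have : (inner ℝ v (P e) : ℝ) = d * inner ℝ (γ - γ') (P e) + inner ℝ ρ (P e) := by
      rw [hv, inner_add_left, real_inner_smul_left]
    rw [this]; ring
  have hρP : (inner ℝ ρ (P e) : ℝ) ≤ ‖P‖ * (d * (2 * η' + B * N)) * R := by
    refine (le_abs_self _).trans ((inner_operator_le P ρ e).trans ?_)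
    gcongr
  have hvP : (inner ℝ v (P v) : ℝ) ≤ ‖P‖ * (2 * G * d) * (2 * G * d) := by
    refine (le_abs_self _).trans ((inner_operator_le P v v).trans ?_)
    gcongr
  have h6 : d * (4 * ‖P‖ * R * η') ≤ d * (η / 2) := by gcongr
  have h7 : d * (4 * ‖P‖ * G ^ 2 * d) ≤ d * (η / 2) := by gcongr
  have h8 := mul_le_mul_of_nonneg_left hst hd.le
  rw [hexp]
  linarith

end Scheme

end SPAverage

/-! ### From single blocks to long horizons: counting, mean squares and uniform convergence. -/

namespace SPAverage

/-! ### Counting grid points close to a sparse set -/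

/-- The extreme indices `a ≤ b` satisfy `(b - a) * d < 2 * δ`, and there are at most `b - a + 1`
indices between them. -/
theorem card_filter_near_le {δ d : ℝ} (hd : 0 < d) (hδ : 0 < δ) (J : Finset ℕ) (s : ℝ) :
    d * ((J.filter fun l : ℕ => |l * d - s| < δ).card : ℝ) ≤ 2 * δ + d := by
  set F := J.filter fun l : ℕ => |l * d - s| < δ with hF
  rcases F.eq_empty_or_nonempty with h | h
  · rw [h]; simp; positivity
  · have ha := F.min'_mem h
    have hb := F.max'_mem h
    set a := F.min' h
    set b := F.max' h
    have hsub : F ⊆ Finset.Icc a b := fun l hl =>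
      Finset.mem_Icc.2 ⟨F.min'_le l hl, F.le_max' l hl⟩
    have hc := Finset.card_le_card hsub
    rw [Nat.card_Icc] at hc
    have hab : a ≤ b := F.min'_le b hb
    have hc' : (F.card : ℝ) ≤ b - a + 1 := by
      have : F.card + a ≤ b + 1 := by omega
      have : (F.card : ℝ) + a ≤ b + 1 := by exact_mod_cast this
      linarith
    have h1 := abs_lt.1 (Finset.mem_filter.1 ha).2
    have h2 := abs_lt.1 (Finset.mem_filter.1 hb).2
    calc d * (F.card : ℝ) ≤ d * (b - a + 1) := by gcongr
      _ ≤ 2 * δ + d := by linarith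

/-- Union bound over the exceptional points in `E`, each affecting blocks of total length at most `2
* δ + d`. -/
theorem sum_nearIndicator_le {D : Set ℝ} {δ d : ℝ} (hd : 0 < d) (hδ : 0 < δ) (J : Finset ℕ)
    (E : Finset ℝ) (hE : ∀ l ∈ J, ∀ s ∈ D, |l * d - s| < δ → s ∈ E) :
    d * ∑ l ∈ J, nearIndicator D δ d l ≤ E.card * (2 * δ + d) := by
  classical
  have h1 : ∀ l ∈ J, nearIndicator D δ d l ≤
      ∑ s ∈ E, if |(l : ℝ) * d - s| < δ then (1 : ℝ) else 0 := by
    intro l hl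
    unfold nearIndicator
    split_ifs with h
    · obtain ⟨s, hs, hls⟩ := h
      refine le_trans ?_ (Finset.single_le_sum (f := fun s =>
        if |(l : ℝ) * d - s| < δ then (1 : ℝ) else 0)
        (fun s _ => by split_ifs <;> norm_num) (hE l hl s hs hls))
      simp [hls]
    · exact Finset.sum_nonneg fun s _ => by split_ifs <;> norm_num
  calc d * ∑ l ∈ J, nearIndicator D δ d l
      ≤ d * ∑ l ∈ J, ∑ s ∈ E, (if |(l : ℝ) * d - s| < δ then (1 : ℝ) else 0) := by
        gcongr with l hl; exact h1 l hl
    _ = ∑ s ∈ E, d * ((J.filter fun l : ℕ => |l * d - s| < δ).card : ℝ) := by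
        rw [Finset.sum_comm, Finset.mul_sum]
        simp
    _ ≤ ∑ _s ∈ E, (2 * δ + d) := Finset.sum_le_sum fun s _ => card_filter_near_le hd hδ J s
    _ = _ := by rw [Finset.sum_const, nsmul_eq_mul]

theorem IsLinearlySparse.exists_sum_nearIndicator_le {D : Set ℝ} (hD : IsLinearlySparse D) :
    ∃ c, 0 ≤ c ∧ ∀ δ > 0, ∀ d > 0, ∀ L : ℕ,
      d * ∑ l ∈ Finset.range L, nearIndicator D δ d l ≤ c * (L * d + δ) * (2 * δ + d) := by
  obtain ⟨hD0, c, hc⟩ := hD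
  refine ⟨max c 0, le_max_right _ _, fun δ hδ d hd L => ?_⟩
  obtain ⟨hfin, hcard⟩ := hc (L * d + δ) (by positivity)
  refine (sum_nearIndicator_le hd hδ (Finset.range L) hfin.toFinset ?_).trans ?_
  · intro l hl s hs hls
    have h1 := abs_lt.1 hls
    have h2 : (l : ℝ) * d ≤ L * d := by
      gcongr; exact (Finset.mem_range.1 hl).le
    exact hfin.mem_toFinset.2 ⟨hs, hD0 hs, by linarith⟩
  · rw [← Set.ncard_eq_toFinset_card _ hfin]
    have : c * (L * d + δ) ≤ max c 0 * (L * d + δ) := by gcongr; exact le_max_left _ _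
    gcongr
    exact hcard.trans this

theorem IsUniformlySparse.exists_sum_nearIndicator_le {D : Set ℝ} (hD : IsUniformlySparse D)
    (hD0 : D ⊆ Ioi 0) :
    ∃ c, 0 ≤ c ∧ ∀ δ > 0, ∀ d > (0 : ℝ), ∀ l₀ L : ℕ, 1 ≤ L * d →
      d * ∑ l ∈ Finset.Ico l₀ (l₀ + L), nearIndicator D δ d l ≤
        c * (L * d + 2 * δ) * (2 * δ + d) := by
  obtain ⟨c, hc⟩ := hD
  refine ⟨max c 0, le_max_right _ _, fun δ hδ d hd l₀ L hL => ?_⟩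
  -- The window is enlarged by `δ` on both sides. Truncating its start at `0` loses nothing, since
  -- all points of `D` are positive.
  obtain ⟨hfin, hcard⟩ := hc (max 0 (l₀ * d - δ)) (le_max_left _ _) (L * d + 2 * δ) (by linarith)
  refine (sum_nearIndicator_le hd hδ _ hfin.toFinset ?_).trans ?_
  · intro l hl s hs hls
    have h1 := abs_lt.1 hls
    obtain ⟨hl1, hl2⟩ := Finset.mem_Ico.1 hl
    have h2 : (l : ℝ) * d ≤ (l₀ + L) * d := by
      gcongr; exact_mod_cast hl2.le
    have h3 : (l₀ : ℝ) * d ≤ l * d := by gcongr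
    have hs0 : 0 < s := hD0 hs
    exact hfin.mem_toFinset.2 ⟨hs, max_lt hs0 (by linarith),
      by linarith [le_max_right 0 (l₀ * d - δ)]⟩
  · rw [← Set.ncard_eq_toFinset_card _ hfin]
    have : c * (L * d + 2 * δ) ≤ max c 0 * (L * d + 2 * δ) := by gcongr; exact le_max_left _ _
    gcongr
    exact hcard.trans this

theorem abs_integral_le_sum_blocks {F : ℝ → ℝ} {d : ℝ} (hd : 0 < d)
    (hF : ∀ a b, 0 ≤ a → 0 ≤ b → IntervalIntegrable F volume a b) {c : ℕ → ℝ}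
    (hc : ∀ l : ℕ, |∫ t in (l * d)..(l * d + d), F t| ≤ c l) (L : ℕ) :
    |∫ t in (0 : ℝ)..(L * d), F t| ≤ ∑ l ∈ Finset.range L, c l := by
  induction L with
  | zero => simp
  | succ L ih =>
    have hL : 0 ≤ L * d := by positivity
    have h1 : ((L + 1 : ℕ) : ℝ) * d = L * d + d := by push_cast; ring
    rw [h1, Finset.sum_range_succ, ← intervalIntegral.integral_add_adjacent_intervals
      (hF 0 (L * d) le_rfl hL) (hF _ _ hL (by linarith))]
    exact (abs_add_le _ _).trans (add_le_add ih (hc L))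

variable {U : Type*} [MetricSpace U] [CompactSpace U] [MeasurableSpace U] [BorelSpace U]
variable {m n : ℕ} {S : SPSystem U m n}
variable {uf : Euc n → ℝ → U} {yf : Euc n → ℝ → Euc m} {μ : Euc n → PUY S}
  {zt : ℝ → Euc n} {Δ : ℝ → ℝ} {uε : ℝ → ℝ → U} {yε : ℝ → ℝ → Euc m} {zε : ℝ → ℝ → Euc n}
  {A₁ : Matrix (Fin m) (Fin m) ℝ} {A₂ : Matrix (Fin n) (Fin n) ℝ}

/-! ### Averages over long intervals -/

theorem exists_pos_mul_le {a η : ℝ} (ha : 0 ≤ a) (hη : 0 < η) : ∃ δ > 0, δ ≤ 1 ∧ a * δ ≤ η := by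
  refine ⟨min 1 (η / (a + 1)), by positivity, min_le_left _ _, ?_⟩
  calc a * min 1 (η / (a + 1)) ≤ a * (η / (a + 1)) := by gcongr; exact min_le_right _ _
    _ ≤ η := by
      rw [mul_div_assoc', div_le_iff₀ (by positivity)]
      nlinarith

/-- The mean square distance of the slow variables on the grid. -/
theorem IsPiecewiseScheme.sum_sq_le (hs : StabilityAssumption S A₁ A₂)
    (hP : IsPiecewiseScheme S uf yf μ zt Δ uε yε zε) {D : Set ℝ} (hD : IsLinearlySparse D)
    (hpc : IsPiecewiseContinuous S.g (fun t => μ (zt t)) D) {η : ℝ} (hη : 0 < η) :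
    ∀ᶠ ε in 𝓝[>] (0 : ℝ), ∀ L : ℕ,
      Δ ε * ∑ l ∈ Finset.range L, ‖zε ε (l * Δ ε) - zt (l * Δ ε)‖ ^ 2 ≤ η * (L * Δ ε + 1) := by
  obtain ⟨P, hkey, hsym, c₂, hc₂, hcP⟩ := exists_operator_of_posDef hs.posDef₂
  obtain ⟨K, hK0, hK⟩ := hP.lyapunov_step hs hpc hkey hsym
  obtain ⟨c, hc0, hc⟩ := hD.exists_sum_nearIndicator_le
  -- Once `d < δ ≤ 1`, one has `2 * δ + d ≤ 3 * δ`, so the penalty near `D` is at most `η * (L * d +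
  -- 1)`.
  obtain ⟨δ, hδ0, hδ1, hδ⟩ := exists_pos_mul_le (a := K * c * 3) (by positivity) hη
  filter_upwards [hK δ hδ0 η hη, hP.init, hP.zero.eventually (gt_mem_nhds hδ0),
    self_mem_nhdsWithin] with ε hstep hinit hΔδ hε L
  have hd := hP.pos ε hε
  set d := Δ ε
  set e : ℕ → Euc n := fun l => zε ε (l * d) - zt (l * d) with he
  -- The Lyapunov steps telescope; no initial term appears because the two slow trajectories start
  -- at the same point.
  have key : ∀ L : ℕ, inner ℝ (e L) (P (e L)) + 2 * (d * ∑ l ∈ Finset.range L, ‖e l‖ ^ 2) ≤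
      L * d * η + K * (d * ∑ l ∈ Finset.range L, nearIndicator D δ d l) := by
    intro L
    induction L with
    | zero => simp [he, hinit]
    | succ L ih =>
      have h1 : ((L + 1 : ℕ) : ℝ) * d = L * d + d := by push_cast; ring
      have := hstep L (e L) (e (L + 1)) rfl (by simp only [he, h1])
      rw [Finset.sum_range_succ, Finset.sum_range_succ, h1]
      linarith
  have h1 := key L
  have h2 : 0 ≤ (inner ℝ (e L) (P (e L)) : ℝ) := le_trans (by positivity) (hcP _)
  have h3 := hc δ hδ0 d hd L
  have hLd : 0 ≤ L * d := by positivity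
  have h4 : K * (c * (L * d + δ) * (2 * δ + d)) ≤ η * (L * d + 1) := by
    calc K * (c * (L * d + δ) * (2 * δ + d)) ≤ K * (c * (L * d + 1) * (3 * δ)) := by
          gcongr; linarith
      _ = (K * c * 3 * δ) * (L * d + 1) := by ring
      _ ≤ η * (L * d + 1) := by gcongr
  have h5 := mul_le_mul_of_nonneg_left h3 hK0
  linarith

/-- Long run averages along the singularly perturbed solutions are close to those along the
averaged solution. -/
theorem IsPiecewiseScheme.timeAvg_near (hs : StabilityAssumption S A₁ A₂)
    (hP : IsPiecewiseScheme S uf yf μ zt Δ uε yε zε) {D : Set ℝ} (hD : IsLinearlySparse D)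
    (hpc : IsPiecewiseContinuous S.g (fun t => μ (zt t)) D)
    {h : U × Euc m × Euc n → ℝ} (hh : Continuous h) {D' : Set ℝ} (hD' : IsLinearlySparse D')
    (hpc' : IsPiecewiseContinuous (fun u y z => h (u, y, z)) (fun t => μ (zt t)) D')
    {η : ℝ} (hη : 0 < η) :
    ∀ᶠ ε in 𝓝[>] (0 : ℝ), ∀ T ≥ 1,
      |timeAvg (fun t => h (uε ε t, yε ε t, zε ε t)) T
        - timeAvg (fun t => tilde S (fun u y z => h (u, y, z)) (μ (zt t)) (zt t)) T| ≤ η := by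
  obtain ⟨Bh, hBh0, hBh⟩ := S.exists_norm_le hh
  obtain ⟨B, hB0, hB⟩ := hP.block_averaged hh hpc'
    fun a b ha hb => hP.intervalIntegrable_tilde hh ha hb
  -- Six errors of this size occur: three within each block, the mean square of the slow error, the
  -- blocks near `D'`, and the last incomplete block.
  have h10 : 0 < η / 10 := by positivity
  obtain ⟨K, hK0, hK⟩ := S.exists_quadratic_modulus hh h10
  obtain ⟨c, hc0, hc⟩ := hD'.exists_sum_nearIndicator_le
  obtain ⟨δ, hδ0, hδ1, hδ⟩ := exists_pos_mul_le (a := B * c * 3 * 2) (by positivity) h10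
  obtain ⟨θ, hθ0, hθ1, hθ⟩ := exists_pos_mul_le (a := K * 2) (by positivity) h10
  have hlim : Tendsto (fun ε : ℝ => 2 * Bh * Δ ε) (𝓝[>] 0) (𝓝 0) := by
    simpa using hP.zero.const_mul (2 * Bh)
  filter_upwards [hP.block hs hh h10, hP.tendsto_Δ.eventually (hB δ hδ0 _ h10),
    hP.sum_sq_le hs hD hpc hθ0, hP.admissible, hlim.eventually (gt_mem_nhds h10),
    hP.zero.eventually (gt_mem_nhds hδ0), self_mem_nhdsWithin] with
    ε hblock hav hsum ha hΔB hΔδ hε T hT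
  have hd := hP.pos ε hε
  set d := Δ ε
  have hTpos : 0 < T := by linarith
  have hi1 : ∀ a b : ℝ, 0 ≤ a → 0 ≤ b →
      IntervalIntegrable (fun t => h (uε ε t, yε ε t, zε ε t)) volume a b :=
    fun a b h1 h2 => ha.intervalIntegrable hh h1 h2
  have hi2 : ∀ a b : ℝ, 0 ≤ a → 0 ≤ b → IntervalIntegrable
      (fun t => tilde S (fun u y z => h (u, y, z)) (μ (zt t)) (zt t)) volume a b :=
    fun a b h1 h2 => hP.intervalIntegrable_tilde hh h1 h2
  set F : ℝ → ℝ := fun t => h (uε ε t, yε ε t, zε ε t) -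
    tilde S (fun u y z => h (u, y, z)) (μ (zt t)) (zt t) with hF
  have hFi : ∀ a b, 0 ≤ a → 0 ≤ b → IntervalIntegrable F volume a b :=
    fun a b h1 h2 => (hi1 a b h1 h2).sub (hi2 a b h1 h2)
  have hblk : ∀ l : ℕ, |∫ t in (l * d)..(l * d + d), F t| ≤
      d * (3 * (η / 10)) + K * (d * ‖zε ε (l * d) - zt (l * d)‖ ^ 2) +
        B * (d * nearIndicator D' δ d l) := by
    intro l
    have hl : 0 ≤ l * d := by positivity
    rw [hF, intervalIntegral.integral_sub (hi1 _ _ hl (by linarith)) (hi2 _ _ hl (by linarith))]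
    have h1 := hblock l
    have h2 := hav l
    rw [Real.norm_eq_abs, smul_eq_mul] at h2
    have h3 : |tilde S (fun u y z => h (u, y, z)) (μ (zt (l * d))) (zε ε (l * d)) -
        tilde S (fun u y z => h (u, y, z)) (μ (zt (l * d))) (zt (l * d))| ≤
        η / 10 + K * ‖zε ε (l * d) - zt (l * d)‖ ^ 2 := by
      refine norm_tilde_sub_le S hh hh (fun u y hy => ?_) _
      have := hK u y hy _ (ha.mem _ hl).2 y hy _ (hP.zt_mem hl)
      rwa [sub_self, norm_zero, zero_pow two_ne_zero, zero_add] at this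
    have h4 := mul_le_mul_of_nonneg_left h3 hd.le
    rw [← abs_of_pos hd, ← abs_mul, abs_of_pos hd, mul_sub] at h4
    rw [abs_le] at *
    constructor <;> linarith
  set L := ⌊T / d⌋₊ with hL
  have hL1 : L * d ≤ T := by
    rw [← le_div_iff₀ hd]; exact Nat.floor_le (by positivity)
  have hL2 : T ≤ L * d + d := by
    have := (Nat.lt_floor_add_one (T / d)).le
    rw [div_le_iff₀ hd] at this
    linarith
  have hLd : 0 ≤ L * d := by positivity
  have hmain := abs_integral_le_sum_blocks hd hFi hblk L
  rw [Finset.sum_add_distrib, Finset.sum_add_distrib, Finset.sum_const, Finset.card_range,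
    ← Finset.mul_sum, ← Finset.mul_sum, ← Finset.mul_sum, ← Finset.mul_sum, nsmul_eq_mul] at hmain
  have hs1 := mul_le_mul_of_nonneg_left (hsum L) hK0
  have hs2 := mul_le_mul_of_nonneg_left (hc δ hδ0 d hd L) hB0
  -- Here `T ≥ 1` absorbs the additive constant, making the estimate uniform over all horizons.
  have hs3 : K * (θ * (L * d + 1)) ≤ T * (η / 10) := by
    calc K * (θ * (L * d + 1)) ≤ K * (θ * (T + T)) := by gcongr
      _ = T * (K * 2 * θ) := by ring
      _ ≤ T * (η / 10) := by gcongr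
  have hs4 : B * (c * (L * d + δ) * (2 * δ + d)) ≤ T * (η / 10) := by
    calc B * (c * (L * d + δ) * (2 * δ + d)) ≤ B * (c * (T + T) * (3 * δ)) := by
          gcongr <;> linarith
      _ = T * (B * c * 3 * 2 * δ) := by ring
      _ ≤ T * (η / 10) := by gcongr
  have hs5 : (L : ℝ) * (d * (3 * (η / 10))) ≤ T * (3 * (η / 10)) := by
    rw [← mul_assoc]; gcongr
  have hrem : |∫ t in (L * d)..T, F t| ≤ T * (η / 10) := by
    have h1 := intervalIntegral.norm_integral_le_of_norm_le_const (a := L * d) (b := T)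
      (f := F) (C := 2 * Bh) fun t ht => by
        rw [uIoc_of_le hL1] at ht
        have ht0 : 0 ≤ t := hLd.trans ht.1.le
        refine (norm_sub_le _ _).trans ?_
        have h2 := hBh (uε ε t) _ (ha.mem t ht0).1 _ (ha.mem t ht0).2
        have h3 := norm_tilde_le S (h := h) (fun u y hy => hBh u y hy _ (hP.zt_mem ht0)) (μ (zt t))
        linarith
    rw [abs_of_nonneg (sub_nonneg.2 hL1), Real.norm_eq_abs] at h1
    have h2 : 2 * Bh * (T - L * d) ≤ 2 * Bh * d := by gcongr; linarith
    nlinarith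
  have htot : |∫ t in (0 : ℝ)..T, F t| ≤ T * η := by
    rw [← intervalIntegral.integral_add_adjacent_intervals (hFi 0 (L * d) le_rfl hLd)
      (hFi _ _ hLd hTpos.le)]
    refine (abs_add_le _ _).trans ?_
    have : 0 < T * η := by positivity
    linarith
  rw [timeAvg, timeAvg, ← mul_sub, ← intervalIntegral.integral_sub (hi1 _ _ le_rfl hTpos.le)
    (hi2 _ _ le_rfl hTpos.le), abs_mul, abs_of_pos (inv_pos.2 hTpos), inv_mul_le_iff₀ hTpos]
  exact htot

/-! ### Uniform convergence of the slow variables -/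

/-- A discrete Grönwall type estimate over windows of fixed length. -/
theorem le_of_step_of_window {x b : ℕ → ℝ} {α β : ℝ} {p : ℕ} (hα0 : 0 ≤ α) (hα1 : α ≤ 1)
    (hx : ∀ l, 0 ≤ x l) (hb : ∀ l, 0 ≤ b l)
    (hstep : ∀ l, x (l + 1) ≤ (1 - α) * x l + b l)
    (hwin : ∀ l₀, ∑ l ∈ Finset.Ico l₀ (l₀ + p), b l ≤ β) (hx0 : x 0 = 0) (hp : 0 < p) :
    ∀ l, (1 - (1 - α) ^ p) * x l ≤ 2 * β := by
  have hq0 : 0 ≤ 1 - α := by linarith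
  have hq1 : 1 - α ≤ 1 := by linarith
  have hrun : ∀ l j, x (l + j) ≤ (1 - α) ^ j * x l + ∑ i ∈ Finset.Ico l (l + j), b i := by
    intro l j
    induction j with
    | zero => simp
    | succ j ih =>
      rw [← add_assoc, Finset.sum_Ico_succ_top (by omega), pow_succ]
      have hsum : 0 ≤ ∑ i ∈ Finset.Ico l (l + j), b i := Finset.sum_nonneg fun i _ => hb i
      have h1 := mul_le_mul_of_nonneg_left ih hq0
      have h2 := hstep (l + j)
      nlinarith
  have hβ : 0 ≤ β := (Finset.sum_nonneg fun i _ => hb i).trans (hwin 0)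
  set θ := (1 - α) ^ p
  have hθ0 : 0 ≤ θ := pow_nonneg hq0 _
  have hθ1 : θ ≤ 1 := pow_le_one₀ hq0 hq1
  -- At window ends the recursion is `x ≤ θ * x + β`, which preserves the bound `β / (1 - θ)`. It is
  -- kept in multiplied form because `θ = 1` is not excluded.
  have hgrid : ∀ k : ℕ, (1 - θ) * x (k * p) ≤ β := by
    intro k
    induction k with
    | zero => simpa [hx0] using hβ
    | succ k ih =>
      have h1 := (hrun (k * p) p).trans (add_le_add_right (hwin (k * p)) _)
      rw [add_mul, one_mul]
      nlinarith [mul_le_mul_of_nonneg_left h1 (sub_nonneg.2 hθ1), hx (k * p)]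
  intro l
  -- Fewer than `p` further steps lead from the last window end to `l` and add at most another `β`.
  have hl : l = (l / p) * p + l % p := by rw [mul_comm]; exact (Nat.div_add_mod l p).symm
  have h1 := hrun ((l / p) * p) (l % p)
  rw [← hl] at h1
  have h2 : ∑ i ∈ Finset.Ico ((l / p) * p) l, b i ≤ β := by
    refine le_trans (Finset.sum_le_sum_of_subset_of_nonneg ?_ fun i _ _ => hb i)
      (hwin ((l / p) * p))
    refine Finset.Ico_subset_Ico le_rfl ?_
    have := Nat.mod_lt l hp
    omega
  have h3 : (1 - α) ^ (l % p) ≤ 1 := pow_le_one₀ hq0 hq1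
  have h4 : x l ≤ x ((l / p) * p) + β := by
    have := mul_le_mul_of_nonneg_right h3 (hx ((l / p) * p))
    linarith
  have h5 := mul_le_mul_of_nonneg_left h4 (sub_nonneg.2 hθ1)
  nlinarith [hgrid (l / p)]

/-- The dissipation dominates a multiple of the form, so each block contracts by `1 - a * d`, and a
window of time length at least one contracts by `θ = exp (-a)`, independently of `ε`. Uniform
sparsity bounds the forcing in every such window, wherever it starts. -/
theorem IsPiecewiseScheme.tendstoUniformlyOn (hs : StabilityAssumption S A₁ A₂)
    (hP : IsPiecewiseScheme S uf yf μ zt Δ uε yε zε) {D : Set ℝ} (hD0 : D ⊆ Ioi 0)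
    (hD : IsUniformlySparse D)
    (hpc : IsPiecewiseContinuous S.g (fun t => μ (zt t)) D) :
    TendstoUniformlyOn zε zt (𝓝[>] 0) (Ici 0) := by
  obtain ⟨P, hkey, hsym, c₂, hc₂, hcP⟩ := exists_operator_of_posDef hs.posDef₂
  obtain ⟨K, hK0, hK⟩ := hP.lyapunov_step hs hpc hkey hsym
  obtain ⟨c, hc0, hc⟩ := hD.exists_sum_nearIndicator_le hD0
  obtain ⟨G, hG0, hG⟩ := S.exists_norm_le S.continuous_g
  rw [Metric.tendstoUniformlyOn_iff]
  intro η hη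
  set a : ℝ := 2 / (‖P‖ + 1) with ha_def
  have ha0 : 0 < a := by positivity
  set θ := Real.exp (-a) with hθ
  have hθ1 : 0 < 1 - θ := by
    rw [hθ, sub_pos, Real.exp_lt_one_iff]; linarith
  -- Chosen so that the Grönwall bound `(1 - θ) * c₂ * ‖e l‖ ^ 2 ≤ 2 * κ` reads `‖e l‖ ≤ η / 4`.
  set κ := (1 - θ) * c₂ * (η / 4) ^ 2 / 2 with hκ
  have hκ0 : 0 < κ := by positivity
  obtain ⟨δ, hδ0, hδ1, hδ⟩ := exists_pos_mul_le (a := K * c * 12) (by positivity)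
    (show 0 < κ / 2 by positivity)
  have hlim1 : Tendsto (fun ε : ℝ => a * Δ ε) (𝓝[>] 0) (𝓝 0) := by
    simpa using hP.zero.const_mul a
  have hlim2 : Tendsto (fun ε : ℝ => 2 * G * Δ ε) (𝓝[>] 0) (𝓝 0) := by
    simpa using hP.zero.const_mul (2 * G)
  filter_upwards [hK δ hδ0 (κ / 4) (by positivity), hP.init, hP.admissible,
    hP.zero.eventually (gt_mem_nhds hδ0), hlim1.eventually (gt_mem_nhds one_pos),
    hlim2.eventually (gt_mem_nhds (show 0 < η / 4 by positivity)),
    self_mem_nhdsWithin] with ε hstep hinit hadm hΔδ hΔa hΔG hε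
  have hd := hP.pos ε hε
  set d := Δ ε
  set e : ℕ → Euc n := fun l => zε ε (l * d) - zt (l * d) with he
  set x : ℕ → ℝ := fun l => inner ℝ (e l) (P (e l)) with hx
  -- A window then has length `p * d` between 1 and 2: the lower bound serves the contraction and
  -- the sparsity hypothesis, the upper one the total forcing.
  set p := ⌈1 / d⌉₊ with hp
  have hp1 : 1 ≤ p * d := by rw [← div_le_iff₀ hd]; exact Nat.le_ceil _
  have hp2 : p * d ≤ 2 := by
    have := (Nat.ceil_lt_add_one (show 0 ≤ 1 / d by positivity)).le
    rw [← hp] at this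
    calc p * d ≤ (1 / d + 1) * d := by gcongr
      _ = 1 + d := by field_simp
      _ ≤ 2 := by linarith
  have hp0 : 0 < p := Nat.ceil_pos.2 (by positivity)
  have hbound := le_of_step_of_window (x := x) (α := a * d) (β := κ) (p := p)
    (b := fun l => d * (κ / 4 + K * nearIndicator D δ d l)) (by positivity) hΔa.le
    (fun l => le_trans (by positivity) (hcP _))
    (fun l => mul_nonneg hd.le (add_nonneg (by positivity)
      (mul_nonneg hK0 (nearIndicator_nonneg _ _ _ _))))
    (fun l => by
      have h1 : ((l + 1 : ℕ) : ℝ) * d = l * d + d := by push_cast; ring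
      have h2 := hstep l (e l) (e (l + 1)) rfl (by simp only [he, h1])
      have h3 : a * x l ≤ 2 * ‖e l‖ ^ 2 := by
        have h4 := (le_abs_self _).trans (inner_operator_le P (e l) (e l))
        rw [ha_def, div_mul_eq_mul_div, div_le_iff₀ (by positivity)]
        nlinarith [sq_nonneg ‖e l‖]
      have h5 := mul_le_mul_of_nonneg_right h3 hd.le
      simp only [hx] at h5 ⊢
      linarith)
    (fun l₀ => by
      rw [← Finset.mul_sum, Finset.sum_add_distrib, ← Finset.mul_sum, Finset.sum_const,
        Nat.card_Ico, Nat.add_sub_cancel_left, nsmul_eq_mul]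
      have h1 := mul_le_mul_of_nonneg_left (hc δ hδ0 d hd l₀ p hp1) hK0
      have h2 : K * (c * (p * d + 2 * δ) * (2 * δ + d)) ≤ κ / 2 := by
        calc K * (c * (p * d + 2 * δ) * (2 * δ + d)) ≤ K * (c * (2 + 2) * (3 * δ)) := by
              gcongr <;> linarith
          _ = K * c * 12 * δ := by ring
          _ ≤ κ / 2 := hδ
      nlinarith)
    (by simp [hx, he, hinit]) hp0
  have hpow : (1 - a * d) ^ p ≤ θ := by
    calc (1 - a * d) ^ p ≤ (Real.exp (-(a * d))) ^ p := by
          gcongr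
          linarith [Real.add_one_le_exp (-(a * d))]
      _ = Real.exp (-(a * (p * d))) := by rw [← Real.exp_nat_mul]; congr 1; ring
      _ ≤ θ := by
          rw [hθ]
          refine Real.exp_le_exp.2 (neg_le_neg ?_)
          nlinarith
  have hel : ∀ l, ‖e l‖ ≤ η / 4 := by
    intro l
    have h1 := hbound l
    have h2 : c₂ * ‖e l‖ ^ 2 ≤ x l := hcP (e l)
    have h3 : (1 - θ) * (c₂ * ‖e l‖ ^ 2) ≤ 2 * κ := by
      refine le_trans ?_ h1
      have h5 : 0 ≤ c₂ * ‖e l‖ ^ 2 := by positivity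
      calc (1 - θ) * (c₂ * ‖e l‖ ^ 2) ≤ (1 - (1 - a * d) ^ p) * (c₂ * ‖e l‖ ^ 2) := by gcongr
        _ ≤ _ := by
          refine mul_le_mul_of_nonneg_left h2 ?_
          linarith
    have h4 : ‖e l‖ ^ 2 ≤ (η / 4) ^ 2 := by
      have h6 : (0 : ℝ) < (1 - θ) * c₂ := by positivity
      refine le_of_mul_le_mul_left ?_ h6
      rw [hκ] at h3
      linarith
    exact (pow_le_pow_iff_left₀ (norm_nonneg _) (by positivity) two_ne_zero).1 h4
  -- Between grid points each trajectory moves by at most `G * d`, which is added to the grid error.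
  intro t ht
  have ht0 : (0 : ℝ) ≤ t := ht
  set l := ⌊t / d⌋₊
  have hl1 : l * d ≤ t := by
    rw [← le_div_iff₀ hd]; exact Nat.floor_le (by positivity)
  have hl2 : t ≤ l * d + d := by
    have := (Nat.lt_floor_add_one (t / d)).le
    rw [div_le_iff₀ hd] at this
    linarith
  have hl : 0 ≤ l * d := by positivity
  have h1 := hadm.norm_sub_le hG hl hl1
  have h2 := hP.norm_zt_sub_le hG hl hl1
  have h3 : G * (t - l * d) ≤ G * d := by gcongr; linarith
  have h4 := hel l
  rw [dist_comm, dist_eq_norm]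
  have h5 : zε ε t - zt t = (zε ε t - zε ε (l * d)) - (zt t - zt (l * d)) + e l := by
    simp only [he]; abel
  rw [h5]
  refine lt_of_le_of_lt ((norm_add_le _ _).trans (add_le_add_left (norm_sub_le _ _) _)) ?_
  linarith

end SPAverage

/-! ### The averaged LP value as a lower bound for the singularly perturbed values. -/

namespace SPAverage

/-! ### Long run averages of bounded functions -/

theorem liminf_timeAvg_mem_Icc {h : ℝ → ℝ} {B : ℝ} (hB : ∀ t, 0 ≤ t → |h t| ≤ B) :
    liminf (timeAvg h) atTop ∈ Icc (-B) B := by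
  have hev : ∀ᶠ T in atTop, |timeAvg h T| ≤ B := by
    filter_upwards [eventually_gt_atTop (0 : ℝ)] with T hT
    exact abs_timeAvg_le hT fun t ht _ => hB t ht
  have h1 : IsBoundedUnder (· ≤ ·) atTop (timeAvg h) :=
    isBoundedUnder_of_eventually_le (hev.mono fun T hT => (abs_le.1 hT).2)
  have h2 : IsBoundedUnder (· ≥ ·) atTop (timeAvg h) :=
    isBoundedUnder_of_eventually_ge (hev.mono fun T hT => (abs_le.1 hT).1)
  refine ⟨le_liminf_of_le h1.isCoboundedUnder_ge (hev.mono fun T hT => (abs_le.1 hT).1), ?_⟩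
  exact liminf_le_of_frequently_le (hev.mono fun T hT => (abs_le.1 hT).2).frequently h2

theorem frequently_timeAvg_lt {h : ℝ → ℝ} {B a : ℝ} (hB : ∀ t, 0 ≤ t → |h t| ≤ B)
    (ha : liminf (timeAvg h) atTop < a) : ∃ᶠ T in atTop, timeAvg h T < a := by
  have hev : ∀ᶠ T in atTop, |timeAvg h T| ≤ B := by
    filter_upwards [eventually_gt_atTop (0 : ℝ)] with T hT
    exact abs_timeAvg_le hT fun t ht _ => hB t ht
  have h1 : IsBoundedUnder (· ≤ ·) atTop (timeAvg h) :=
    isBoundedUnder_of_eventually_le (hev.mono fun T hT => (abs_le.1 hT).2)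
  exact frequently_lt_of_liminf_lt h1.isCoboundedUnder_ge ha

variable {U : Type*} [MetricSpace U] [CompactSpace U] [MeasurableSpace U] [BorelSpace U]
variable {m n : ℕ} {S : SPSystem U m n}

/-! ### Occupational measures on finite intervals -/

/-- The measure is the image of normalized Lebesgue measure on `(0, T]` under the triplet. A finite
horizon suffices, so no long run limit along the triplet is needed. -/
theorem IsAdmissibleSP.exists_occupational {ε : ℝ} {u : ℝ → U} {y : ℝ → Euc m} {z : ℝ → Euc n}
    (ha : IsAdmissibleSP S ε u y z) {T : ℝ} (hT : 0 < T) :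
    ∃ γ : ProbabilityMeasure (U × S.Y × S.Z), ∀ h : U × Euc m × Euc n → ℝ, Continuous h →
      ∫ q : U × S.Y × S.Z, h (q.1, q.2.1, q.2.2) ∂(γ : Measure (U × S.Y × S.Z)) =
        timeAvg (fun t => h (u t, y t, z t)) T := by
  set ν : Measure ℝ := (ENNReal.ofReal T)⁻¹ • volume.restrict (Ioc 0 T) with hν
  have hT' : ENNReal.ofReal T ≠ 0 := by simpa using hT
  have hprob : IsProbabilityMeasure ν := ⟨by
    simp [hν, ENNReal.inv_mul_cancel hT' ENNReal.ofReal_ne_top]⟩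
  have hyc : Continuous fun t : ℝ => y (max 0 t) :=
    ha.fast.continuousOn.comp_continuous (by fun_prop) fun t => mem_Ici.2 (le_max_left _ _)
  have hzc : Continuous fun t : ℝ => z (max 0 t) :=
    ha.slow.continuousOn.comp_continuous (by fun_prop) fun t => mem_Ici.2 (le_max_left _ _)
  set X : ℝ → U × S.Y × S.Z := fun t => (u t, ⟨y (max 0 t), (ha.mem _ (le_max_left _ _)).1⟩,
    ⟨z (max 0 t), (ha.mem _ (le_max_left _ _)).2⟩) with hX
  have hu : AEMeasurable u (volume.restrict (Ioc 0 T)) :=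
    ha.measurable_control.mono_measure (Measure.restrict_mono (fun t ht => ht.1.le) le_rfl)
  have hXm : AEMeasurable X ν := by
    refine AEMeasurable.smul_measure (hu.prodMk ?_) _
    exact (hyc.measurable.subtype_mk.prodMk hzc.measurable.subtype_mk).aemeasurable
  refine ⟨⟨ν.map X, Measure.isProbabilityMeasure_map hXm⟩, fun h hh => ?_⟩
  have hc : Continuous fun q : U × S.Y × S.Z => h (q.1, q.2.1, q.2.2) := by fun_prop
  change ∫ q, _ ∂(ν.map X) = _
  rw [integral_map hXm hc.aestronglyMeasurable, hν, integral_smul_measure, timeAvg,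
    intervalIntegral.integral_of_le hT.le, ENNReal.toReal_inv, ENNReal.toReal_ofReal hT.le,
    smul_eq_mul]
  congr 1
  refine setIntegral_congr_fun measurableSet_Ioc fun t ht => ?_
  simp only [hX, max_eq_right ht.1.le]

theorem IsPrimitive.prodMk {E F : Type*} [NormedAddCommGroup E] [NormedSpace ℝ E]
    [NormedAddCommGroup F] [NormedSpace ℝ F] [CompleteSpace E] [CompleteSpace F]
    {v x : ℝ → E} {w y : ℝ → F}
    (hx : IsPrimitive v x) (hy : IsPrimitive w y) :
    IsPrimitive (fun t => (v t, w t)) fun t => (x t, y t) := by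
  intro t ht
  have h1 := (hx t ht).1
  have h2 := (hy t ht).1
  rw [intervalIntegrable_iff_integrableOn_Ioc_of_le ht] at *
  refine ⟨h1.prodMk h2, ?_⟩
  rw [intervalIntegral.integral_of_le ht, integral_pair h1 h2, ← intervalIntegral.integral_of_le ht,
    ← intervalIntegral.integral_of_le ht]
  exact Prod.ext (hx t ht).2 (hy t ht).2

/-- Integration of the derivative of `φ(y) χ(z)` along a triplet. -/
theorem IsAdmissibleSP.timeAvg_identity {ε : ℝ} {u : ℝ → U} {y : ℝ → Euc m} {z : ℝ → Euc n}
    (ha : IsAdmissibleSP S ε u y z) {φ : Euc m → ℝ} (hφ : ContDiff ℝ 1 φ) {χ : Euc n → ℝ}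
    (hχ : ContDiff ℝ 1 χ) {T : ℝ} (hT : 0 < T) :
    ε⁻¹ * timeAvg (fun t => χ (z t) * fderiv ℝ φ (y t) (S.f (u t) (y t))) T +
      timeAvg (fun t => φ (y t) * fderiv ℝ χ (z t) (S.g (u t) (y t) (z t))) T =
      T⁻¹ * (φ (y T) * χ (z T) - φ (y 0) * χ (z 0)) := by
  obtain ⟨B, hB0, hB⟩ := S.exists_norm_f_le
  obtain ⟨G, hG0, hG⟩ := S.exists_norm_le S.continuous_g
  have hp := ha.fast.prodMk ha.slow
  have hΦ : ContDiff ℝ 1 fun q : Euc m × Euc n => φ q.1 * χ q.2 :=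
    (hφ.comp contDiff_fst).mul (hχ.comp contDiff_snd)
  have hbd : ∀ t, 0 ≤ t → ‖(ε⁻¹ • S.f (u t) (y t), S.g (u t) (y t) (z t))‖ ≤
      max (|ε⁻¹| * B) G := by
    intro t ht
    rw [Prod.norm_mk, norm_smul, Real.norm_eq_abs]
    refine max_le_max ?_ (hG _ _ (ha.mem t ht).1 _ (ha.mem t ht).2)
    gcongr
    exact hB _ _ (ha.mem t ht).1
  have hmain := hp.integral_fderiv hbd hΦ hT.le
  have hfd : ∀ (a : Euc m) (b : Euc n) (v : Euc m) (w : Euc n),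
      fderiv ℝ (fun q : Euc m × Euc n => φ q.1 * χ q.2) (a, b) (v, w) =
        χ b * fderiv ℝ φ a v + φ a * fderiv ℝ χ b w := by
    intro a b v w
    have h1 : HasFDerivAt (fun q : Euc m × Euc n => φ q.1)
        ((fderiv ℝ φ a).comp (ContinuousLinearMap.fst ℝ (Euc m) (Euc n))) (a, b) :=
      ((hφ.differentiable one_ne_zero a).hasFDerivAt).comp (a, b) hasFDerivAt_fst
    have h2 : HasFDerivAt (fun q : Euc m × Euc n => χ q.2)
        ((fderiv ℝ χ b).comp (ContinuousLinearMap.snd ℝ (Euc m) (Euc n))) (a, b) :=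
      ((hχ.differentiable one_ne_zero b).hasFDerivAt).comp (a, b) hasFDerivAt_snd
    rw [(h1.fun_mul h2).fderiv]
    simp [add_comm]
  simp only [hfd, map_smul, smul_eq_mul] at hmain
  have hc1 : Continuous fun q : U × Euc m × Euc n => χ q.2.2 * fderiv ℝ φ q.2.1 (S.f q.1 q.2.1) :=
    (hχ.continuous.comp (by fun_prop)).mul
      (((hφ.continuous_fderiv one_ne_zero).comp (by fun_prop)).clm_apply
        (S.continuous_f.comp (by fun_prop : Continuous fun q : U × Euc m × Euc n => (q.1, q.2.1))))
  have hc2 : Continuous fun q : U × Euc m × Euc n =>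
      φ q.2.1 * fderiv ℝ χ q.2.2 (S.g q.1 q.2.1 q.2.2) :=
    (hφ.continuous.comp (by fun_prop)).mul
      (((hχ.continuous_fderiv one_ne_zero).comp (by fun_prop)).clm_apply S.continuous_g)
  have hi1 := ha.intervalIntegrable hc1 le_rfl hT.le
  have hi2 := ha.intervalIntegrable hc2 le_rfl hT.le
  rw [← hmain, timeAvg, timeAvg]
  have : ∀ t, χ (z t) * (ε⁻¹ * fderiv ℝ φ (y t) (S.f (u t) (y t))) +
      φ (y t) * fderiv ℝ χ (z t) (S.g (u t) (y t) (z t)) =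
      ε⁻¹ * (χ (z t) * fderiv ℝ φ (y t) (S.f (u t) (y t))) +
      φ (y t) * fderiv ℝ χ (z t) (S.g (u t) (y t) (z t)) := fun t => by ring
  simp only [this]
  rw [intervalIntegral.integral_add (hi1.const_mul _) hi2, intervalIntegral.integral_const_mul]
  ring

/-! ### Measurability -/

variable (S) in
theorem measurable_coe_PUY : Measurable fun μ : PUY S => (μ : Measure (U × S.Y)) :=
  measurable_subtype_coe

variable (S) in
/-- The identity of `𝒫(U × Y)`, as a kernel. -/
noncomputable def evalKernel : ProbabilityTheory.Kernel (PUY S × Euc n) (U × S.Y) where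
  toFun q := (q.1 : Measure (U × S.Y))
  measurable' := (measurable_coe_PUY S).comp measurable_fst

instance : ProbabilityTheory.IsMarkovKernel (evalKernel S) :=
  ⟨fun q => inferInstanceAs (IsProbabilityMeasure (q.1 : Measure (U × S.Y)))⟩

/-- Evaluation of a measure is a Markov kernel, so `h̃` is an integral of a jointly measurable
function against a kernel. -/
theorem stronglyMeasurable_tilde {E : Type*} [NormedAddCommGroup E] [NormedSpace ℝ E]
    {h : U × Euc m × Euc n → E} (hh : Continuous h) :
    StronglyMeasurable fun q : PUY S × Euc n => tilde S (fun u y z => h (u, y, z)) q.1 q.2 := by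
  have hm : StronglyMeasurable fun p : (PUY S × Euc n) × (U × S.Y) =>
      h (p.2.1, p.2.2, p.1.2) := by
    have hc' : Continuous fun p : Euc n × (U × S.Y) => h (p.2.1, p.2.2, p.1) := by fun_prop
    exact hc'.stronglyMeasurable.comp_measurable
      (g := fun p : (PUY S × Euc n) × (U × S.Y) => (p.1.2, p.2)) (by fun_prop)
  exact hm.integral_kernel_prod_right' (κ := evalKernel S)

theorem continuous_fderiv_f {φ : Euc m → ℝ} (hφ : ContDiff ℝ 1 φ) :
    Continuous fun q : U × Euc m => fderiv ℝ φ q.2 (S.f q.1 q.2) :=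
  ((hφ.continuous_fderiv one_ne_zero).comp continuous_snd).clm_apply S.continuous_f

/-- A countable family of test functions determines `W`. -/
theorem mem_W_iff {φ : ℕ → Euc m → ℝ} (hφ : IsC1Dense φ) {μ : PUY S} :
    μ ∈ W S ↔ ∀ i, ∫ q : U × S.Y, fderiv ℝ (φ i) q.2 (S.f q.1 q.2)
      ∂(μ : Measure (U × S.Y)) = 0 := by
  refine ⟨fun h i => h _ (hφ.1 i), fun h ζ hζ => ?_⟩
  obtain ⟨B, hB0, hB⟩ := S.exists_norm_f_le
  have hint : ∀ ζ : Euc m → ℝ, ContDiff ℝ 1 ζ → Integrable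
      (fun q : U × S.Y => fderiv ℝ ζ q.2 (S.f q.1 q.2)) (μ : Measure (U × S.Y)) :=
    fun ζ hζ => integrable_of_continuous_UY S ((continuous_fderiv_f hζ).comp
      (by fun_prop : Continuous fun q : U × S.Y => (q.1, (q.2 : Euc m)))) μ
  by_contra hne
  have hpos := abs_pos.2 hne
  -- Approximating the gradient within `δ` bounds the integral by `B * δ`, at most half of its own
  -- absolute value.
  obtain ⟨δ, hδ0, -, hδ⟩ := exists_pos_mul_le hB0 (half_pos hpos)
  obtain ⟨N, c, hc⟩ := hφ.2 ζ hζ S.Y S.isCompact_Y δ hδ0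
  have hsum : ∫ q : U × S.Y, (∑ i ∈ Finset.range N, c i * fderiv ℝ (φ i) q.2 (S.f q.1 q.2))
      ∂(μ : Measure (U × S.Y)) = 0 := by
    rw [integral_finsetSum _ fun i _ => (hint _ (hφ.1 i)).const_mul _]
    refine Finset.sum_eq_zero fun i _ => ?_
    rw [integral_const_mul, h i, mul_zero]
  have hle : |∫ q : U × S.Y, fderiv ℝ ζ q.2 (S.f q.1 q.2) ∂(μ : Measure (U × S.Y))| ≤ B * δ := by
    rw [← sub_zero (∫ q : U × S.Y, fderiv ℝ ζ q.2 (S.f q.1 q.2) ∂(μ : Measure (U × S.Y))), ← hsum,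
      ← integral_sub (hint ζ hζ) (integrable_finsetSum _ fun i _ => (hint _ (hφ.1 i)).const_mul _)]
    have h2 := norm_integral_le_of_norm_le_const (μ := (μ : Measure (U × S.Y)))
      (f := fun q : U × S.Y => fderiv ℝ ζ q.2 (S.f q.1 q.2) -
        ∑ i ∈ Finset.range N, c i * fderiv ℝ (φ i) q.2 (S.f q.1 q.2)) (C := B * δ)
      (ae_of_all _ fun q => by
        have h3 := (hc q.2 q.2.2).2.le
        have h4 : fderiv ℝ ζ q.2 (S.f q.1 q.2) -
            ∑ i ∈ Finset.range N, c i * fderiv ℝ (φ i) q.2 (S.f q.1 q.2) =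
            (fderiv ℝ ζ q.2 - ∑ i ∈ Finset.range N, c i • fderiv ℝ (φ i) q.2) (S.f q.1 q.2) := by
          simp
        rw [h4, mul_comm]
        refine (ContinuousLinearMap.le_opNorm _ _).trans ?_
        gcongr
        exact hB _ _ q.2.2)
    simpa using h2
  linarith

/-- The dense sequence presents `W` as a countable intersection. Measurability is what lets a
measure concentrated on `F` be viewed as a measure on the subtype. -/
theorem measurableSet_F {φ : ℕ → Euc m → ℝ} (hφ : IsC1Dense φ) : MeasurableSet (F S) := by
  have hW : MeasurableSet (W S) := by
    have : W S = ⋂ i, {μ : PUY S | ∫ q : U × S.Y, fderiv ℝ (φ i) q.2 (S.f q.1 q.2)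
        ∂(μ : Measure (U × S.Y)) = 0} := by
      ext μ
      rw [mem_W_iff hφ, mem_iInter]
      rfl
    rw [this]
    refine MeasurableSet.iInter fun i => ?_
    have h1 := (stronglyMeasurable_tilde (S := S) (h := fun q : U × Euc m × Euc n =>
      fderiv ℝ (φ i) q.2.1 (S.f q.1 q.2.1)) ((continuous_fderiv_f (hφ.1 i)).comp
      (by fun_prop : Continuous fun q : U × Euc m × Euc n => (q.1, q.2.1)))).measurable.comp
      (g := _) (f := fun μ : PUY S => (μ, (0 : Euc n))) (by fun_prop)
    exact h1 (measurableSet_singleton 0)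
  exact (measurable_fst hW).inter (measurable_snd S.isCompact_Z.measurableSet)

/-! ### Disintegration of limit occupational measures -/

/-- The cost of a limit occupational measure is at least the value of the averaged LP problem. -/
theorem valueLP_le_of_limit_measure {φ : ℕ → Euc m → ℝ} (hφ : IsC1Dense φ)
    (γ : ProbabilityMeasure (U × S.Y × S.Z))
    (hf : ∀ i, ∀ χ : Euc n → ℝ, ContDiff ℝ 1 χ →
      ∫ q : U × S.Y × S.Z, χ q.2.2 * fderiv ℝ (φ i) q.2.1 (S.f q.1 q.2.1)
        ∂(γ : Measure (U × S.Y × S.Z)) = 0)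
    (hg : ∀ χ : Euc n → ℝ, ContDiff ℝ 1 χ →
      ∫ q : U × S.Y × S.Z, fderiv ℝ χ q.2.2 (S.g q.1 q.2.1 q.2.2)
        ∂(γ : Measure (U × S.Y × S.Z)) = 0) :
    valueLP S ≤ ∫ q : U × S.Y × S.Z, S.G q.1 q.2.1 q.2.2 ∂(γ : Measure (U × S.Y × S.Z)) := by
  have hne : Nonempty (U × S.Y × S.Z) := (γ : Measure (U × S.Y × S.Z)).nonempty_of_neZero
  have hne' : Nonempty (U × S.Y) := ⟨(hne.some.1, hne.some.2.1)⟩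
  have : PolishSpace S.Y := S.isCompact_Y.isClosed.polishSpace
  have hmz : Measurable fun q : U × S.Y × S.Z => ((q.2.2 : Euc n), (q.1, q.2.1)) := by fun_prop
  -- The slow variable is put first and taken in all of `ℝⁿ`, so that conditioning on it can be
  -- tested with smooth functions on `ℝⁿ`.
  set γ' : Measure (Euc n × (U × S.Y)) :=
    (γ : Measure (U × S.Y × S.Z)).map fun q => ((q.2.2 : Euc n), (q.1, q.2.1)) with hγ'
  have : IsProbabilityMeasure γ' := Measure.isProbabilityMeasure_map hmz.aemeasurable
  set σ := γ'.fst with hσ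
  set κ := γ'.condKernel with hκ
  have hZ : ∀ᵐ z ∂σ, z ∈ S.Z := by
    rw [hσ, Measure.fst, hγ', Measure.map_map measurable_fst hmz]
    refine (ae_map_iff (measurable_fst.comp hmz).aemeasurable
      S.isCompact_Z.measurableSet).2 (ae_of_all _ fun q => ?_)
    exact q.2.2.2
  -- integrals against `γ` as iterated integrals
  have hdis : ∀ h : U × Euc m × Euc n → ℝ, Continuous h →
      Integrable (fun z => ∫ q : U × S.Y, h (q.1, q.2, z) ∂(κ z)) σ ∧
      ∫ z, ∫ q : U × S.Y, h (q.1, q.2, z) ∂(κ z) ∂σ =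
        ∫ q : U × S.Y × S.Z, h (q.1, q.2.1, q.2.2) ∂(γ : Measure (U × S.Y × S.Z)) := by
    intro h hh
    have hc : Continuous fun p : Euc n × (U × S.Y) => h (p.2.1, p.2.2, p.1) := by fun_prop
    obtain ⟨B, hB0, hB⟩ := S.exists_norm_le hh
    have hi : Integrable (fun p : Euc n × (U × S.Y) => h (p.2.1, p.2.2, p.1)) γ' := by
      rw [hγ', integrable_map_measure hc.aestronglyMeasurable hmz.aemeasurable]
      exact ⟨(hc.stronglyMeasurable.comp_measurable hmz).aestronglyMeasurable,
        HasFiniteIntegral.of_bounded (C := B) (ae_of_all _ fun q => hB _ _ q.2.1.2 _ q.2.2.2)⟩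
    refine ⟨hi.integral_condKernel, ?_⟩
    rw [hσ, hκ, Measure.integral_condKernel hi, hγ',
      integral_map hmz.aemeasurable hc.aestronglyMeasurable]
  set Kz : Euc n → PUY S := fun z => ⟨κ z, inferInstance⟩ with hKz
  have hKm : Measurable Kz := κ.measurable.subtype_mk
  have hW : ∀ᵐ z ∂σ, Kz z ∈ W S := by
    have hall : ∀ᵐ z ∂σ, ∀ i, ∫ q : U × S.Y, fderiv ℝ (φ i) q.2 (S.f q.1 q.2) ∂(κ z) = 0 := by
      rw [ae_all_iff]
      intro i
      have hc : Continuous fun q : U × Euc m × Euc n => fderiv ℝ (φ i) q.2.1 (S.f q.1 q.2.1) :=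
        (continuous_fderiv_f (hφ.1 i)).comp
          (by fun_prop : Continuous fun q : U × Euc m × Euc n => (q.1, q.2.1))
      -- The factor `χ(z)` in the hypothesis localizes in `z`: a function whose integral against
      -- every smooth compactly supported weight vanishes is zero almost everywhere.
      refine ae_eq_zero_of_integral_contDiff_smul_eq_zero (hdis _ hc).1.locallyIntegrable
        fun χ hχ _ => ?_
      have hχ1 : ContDiff ℝ 1 χ := hχ.of_le (by exact_mod_cast le_top)
      have h1 := (hdis (fun q => χ q.2.2 * fderiv ℝ (φ i) q.2.1 (S.f q.1 q.2.1))
        ((hχ.continuous.comp (by fun_prop)).mul hc)).2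
      rw [← hf i χ hχ1, ← h1]
      refine integral_congr_ae (ae_of_all _ fun z => ?_)
      exact (integral_const_mul _ _).symm
    filter_upwards [hall] with z hz
    exact (mem_W_iff hφ).2 hz
  have hpair : Measurable fun z : Euc n => (Kz z, z) := hKm.prodMk measurable_id
  -- The LP candidate is the law of `(conditional measure at z, z)` under the slow marginal.
  set p' : Measure (PUY S × Euc n) := σ.map fun z => (Kz z, z) with hp'
  have hFm := measurableSet_F (S := S) hφ
  have hp'F : ∀ᵐ q ∂p', q ∈ F S := by
    refine (ae_map_iff hpair.aemeasurable hFm).2 ?_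
    filter_upwards [hW, hZ] with z h1 h2 using ⟨h1, h2⟩
  have : IsProbabilityMeasure σ := by rw [hσ]; infer_instance
  have : IsProbabilityMeasure p' := Measure.isProbabilityMeasure_map hpair.aemeasurable
  have hprob : IsProbabilityMeasure (Measure.comap (Subtype.val : F S → _) p') := ⟨by
    rw [(MeasurableEmbedding.subtype_coe hFm).comap_apply, image_univ, Subtype.range_coe]
    exact prob_compl_eq_zero_iff hFm |>.1 hp'F⟩
  set p : ProbabilityMeasure (F S) := ⟨Measure.comap (Subtype.val : F S → _) p', hprob⟩
  have hpint : ∀ h : U × Euc m × Euc n → ℝ, Continuous h →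
      ∫ q : F S, tilde S (fun u y z => h (u, y, z)) q.1.1 q.1.2 ∂(p : Measure (F S)) =
        ∫ q : U × S.Y × S.Z, h (q.1, q.2.1, q.2.2) ∂(γ : Measure (U × S.Y × S.Z)) := by
    intro h hh
    have h1 := integral_subtype_comap (μ := p') hFm
      (fun q : PUY S × Euc n => tilde S (fun u y z => h (u, y, z)) q.1 q.2)
    refine h1.trans ?_
    rw [Measure.restrict_eq_self_of_ae_mem hp'F, hp', integral_map hpair.aemeasurable
      (stronglyMeasurable_tilde hh).aestronglyMeasurable]
    exact (hdis h hh).2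
  have hpW : p ∈ WAvg S := by
    intro ψ hψ
    have hc : Continuous fun q : U × Euc m × Euc n => fderiv ℝ ψ q.2.2 (S.g q.1 q.2.1 q.2.2) :=
      ((hψ.continuous_fderiv one_ne_zero).comp (by fun_prop)).clm_apply S.continuous_g
    rw [← hg ψ hψ, ← hpint _ hc]
    refine integral_congr_ae (ae_of_all _ fun q => ?_)
    exact ((fderiv ℝ ψ q.1.2).integral_comp_comm (integrable_of_continuous_UY S
      (continuous_slice S S.continuous_g q.1.2) q.1.1)).symm
  have hcost : costLP S p = ∫ q : U × S.Y × S.Z, S.G q.1 q.2.1 q.2.2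
      ∂(γ : Measure (U × S.Y × S.Z)) := hpint (fun q => S.G q.1 q.2.1 q.2.2) S.continuous_G
  rw [← hcost]
  obtain ⟨B, hB0, hB⟩ := S.exists_norm_le S.continuous_G
  refine csInf_le ⟨-B, ?_⟩ (mem_image_of_mem _ hpW)
  rintro _ ⟨r, -, rfl⟩
  have h1 := norm_integral_le_of_norm_le_const (μ := (r : Measure (F S)))
    (f := fun q : F S => tilde S S.G q.1.1 q.1.2) (C := B)
    (ae_of_all _ fun q => norm_tilde_le S (h := fun q => S.G q.1 q.2.1 q.2.2)
      (fun u y hy => hB u y hy _ q.2.2) _)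
  rw [Real.norm_eq_abs] at h1
  have h2 := (abs_le.1 h1).1
  simpa [costLP] using h2

/-! ### The lower bound for the singularly perturbed problem -/

theorem costSP_mem_Icc {B : ℝ} (hB : ∀ u, ∀ y ∈ S.Y, ∀ z ∈ S.Z, ‖S.G u y z‖ ≤ B)
    {ε : ℝ} {u : ℝ → U} {y : ℝ → Euc m} {z : ℝ → Euc n} (ha : IsAdmissibleSP S ε u y z) :
    costSP S u y z ∈ Icc (-B) B :=
  liminf_timeAvg_mem_Icc fun t ht => hB _ _ (ha.mem t ht).1 _ (ha.mem t ht).2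

/-- Weak compactness gives a limit of the finite horizon measures, and
`IsAdmissibleSP.timeAvg_identity` passes to that limit as `ε → 0` and `T → ∞`. -/
theorem valueLP_le_of_forall_exists {φ : ℕ → Euc m → ℝ} (hφ : IsC1Dense φ) {a : ℝ}
    (H : ∀ δ > 0, ∃ ε T u y z, 0 < ε ∧ ε < δ ∧ 1 / δ < T ∧ IsAdmissibleSP S ε u y z ∧
      timeAvg (fun t => S.G (u t) (y t) (z t)) T ≤ a) : valueLP S ≤ a := by
  have hk : ∀ k : ℕ, 0 < 1 / ((k : ℝ) + 1) := fun k => by positivity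
  choose! ε T u y z hε hεk hTk ha hG using fun k : ℕ => H _ (hk k)
  have hT : ∀ k, 0 < T k := fun k => lt_trans (one_div_pos.2 (hk k)) (hTk k)
  choose γ hγ using fun k => (ha k).exists_occupational (hT k)
  -- A limit along a nonprincipal ultrafilter replaces the extraction of a subsequence.
  obtain ⟨γ₀, -, hlim⟩ := (isCompact_univ
    (X := ProbabilityMeasure (U × S.Y × S.Z))).ultrafilter_le_nhds ((hyperfilter ℕ).map γ) (by simp)
  have hlim' : Tendsto γ (hyperfilter ℕ : Filter ℕ) (𝓝 γ₀) := hlim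
  have hint : ∀ h : U × Euc m × Euc n → ℝ, Continuous h →
      Tendsto (fun k => timeAvg (fun t => h (u k t, y k t, z k t)) (T k))
        (hyperfilter ℕ : Filter ℕ) (𝓝 (∫ q : U × S.Y × S.Z, h (q.1, q.2.1, q.2.2)
          ∂(γ₀ : Measure (U × S.Y × S.Z)))) := by
    intro h hh
    have hc : Continuous fun q : U × S.Y × S.Z => h (q.1, q.2.1, q.2.2) := by fun_prop
    have h1 := (ProbabilityMeasure.tendsto_iff_forall_integral_tendsto.1 hlim')
      (BoundedContinuousFunction.mkOfCompact ⟨_, hc⟩)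
    refine h1.congr fun k => ?_
    exact hγ k h hh
  have hεlim : Tendsto ε (hyperfilter ℕ : Filter ℕ) (𝓝 0) := by
    have h0 : Tendsto ε atTop (𝓝 0) := squeeze_zero (fun k => (hε k).le)
      (fun k => (hεk k).le) tendsto_one_div_add_atTop_nhds_zero_nat
    exact h0.mono_left Nat.hyperfilter_le_atTop
  have hTlim : Tendsto (fun k => (T k)⁻¹) (hyperfilter ℕ : Filter ℕ) (𝓝 0) := by
    have h0 : Tendsto (fun k => (T k)⁻¹) atTop (𝓝 0) :=
      squeeze_zero (fun k => (inv_pos.2 (hT k)).le)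
        (fun k => by
          have := hTk k
          rw [one_div_one_div] at this
          rw [← one_div]
          exact one_div_le_one_div_of_le (by positivity) this.le)
        tendsto_one_div_add_atTop_nhds_zero_nat
    exact h0.mono_left Nat.hyperfilter_le_atTop
  -- boundary terms vanish in the limit
  have hbdry : ∀ (φ : Euc m → ℝ) (χ : Euc n → ℝ), Continuous φ → Continuous χ →
      Tendsto (fun k => (T k)⁻¹ * (φ (y k (T k)) * χ (z k (T k)) - φ (y k 0) * χ (z k 0)))
        (hyperfilter ℕ : Filter ℕ) (𝓝 0) := by
    intro φ χ hφ hχ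
    obtain ⟨B, hB0, hB⟩ := S.exists_norm_le (h := fun q : U × Euc m × Euc n => φ q.2.1 * χ q.2.2)
      (by fun_prop)
    refine squeeze_zero_norm (a := fun k => (T k)⁻¹ * (2 * B)) (fun k => ?_) ?_
    · rw [norm_mul, norm_inv, Real.norm_of_nonneg (hT k).le]
      refine mul_le_mul_of_nonneg_left ((norm_sub_le _ _).trans ?_) (inv_pos.2 (hT k)).le
      have h1 := (ha k).mem (T k) (hT k).le
      have h2 := (ha k).mem 0 le_rfl
      linarith [hB (u k 0) _ h1.1 _ h1.2, hB (u k 0) _ h2.1 _ h2.2]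
    · simpa using hTlim.mul_const (2 * B)
  have hcf : ∀ φ : Euc m → ℝ, ContDiff ℝ 1 φ → ∀ χ : Euc n → ℝ, ContDiff ℝ 1 χ →
      Continuous fun q : U × Euc m × Euc n => χ q.2.2 * fderiv ℝ φ q.2.1 (S.f q.1 q.2.1) :=
    fun φ hφ χ hχ => (hχ.continuous.comp (by fun_prop)).mul ((continuous_fderiv_f hφ).comp
      (by fun_prop : Continuous fun q : U × Euc m × Euc n => (q.1, q.2.1)))
  have hcg : ∀ φ : Euc m → ℝ, ContDiff ℝ 1 φ → ∀ χ : Euc n → ℝ, ContDiff ℝ 1 χ →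
      Continuous fun q : U × Euc m × Euc n => φ q.2.1 * fderiv ℝ χ q.2.2 (S.g q.1 q.2.1 q.2.2) :=
    fun φ hφ χ hχ => (hφ.continuous.comp (by fun_prop)).mul
      (((hχ.continuous_fderiv one_ne_zero).comp (by fun_prop)).clm_apply S.continuous_g)
  refine (valueLP_le_of_limit_measure hφ γ₀ (fun i χ hχ => ?_) fun χ hχ => ?_).trans ?_
  · refine tendsto_nhds_unique (hint _ (hcf _ (hφ.1 i) χ hχ)) ?_
    -- Multiplying the identity by `ε` leaves the fast term alone on one side and quantities tending
    -- to zero on the other.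
    have h1 := hεlim.mul ((hbdry (φ i) χ (hφ.1 i).continuous hχ.continuous).sub
      (hint _ (hcg _ (hφ.1 i) χ hχ)))
    rw [zero_mul] at h1
    refine h1.congr fun k => ?_
    rw [← (ha k).timeAvg_identity (hφ.1 i) hχ (hT k), add_sub_cancel_right,
      mul_inv_cancel_left₀ (hε k).ne']
  -- With `φ = 1` the singular term disappears altogether.
  · have hc1 : ContDiff ℝ 1 fun _ : Euc m => (1 : ℝ) := contDiff_const
    have h1 := hint _ (hcg _ hc1 χ hχ)
    have h2 := hbdry (fun _ => 1) χ continuous_const hχ.continuous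
    have h3 := tendsto_nhds_unique h1 (h2.congr fun k => by
      rw [← (ha k).timeAvg_identity hc1 hχ (hT k)]
      simp [timeAvg])
    simpa using h3
  · exact le_of_tendsto (hint (fun q => S.G q.1 q.2.1 q.2.2) S.continuous_G)
      (Eventually.of_forall hG)

/-- If the values dropped below some `a < valueLP S` for arbitrarily small `ε`, triplets of cost
below `a` would have arbitrarily long horizons with average below `a`. -/
theorem valueLP_le_liminf_valueSP {φ : ℕ → Euc m → ℝ} (hφ : IsC1Dense φ)
    (hadm : ∀ᶠ ε in 𝓝[>] (0 : ℝ), ∃ u y z, IsAdmissibleSP S ε u y z) :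
    valueLP S ≤ liminf (fun ε => valueSP S ε) (𝓝[>] 0) := by
  obtain ⟨B, hB0, hB⟩ := S.exists_norm_le S.continuous_G
  have hbelow : ∀ ε, BddBelow {v | ∃ u y z, IsAdmissibleSP S ε u y z ∧ v = costSP S u y z} := by
    refine fun ε => ⟨-B, ?_⟩
    rintro _ ⟨u, y, z, ha, rfl⟩
    exact (costSP_mem_Icc hB ha).1
  have hbdd : IsBoundedUnder (· ≤ ·) (𝓝[>] (0 : ℝ)) fun ε => valueSP S ε := by
    refine isBoundedUnder_of_eventually_le (a := B) ?_
    filter_upwards [hadm] with ε ⟨u, y, z, ha⟩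
    exact (csInf_le (hbelow ε) ⟨u, y, z, ha, rfl⟩).trans (costSP_mem_Icc hB ha).2
  refine le_of_forall_lt_imp_le_of_dense fun a ha => ?_
  refine le_liminf_of_le hbdd.isCoboundedUnder_ge ?_
  by_contra hcon
  refine absurd (valueLP_le_of_forall_exists hφ (a := a) fun δ hδ => ?_) (not_le.2 ha)
  have hfreq : ∃ᶠ ε in 𝓝[>] (0 : ℝ), valueSP S ε < a := by
    simpa [not_eventually] using hcon
  obtain ⟨ε, ⟨⟨hlt, hne⟩, hεδ⟩, hε⟩ := (((hfreq.and_eventually hadm).and_eventually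
    (mem_nhdsWithin_of_mem_nhds (Iio_mem_nhds hδ))).and_eventually self_mem_nhdsWithin).exists
  -- Admissible triplets must exist here: the real infimum of an empty set is `0` and would say
  -- nothing about costs.
  obtain ⟨u₀, y₀, z₀, h₀⟩ := hne
  obtain ⟨_, ⟨u, y, z, hadm', rfl⟩, hcost⟩ := exists_lt_of_csInf_lt
    (s := {v | ∃ u y z, IsAdmissibleSP S ε u y z ∧ v = costSP S u y z})
    ⟨_, u₀, y₀, z₀, h₀, rfl⟩ hlt
  have hTf := frequently_timeAvg_lt (h := fun t => S.G (u t) (y t) (z t)) (B := B)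
    (fun t ht => hB _ _ (hadm'.mem t ht).1 _ (hadm'.mem t ht).2) hcost
  obtain ⟨T, hT, hTδ⟩ := (hTf.and_eventually (eventually_gt_atTop (1 / δ))).exists
  exact ⟨ε, T, u, y, z, hε, hεδ, hTδ, hadm', hT.le⟩

end SPAverage

/-! ### Occupational measures, weak convergence and the limits `ε → 0`. -/

namespace SPAverage

variable {U : Type*} [MetricSpace U] [CompactSpace U] [MeasurableSpace U] [BorelSpace U]
variable {m n : ℕ} {S : SPSystem U m n}

/-! ### The map `Φ` and continuity of `h̃` -/

/-- Draw `(μ, z)` from `p`, then `(u, y)` from `μ`, and take the law of `(u, y, z)`. -/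
theorem exists_isPhi (p : ProbabilityMeasure (F S)) :
    ∃ γ : ProbabilityMeasure (U × S.Y × S.Z), IsPhi S p γ := by
  set κ : ProbabilityTheory.Kernel (F S) (U × S.Y) :=
    (evalKernel S).comap Subtype.val measurable_subtype_coe with hκ
  have hm : Measurable fun q : F S × (U × S.Y) =>
      ((q.2.1, q.2.2, ⟨q.1.1.2, q.1.2.2⟩) : U × S.Y × S.Z) := by
    have h1 : Measurable fun q : F S × (U × S.Y) => (⟨q.1.1.2, q.1.2.2⟩ : S.Z) :=
      Measurable.subtype_mk (by fun_prop)
    exact (by fun_prop : Measurable fun q : F S × (U × S.Y) => q.2.1).prodMk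
      ((by fun_prop : Measurable fun q : F S × (U × S.Y) => q.2.2).prodMk h1)
  refine ⟨⟨((p : Measure (F S)).compProd κ).map _, Measure.isProbabilityMeasure_map hm.aemeasurable⟩,
    fun h hh => ?_⟩
  have hc : Continuous fun q : U × S.Y × S.Z => h (q.1, q.2.1, q.2.2) := by fun_prop
  obtain ⟨B, hB0, hB⟩ := S.exists_norm_le hh
  change ∫ q, _ ∂(((p : Measure (F S)).compProd κ).map _) = _
  rw [integral_map hm.aemeasurable hc.aestronglyMeasurable]
  rw [Measure.integral_compProd]
  · rfl
  · exact ⟨(hc.stronglyMeasurable.comp_measurable hm).aestronglyMeasurable,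
      HasFiniteIntegral.of_bounded (C := B) (ae_of_all _ fun q => hB _ _ q.2.2.2 _ q.1.2.2)⟩

/-- Currying makes `z ↦ h(·, ·, z)` continuous in the sup norm, since `U × Y` is compact. Changing
`z` therefore costs a sup norm uniformly in the measure, and changing the measure at fixed `z₀` is
weak convergence. -/
theorem continuous_tilde {h : U × Euc m × Euc n → ℝ} (hh : Continuous h) :
    Continuous fun q : PUY S × Euc n => tilde S (fun u y z => h (u, y, z)) q.1 q.2 := by
  have hc : Continuous fun p : Euc n × (U × S.Y) => h (p.2.1, p.2.2, p.1) := by fun_prop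
  set H : C(Euc n, C(U × S.Y, ℝ)) := ContinuousMap.curry ⟨_, hc⟩ with hH
  rw [continuous_iff_continuousAt]
  rintro ⟨μ₀, z₀⟩
  have h1 : Tendsto (fun q : PUY S × Euc n =>
      ∫ p, H z₀ p ∂(q.1 : Measure (U × S.Y))) (𝓝 (μ₀, z₀))
      (𝓝 (∫ p, H z₀ p ∂(μ₀ : Measure (U × S.Y)))) :=
    (ProbabilityMeasure.tendsto_iff_forall_integral_tendsto.1
      (continuous_fst.tendsto (μ₀, z₀))) (BoundedContinuousFunction.mkOfCompact (H z₀))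
  have h2 : Tendsto (fun q : PUY S × Euc n => ‖H q.2 - H z₀‖) (𝓝 (μ₀, z₀)) (𝓝 0) := by
    have : Continuous fun q : PUY S × Euc n => ‖H q.2 - H z₀‖ := by fun_prop
    simpa using this.tendsto (μ₀, z₀)
  have hint : ∀ (k : C(U × S.Y, ℝ)) (μ : PUY S), Integrable k (μ : Measure (U × S.Y)) :=
    fun k μ => integrable_of_continuous_UY S k.continuous μ
  refine tendsto_iff_norm_sub_tendsto_zero.2 (squeeze_zero (g := fun q : PUY S × Euc n =>
    ‖H q.2 - H z₀‖ + ‖(∫ p, H z₀ p ∂(q.1 : Measure (U × S.Y))) -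
      ∫ p, H z₀ p ∂(μ₀ : Measure (U × S.Y))‖) (fun _ => norm_nonneg _) (fun q => ?_) ?_)
  · have h3 : ‖(∫ p, H q.2 p ∂(q.1 : Measure (U × S.Y))) -
        ∫ p, H z₀ p ∂(q.1 : Measure (U × S.Y))‖ ≤ ‖H q.2 - H z₀‖ := by
      rw [← integral_sub (hint _ _) (hint _ _)]
      have := norm_integral_le_of_norm_le_const (μ := (q.1 : Measure (U × S.Y)))
        (f := fun p => H q.2 p - H z₀ p) (C := ‖H q.2 - H z₀‖)
        (ae_of_all _ fun p => (H q.2 - H z₀).norm_coe_le_norm p)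
      simpa using this
    exact (norm_sub_le_norm_sub_add_norm_sub _ _ _).trans (add_le_add_left h3 _)
  · have := h2.add (tendsto_iff_norm_sub_tendsto_zero.1 h1)
    simpa using this

theorem GeneratesF.tendsto_tilde {μ : ℝ → PUY S} {z : ℝ → Euc n} {p : ProbabilityMeasure (F S)}
    (hp : GeneratesF S μ z p) {h : U × Euc m × Euc n → ℝ} (hh : Continuous h) :
    Tendsto (timeAvg fun t => tilde S (fun u y z => h (u, y, z)) (μ t) (z t)) atTop
      (𝓝 (∫ q : F S, tilde S (fun u y z => h (u, y, z)) q.1.1 q.1.2 ∂(p : Measure (F S)))) :=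
  hp _ (continuous_tilde hh)

/-! ### Weak convergence and Lipschitz functions -/

/-- Weak convergence is tested by Lipschitz functions on the compact product, whereas piecewise
continuity is assumed for Lipschitz functions on the whole space. -/
theorem exists_lipschitz_extension {k : U × S.Y × S.Z → ℝ} {K : ℝ≥0} (hk : LipschitzWith K k) :
    ∃ h : U × Euc m × Euc n → ℝ, LipschitzWith K h ∧
      ∀ q : U × S.Y × S.Z, h (q.1, q.2.1, q.2.2) = k q := by
  classical
  set k' : U × Euc m × Euc n → ℝ := fun q =>
    if hq : q.2.1 ∈ S.Y ∧ q.2.2 ∈ S.Z then k (q.1, ⟨q.2.1, hq.1⟩, ⟨q.2.2, hq.2⟩) else 0 with hk'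
  have hl : LipschitzOnWith K k' (univ ×ˢ S.Y ×ˢ S.Z) := by
    refine LipschitzOnWith.of_dist_le_mul fun q hq q' hq' => ?_
    have h1 : q.2.1 ∈ S.Y ∧ q.2.2 ∈ S.Z := hq.2
    have h2 : q'.2.1 ∈ S.Y ∧ q'.2.2 ∈ S.Z := hq'.2
    simp only [hk', dif_pos h1, dif_pos h2]
    exact hk.dist_le_mul _ _
  obtain ⟨h, hh, heq⟩ := hl.extend_real
  refine ⟨h, hh, fun q => ?_⟩
  have hq : (q.1, (q.2.1 : Euc m), (q.2.2 : Euc n)) ∈ (univ : Set U) ×ˢ S.Y ×ˢ S.Z :=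
    ⟨mem_univ _, q.2.1.2, q.2.2.2⟩
  rw [← heq hq]
  exact dif_pos (⟨q.2.1.2, q.2.2.2⟩ : (q.2.1 : Euc m) ∈ S.Y ∧ (q.2.2 : Euc n) ∈ S.Z)

theorem tendsto_of_forall_lipschitz {ι : Type*} {l : Filter ι} [l.IsCountablyGenerated]
    {γ : ι → ProbabilityMeasure (U × S.Y × S.Z)} {γ₀ : ProbabilityMeasure (U × S.Y × S.Z)}
    (H : ∀ h : U × Euc m × Euc n → ℝ, (∃ K : ℝ≥0, LipschitzWith K h) →
      Tendsto (fun i => ∫ q : U × S.Y × S.Z, h (q.1, q.2.1, q.2.2)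
        ∂(γ i : Measure (U × S.Y × S.Z))) l
        (𝓝 (∫ q : U × S.Y × S.Z, h (q.1, q.2.1, q.2.2) ∂(γ₀ : Measure (U × S.Y × S.Z))))) :
    Tendsto γ l (𝓝 γ₀) := by
  rw [tendsto_iff_forall_lipschitz_integral_tendsto]
  rintro k - ⟨K, hk⟩
  obtain ⟨h, hh, heq⟩ := exists_lipschitz_extension hk
  simpa only [heq] using H h ⟨K, hh⟩

theorem GeneratesUYZ.unique {u : ℝ → U} {y : ℝ → Euc m} {z : ℝ → Euc n}
    {γ γ' : ProbabilityMeasure (U × S.Y × S.Z)} (h : GeneratesUYZ S u y z γ)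
    (h' : GeneratesUYZ S u y z γ') : γ = γ' := by
  have : Tendsto (fun _ : ℕ => γ) atTop (𝓝 γ') := by
    refine tendsto_of_forall_lipschitz fun k hk => ?_
    obtain ⟨K, hk⟩ := hk
    rw [tendsto_nhds_unique (h k hk.continuous) (h' k hk.continuous)]
    exact tendsto_const_nhds
  exact tendsto_nhds_unique tendsto_const_nhds this

theorem tendsto_rho {ι : Type*} {l : Filter ι}
    {γ : ι → ProbabilityMeasure (U × S.Y × S.Z)} {γ₀ : ProbabilityMeasure (U × S.Y × S.Z)}
    (h : Tendsto γ l (𝓝 γ₀)) : Tendsto (fun i => rho (γ i) γ₀) l (𝓝 0) := by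
  have h1 := (LevyProkhorov.continuous_ofMeasure_probabilityMeasure.tendsto γ₀).comp h
  exact tendsto_iff_dist_tendsto_zero.1 h1

/-! ### The three conclusions -/

variable {uf : Euc n → ℝ → U} {yf : Euc n → ℝ → Euc m} {μ : Euc n → PUY S}
  {zt : ℝ → Euc n} {Δ : ℝ → ℝ} {uε : ℝ → ℝ → U} {yε : ℝ → ℝ → Euc m} {zε : ℝ → ℝ → Euc n}
  {A₁ : Matrix (Fin m) (Fin m) ℝ} {A₂ : Matrix (Fin n) (Fin n) ℝ}

theorem abs_liminf_sub_le {F : ℝ → ℝ} {V η : ℝ} (h : ∀ᶠ T in atTop, |F T - V| ≤ η) :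
    |liminf F atTop - V| ≤ η := by
  have h1 : ∀ᶠ T in atTop, F T ≤ V + η := h.mono fun T hT => by linarith [(abs_le.1 hT).2]
  have h2 : ∀ᶠ T in atTop, V - η ≤ F T := h.mono fun T hT => by linarith [(abs_le.1 hT).1]
  have h3 := le_liminf_of_le (isBoundedUnder_of_eventually_le h1).isCoboundedUnder_ge h2
  have h4 := liminf_le_of_frequently_le h1.frequently (isBoundedUnder_of_eventually_ge h2)
  rw [abs_le]
  constructor <;> linarith

/-- The costs converge to the long run average of the averaged system. -/
theorem IsPiecewiseScheme.tendsto_costSP (hs : StabilityAssumption S A₁ A₂)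
    (hP : IsPiecewiseScheme S uf yf μ zt Δ uε yε zε) {D : Set ℝ} (hD : IsLinearlySparse D)
    (hpc : IsPiecewiseContinuous S.g (fun t => μ (zt t)) D)
    (hpc' : IsPiecewiseContinuous S.G (fun t => μ (zt t)) D) {V : ℝ}
    (hV : Tendsto (timeAvg fun t => tilde S S.G (μ (zt t)) (zt t)) atTop (𝓝 V)) :
    Tendsto (fun ε => costSP S (uε ε) (yε ε) (zε ε)) (𝓝[>] 0) (𝓝 V) := by
  rw [Metric.tendsto_nhds]
  intro η hη
  filter_upwards [hP.timeAvg_near hs hD hpc S.continuous_G hD hpc'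
    (show 0 < η / 3 by positivity)] with ε hε
  rw [Real.dist_eq]
  refine lt_of_le_of_lt (abs_liminf_sub_le (η := η / 3 + η / 3) ?_) (by linarith)
  filter_upwards [eventually_ge_atTop 1, Metric.tendsto_nhds.1 hV (η / 3) (by positivity)] with
    T hT hTV
  rw [Real.dist_eq] at hTV
  exact (abs_sub_le _ _ _).trans (add_le_add (hε T hT) hTV.le)

/-- The occupational measures converge to `Φ(λ)`. -/
theorem IsPiecewiseScheme.exists_rho_le (hs : StabilityAssumption S A₁ A₂)
    (hP : IsPiecewiseScheme S uf yf μ zt Δ uε yε zε) {D : Set ℝ} (hD : IsLinearlySparse D)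
    (hpc : IsPiecewiseContinuous S.g (fun t => μ (zt t)) D)
    {lam : ProbabilityMeasure (F S)} (hlam : GeneratesF S (fun t => μ (zt t)) zt lam)
    (hpc' : ∀ h : U × Euc m × Euc n → ℝ, (∃ K : ℝ≥0, LipschitzWith K h) →
      ∃ D' : Set ℝ, IsLinearlySparse D' ∧
        IsPiecewiseContinuous (fun u y z => h (u, y, z)) (fun t => μ (zt t)) D')
    {Φlam : ProbabilityMeasure (U × S.Y × S.Z)} (hΦ : IsPhi S lam Φlam) :
    ∃ κ : ℝ → ℝ, Tendsto κ (𝓝[>] 0) (𝓝 0) ∧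
      ∀ ε, ∀ γ : ProbabilityMeasure (U × S.Y × S.Z),
        GeneratesUYZ S (uε ε) (yε ε) (zε ε) γ → rho γ Φlam ≤ κ ε := by
  classical
  -- One measure is selected for each `ε`; where none is generated, the default is the limit itself,
  -- at distance zero. By uniqueness the selection is the only measure to be estimated.
  set γ' : ℝ → ProbabilityMeasure (U × S.Y × S.Z) := fun ε =>
    if h : ∃ γ, GeneratesUYZ S (uε ε) (yε ε) (zε ε) γ then h.choose else Φlam with hγ'
  refine ⟨fun ε => rho (γ' ε) Φlam, tendsto_rho (tendsto_of_forall_lipschitz fun h hh => ?_),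
    fun ε γ hγ => ?_⟩
  · obtain ⟨D', hD', hpcD'⟩ := hpc' h hh
    obtain ⟨K, hK⟩ := hh
    rw [Metric.tendsto_nhds]
    intro η hη
    filter_upwards [hP.timeAvg_near hs hD hpc hK.continuous hD' hpcD' (half_pos hη)] with ε hε
    by_cases hex : ∃ γ, GeneratesUYZ S (uε ε) (yε ε) (zε ε) γ
    · have hγε : γ' ε = hex.choose := dif_pos hex
      have h1 := hex.choose_spec h hK.continuous
      have h2 := hlam.tendsto_tilde hK.continuous
      rw [← hΦ h hK.continuous] at h2
      -- The bound holds for every `T ≥ 1`, so it survives `T → ∞` at fixed `ε`.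
      have h3 := le_of_tendsto (h1.sub h2).abs ((eventually_ge_atTop 1).mono hε)
      rw [hγε, Real.dist_eq]
      linarith
    · have hγε : γ' ε = Φlam := dif_neg hex
      rw [hγε, dist_self]
      exact hη
  · have hex : ∃ γ, GeneratesUYZ S (uε ε) (yε ε) (zε ε) γ := ⟨γ, hγ⟩
    have hγε : γ' ε = hex.choose := dif_pos hex
    rw [hγ.unique hex.choose_spec, ← hγε]

end SPAverage

/-! ### Assembly of the three conclusions. -/

open SPAverage in
theorem mainTheorem2 {U : Type*} [MetricSpace U] [CompactSpace U] [MeasurableSpace U]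
    [BorelSpace U] {m n : ℕ} (S : SPSystem U m n)
    -- the construction of the feedback from the approximating dual problems
    (C : FeedbackConstruction S)
    -- optimal solutions of the averaged and LP problems
    (μs : ℝ → PUY S) (zs : ℝ → Euc n) (ps : ProbabilityMeasure (F S))
    (us : ℝ → ℝ → U) (ys : ℝ → ℝ → Euc m)
    -- the average control generating family and the measures and trajectories it generates
    (yi : ℕ+ → ℕ+ → Euc n → Euc m) (μ : ℕ+ → ℕ+ → Euc n → PUY S)
    (zt : ℕ+ → ℕ+ → ℝ → Euc n) (lam : ℕ+ → ℕ+ → ProbabilityMeasure (F S))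
    (RQ : ℝ → ℝ) (RB : ℝ → ℝ → ℝ)
    (h_opt : OptimalPairAssumption S μs zs ps)
    (h_fast : OptimalFastAssumption S μs us ys)
    (h_acg : ACGAssumption C zs ys yi μ zt lam)
    (h_slowBall : SlowBallAssumption zs μ zt RQ)
    (h_fastBall : FastBallAssumption C zs ys RQ RB)
    (A₁ : Matrix (Fin m) (Fin m) ℝ) (A₂ : Matrix (Fin n) (Fin n) ℝ)
    (h_stab : StabilityAssumption S A₁ A₂)
    (N M : ℕ+)
    -- piecewise continuity of `t ↦ μ N M (zt N M t)`
    (D : Set ℝ) (hD : IsLinearlySparse D)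
    (h_pc_g : IsPiecewiseContinuous S.g (fun t => μ N M (zt N M t)) D)
    (h_pc_G : IsPiecewiseContinuous S.G (fun t => μ N M (zt N M t)) D)
    -- lengths of the intervals
    (Δ : ℝ → ℝ) (hΔ_pos : ∀ ε > 0, 0 < Δ ε) (hΔ_zero : Tendsto Δ (𝓝[>] 0) (𝓝 0))
    (hΔ_slow : Tendsto (fun ε => Δ ε / ε) (𝓝[>] 0) atTop)
    -- the piecewise control and the corresponding solutions of the singularly perturbed system
    (uε : ℝ → ℝ → U)
    (huε : ∀ ε t, uε ε t =
      piecewiseControl (fun z => C.ctrl N M z (yi N M z)) (zt N M) (Δ ε) ε t)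
    (yε : ℝ → ℝ → Euc m) (zε : ℝ → ℝ → Euc n) (y₀ : Euc m)
    (h_adm : ∀ᶠ ε in 𝓝[>] (0 : ℝ), IsAdmissibleSP S ε (uε ε) (yε ε) (zε ε) ∧
      yε ε 0 = y₀ ∧ zε ε 0 = zt N M 0) :
    -- asymptotic near optimality with `β = Ṽ^{N,M} - G̃*`
    (∃ V : ℝ,
      Tendsto (timeAvg fun t => tilde S S.G (μ N M (zt N M t)) (zt N M t)) atTop (𝓝 V) ∧
      IsAsymptoticallyNearOptimal S (V - valueLP S) uε yε zε) ∧
    -- uniform convergence of the slow trajectories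
    (IsUniformlySparse D → TendstoUniformlyOn zε (zt N M) (𝓝[>] 0) (Ici 0)) ∧
    -- convergence of the occupational measures
    ((∀ h : U × Euc m × Euc n → ℝ, (∃ K : ℝ≥0, LipschitzWith K h) →
        ∃ D' : Set ℝ, IsLinearlySparse D' ∧
          IsPiecewiseContinuous (fun u y z => h (u, y, z)) (fun t => μ N M (zt N M t)) D') →
      ∃ Φlam : ProbabilityMeasure (U × S.Y × S.Z), IsPhi S (lam N M) Φlam ∧
        ∃ κ : ℝ → ℝ, Tendsto κ (𝓝[>] 0) (𝓝 0) ∧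
          ∀ᶠ ε in 𝓝[>] (0 : ℝ), ∀ γ : ProbabilityMeasure (U × S.Y × S.Z),
            GeneratesUYZ S (uε ε) (yε ε) (zε ε) γ → rho γ Φlam ≤ κ ε) := by
  have hacg : IsACGFamily S (fun z => C.ctrl N M z (yi N M z)) (fun z => C.traj N M z (yi N M z))
      (μ N M) (zt N M 0) (zt N M) := by
    have h := h_acg.acg N M
    rwa [← h.solution.2] at h
  have hP : IsPiecewiseScheme S (fun z => C.ctrl N M z (yi N M z))
      (fun z => C.traj N M z (yi N M z)) (μ N M) (zt N M) Δ uε yε zε :=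
    ⟨hacg, hΔ_pos, hΔ_zero, hΔ_slow, huε, h_adm.mono fun _ h => h.1, h_adm.mono fun _ h => h.2.2⟩
  have hlam := h_acg.generates N M
  have hV := hlam.tendsto_tilde S.continuous_G
  -- The limit `V` is the integral of `G̃` against `lam N M`. As the costs converge to `V` itself,
  -- the remaining inequality is exactly the LP lower bound.
  refine ⟨⟨_, hV, hP.admissible, _, hP.tendsto_costSP h_stab hD h_pc_g h_pc_G hV, ?_⟩,
    fun hDu => hP.tendstoUniformlyOn h_stab hD.1 hDu h_pc_g, fun hpc => ?_⟩
  · have := valueLP_le_liminf_valueSP (S := S) C.dense_φ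
      (hP.admissible.mono fun ε h => ⟨_, _, _, h⟩)
    linarith
  · obtain ⟨Φlam, hΦ⟩ := exists_isPhi (lam N M)
    obtain ⟨κ, hκ, hle⟩ := hP.exists_rho_le h_stab hD h_pc_g hlam hpc hΦ
    exact ⟨Φlam, hΦ, κ, hκ, Eventually.of_forall hle⟩
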